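/- **Setting.** Let $(M,g)$ be a compact smooth Riemannian surface without boundary, $N\subset\mathbb R^k$ a smooth embedded submanifold without boundary, with second fundamental form $A_p(X,Y)=(D_XY)^{\perp}$, and let $0<\omega<\infty$. Let $u:M\times[0,\omega)\to N\subset\mathbb R^k$ be a smooth solution (for instance the maximal one) of the harmonic map heat flow $$\partial_t u=\Delta_g u-A_u(\nabla u,\nabla u),\qquad u(\cdot,0)=u_0,$$ and let $E(f)=\frac12\int_M|\nabla f|_g^2\,dV_g$. Let $p_0\in M$ and fix smooth local coordinates $x=(x^1,x^2)$ around $p_0$, defined over the closed ball $B_\delta=\{|x|\le\delta\}\subset\mathbb R^2$ ($\delta>0$), such that $p_0$ corresponds to $x=0$, $g_{ij}(0)=\delta_{ij}$, $\nabla g_{ij}(0)=0$ (e.g. normal coordinates), and, for a constant $K$, on $B_\delta$ $$K^{-1}|\xi|^2\le g_{ij}(x)\xi^i\xi^j\le K|\xi|^2,\qquad |\nabla g_{ij}(x)|\le K .$$ Let $\phi\in C^\infty(\mathbb R^2)$ satisfy $0\le\phi\le1$, $\phi=1$ on $B_{\delta/2}$, $\phi=0$ outside $B_\delta$, $|\nabla\phi|\le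 C_*\delta^{-1}$ and $|\nabla^2\phi|\le C_*\delta^{-2}$. For $s\ge-\log\omega$ and $e^{-s/2}y\in B_\delta$ put $$w(y,s)=u\big(e^{-s/2}y,\ \omega-e^{-s}\big),\qquad \widetilde g_{ij}(y,s)=g_{ij}(e^{-s/2}y),$$ where $u$ is read in the coordinates $x$, and let $\varphi(y,s)=\phi(e^{-s/2}y)$, $\rho(y)=e^{-|y|^2/4}$, $dV_{\widetilde g}=\sqrt{\det\widetilde g}\,dy$, $|\nabla w|^2_{\widetilde g}=\widetilde g^{ij}\,\partial_{y^i}w\cdot\partial_{y^j}w$, $$\mathcal E(w(s))=\frac12\int\rho\,|\nabla w|_{\widetilde g}^2\,\varphi^2\,dV_{\widetilde g},\qquad \widetilde{\mathcal E}(w(s))=\frac12\int\rho\,|y|^2\,|\nabla w|_{\widetilde g}^2\,\varphi^2\,dV_{\widetilde g},$$ the integrals being over $y\in\mathbb R^2$ (the integrands vanish where $\varphi=0$). **Proposition 2.2.** For all $\lambda>8$ and $\kappa>1$ there are constants $C$ and $s_0$, depending only on $\lambda$, $\kappa$ and on $\delta,K,C_*$ (in particular not on $p_0$, $N$, $\omega$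 or $u$), such that $$\widetilde{\mathcal E}(w(s))+\lambda\,\mathcal E(w(s))\le(1+\kappa^{-1})\Big(\widetilde{\mathcal E}(w(s'))+\lambda\,\mathcal E(w(s'))\Big)+C\,e^{-\kappa s'}E(u_0)$$ for all $s>s'\ge s_0$ with $s'\ge-\log\omega$, and $$\int_{-\log\omega}^{\infty}\int\Big(\rho\,(|y|^2+1)\,|w_s|^2\,\varphi^2+\rho\,|y|^2\,|\nabla w|_{\widetilde g}^2\,\varphi^2\Big)\,dV_{\widetilde g}\,ds\le C\,E(u_0).$$ -/

import Mathlib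

open Set MeasureTheory
open scoped Manifold ContDiff Topology

noncomputable section

/-! ## Submanifolds of Euclidean space and their second fundamental form -/

/-- `N` is an `n`-dimensional smooth (embedded) submanifold, without boundary, of `ℝᵏ`: around each
of its points some smooth local diffeomorphism of `ℝᵏ` straightens `N` to an `n`-dimensional
linear subspace. -/
def IsEmbeddedSubmanifold {k : ℕ} (n : ℕ) (N : Set (EuclideanSpace ℝ (Fin k))) : Prop :=
  ∀ p ∈ N, ∃ Φ : OpenPartialHomeomorph (EuclideanSpace ℝ (Fin k)) (EuclideanSpace ℝ (Fin k)),
    p ∈ Φ.source ∧ ContDiffOn ℝ ∞ Φ Φ.source ∧ ContDiffOn ℝ ∞ Φ.symm Φ.target ∧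
    ∃ L : Submodule ℝ (EuclideanSpace ℝ (Fin k)), Module.finrank ℝ L = n ∧
      ∀ q ∈ Φ.source, q ∈ N ↔ Φ q ∈ L

/-- The tangent space `T_p N`. For a submanifold the tangent cone already is a linear space. -/
def tangentSpaceOf {k : ℕ} (N : Set (EuclideanSpace ℝ (Fin k))) (p : EuclideanSpace ℝ (Fin k)) :
    Submodule ℝ (EuclideanSpace ℝ (Fin k)) :=
  Submodule.span ℝ (tangentConeAt ℝ N p)

/-- The second fundamental form `A_p(X, Y) = (D_X Ŷ)^⊥` of `N ⊆ ℝᵏ` for `X, Y ∈ T_p N`, where `Ŷ` is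
the tangential extension `q ↦ P_q Y` of `Y` along `N` (`P_q` the orthogonal projection onto
`T_q N`). The derivative within `N` is uniquely determined on tangent directions `X`. -/
def secondFundamentalForm {k : ℕ} (N : Set (EuclideanSpace ℝ (Fin k)))
    (p X Y : EuclideanSpace ℝ (Fin k)) : EuclideanSpace ℝ (Fin k) :=
  (tangentSpaceOf N p)ᗮ.starProjection
    (fderivWithin ℝ (fun q => (tangentSpaceOf N q).starProjection Y) N p X)

/-! ## Coordinate expressions in the plane -/

/-- The partial derivative `∂ᵢ f (x)` in `ℝ²`. -/
def pderiv2 {V : Type*} [NormedAddCommGroup V] [NormedSpace ℝ V] (i : Fin 2)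
    (f : EuclideanSpace ℝ (Fin 2) → V) (x : EuclideanSpace ℝ (Fin 2)) : V :=
  fderiv ℝ f x (EuclideanSpace.single i 1)

/-- `|∇f|²_G (x) = G^{ij} ⟨∂ᵢ f, ∂ⱼ f⟩` for a metric with coefficient matrix `G` at `x`. -/
def gradSq {k : ℕ} (G : Matrix (Fin 2) (Fin 2) ℝ)
    (f : EuclideanSpace ℝ (Fin 2) → EuclideanSpace ℝ (Fin k)) (x : EuclideanSpace ℝ (Fin 2)) : ℝ :=
  ∑ i, ∑ j, G⁻¹ i j * inner ℝ (pderiv2 i f x) (pderiv2 j f x)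

/-- The Laplace–Beltrami operator `(det G)^{-1/2} ∂ᵢ ((det G)^{1/2} G^{ij} ∂ⱼ f)` of the metric with
coefficient matrices `G`, on `ℝᵏ`-valued maps. -/
def laplaceBeltrami {k : ℕ} (G : EuclideanSpace ℝ (Fin 2) → Matrix (Fin 2) (Fin 2) ℝ)
    (f : EuclideanSpace ℝ (Fin 2) → EuclideanSpace ℝ (Fin k)) (x : EuclideanSpace ℝ (Fin 2)) :
    EuclideanSpace ℝ (Fin k) :=
  (Real.sqrt (G x).det)⁻¹ •
    ∑ i, ∑ j, pderiv2 i (fun z => (Real.sqrt (G z).det * (G z)⁻¹ i j) • pderiv2 j f z) x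

/-- The trace `A_f(∇f, ∇f) = G^{ij} A_{f}(∂ᵢ f, ∂ⱼ f)` of the second fundamental form of `N`. -/
def secondFormTrace {k : ℕ} (N : Set (EuclideanSpace ℝ (Fin k))) (G : Matrix (Fin 2) (Fin 2) ℝ)
    (f : EuclideanSpace ℝ (Fin 2) → EuclideanSpace ℝ (Fin k)) (x : EuclideanSpace ℝ (Fin 2)) :
    EuclideanSpace ℝ (Fin k) :=
  ∑ i, ∑ j, G⁻¹ i j • secondFundamentalForm N (f x) (pderiv2 i f x) (pderiv2 j f x)

/-! ## Riemannian surfaces -/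

/-- Smooth Riemannian metrics on a smooth surface. -/
abbrev SurfaceMetric (M : Type*) [TopologicalSpace M] [ChartedSpace (EuclideanSpace ℝ (Fin 2)) M]
    [IsManifold (𝓡 2) ∞ M] : Type _ :=
  Bundle.ContMDiffRiemannianMetric (𝓡 2) ∞ (EuclideanSpace ℝ (Fin 2))
    (fun x : M => TangentSpace (𝓡 2) x)

section Surface

variable {M : Type*} [TopologicalSpace M] [ChartedSpace (EuclideanSpace ℝ (Fin 2)) M]
  [IsManifold (𝓡 2) ∞ M]

/-- The coefficients `gᵢⱼ(x)` of the metric in the chart `e`, at the point with coordinates `x`. -/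
def metricMatrix (g : SurfaceMetric M) (e : OpenPartialHomeomorph M (EuclideanSpace ℝ (Fin 2)))
    (x : EuclideanSpace ℝ (Fin 2)) : Matrix (Fin 2) (Fin 2) ℝ :=
  Matrix.of fun i j => g.inner (e.symm x)
    (mfderiv (𝓡 2) (𝓡 2) e.symm x (EuclideanSpace.single i (1 : ℝ)))
    (mfderiv (𝓡 2) (𝓡 2) e.symm x (EuclideanSpace.single j (1 : ℝ)))

/-- The measure `√(det g) dx` of a coordinate patch, extended by zero to the surface. -/
def chartVolume [MeasurableSpace M] (g : SurfaceMetric M)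
    (e : OpenPartialHomeomorph M (EuclideanSpace ℝ (Fin 2))) : Measure M :=
  ((volume.restrict e.target).withDensity
    (fun x => ENNReal.ofReal (Real.sqrt (metricMatrix g e x).det))).map e.symm

/-- The Riemannian volume measure `dV_g`: the least measure dominating `√(det g) dx` in every
chart. (The patches agree on overlaps, so it restricts to `√(det g) dx` in every chart.) -/
def surfaceVolume [MeasurableSpace M] (g : SurfaceMetric M) : Measure M :=
  ⨆ e ∈ IsManifold.maximalAtlas (𝓡 2) ∞ M, chartVolume g e

/-- The energy density `e(f) = |∇f|² = g^{ij} ∂ᵢ f · ∂ⱼ f`, independent of the chart used. -/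
def energyDensity {k : ℕ} (g : SurfaceMetric M) (f : M → EuclideanSpace ℝ (Fin k)) (p : M) : ℝ :=
  gradSq (metricMatrix g (chartAt (EuclideanSpace ℝ (Fin 2)) p)
      (chartAt (EuclideanSpace ℝ (Fin 2)) p p))
    (fun z => f ((chartAt (EuclideanSpace ℝ (Fin 2)) p).symm z))
    (chartAt (EuclideanSpace ℝ (Fin 2)) p p)

/-- The Dirichlet energy `E(f) = ½ ∫_M |∇f|² dV_g`. -/
def dirichletEnergy {k : ℕ} [MeasurableSpace M] (g : SurfaceMetric M)
    (f : M → EuclideanSpace ℝ (Fin k)) : ℝ :=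
  1 / 2 * ∫ p, energyDensity g f p ∂(surfaceVolume g)

/-- `u` is a smooth solution on `M × [0, T)`, with values in `N`, of the harmonic map heat flow
`∂ₜ u = Δ_g u - A_u(∇u, ∇u)`, the equation being written in arbitrary local coordinates. -/
structure IsHarmonicHeatFlow {k : ℕ} (g : SurfaceMetric M) (N : Set (EuclideanSpace ℝ (Fin k)))
    (T : ℝ) (u : M → ℝ → EuclideanSpace ℝ (Fin k)) : Prop where
  smooth : ContMDiffOn ((𝓡 2).prod 𝓘(ℝ, ℝ)) 𝓘(ℝ, EuclideanSpace ℝ (Fin k)) ∞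
    (fun q : M × ℝ => u q.1 q.2) (univ ×ˢ Ico 0 T)
  mem_target : ∀ p, ∀ t ∈ Ico 0 T, u p t ∈ N
  equation : ∀ e ∈ IsManifold.maximalAtlas (𝓡 2) ∞ M, ∀ x ∈ e.target, ∀ t ∈ Ioo 0 T,
    deriv (fun τ => u (e.symm x) τ) t =
      laplaceBeltrami (metricMatrix g e) (fun z => u (e.symm z) t) x
        - secondFormTrace N (metricMatrix g e x) (fun z => u (e.symm z) t) x

/-- `e` is a system of smooth local coordinates about `p₀`, defined over the closed ball `B_δ`, in
which `p₀` is the origin, `gᵢⱼ(0) = δᵢⱼ` and `∇gᵢⱼ(0) = 0` (as in normal coordinates), and in which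
the metric and its first derivatives are controlled by `K` on `B_δ`. -/
structure IsNormalizedChart (g : SurfaceMetric M) (δ K : ℝ) (p₀ : M)
    (e : OpenPartialHomeomorph M (EuclideanSpace ℝ (Fin 2))) : Prop where
  mem_atlas : e ∈ IsManifold.maximalAtlas (𝓡 2) ∞ M
  mem_source : p₀ ∈ e.source
  center : e p₀ = 0
  ball_subset : Metric.closedBall 0 δ ⊆ e.target
  metric_zero : metricMatrix g e 0 = 1
  metric_deriv_zero : ∀ i j, fderiv ℝ (fun x => metricMatrix g e x i j) 0 = 0
  metric_lower : ∀ x ∈ Metric.closedBall (0 : EuclideanSpace ℝ (Fin 2)) δ, ∀ ξ : Fin 2 → ℝ,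
    K⁻¹ * ∑ i, ξ i ^ 2 ≤ ∑ i, ∑ j, metricMatrix g e x i j * ξ i * ξ j
  metric_upper : ∀ x ∈ Metric.closedBall (0 : EuclideanSpace ℝ (Fin 2)) δ, ∀ ξ : Fin 2 → ℝ,
    ∑ i, ∑ j, metricMatrix g e x i j * ξ i * ξ j ≤ K * ∑ i, ξ i ^ 2
  metric_deriv_bound : ∀ x ∈ Metric.closedBall (0 : EuclideanSpace ℝ (Fin 2)) δ, ∀ i j,
    ‖fderiv ℝ (fun z => metricMatrix g e z i j) x‖ ≤ K

/-! ## Cut-off, self-similar rescaling and weighted energies -/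

/-- `φ` is a smooth cut-off function, `1` on `B_{δ/2}` and `0` off `B_δ`, with
`0 ≤ φ ≤ 1`, `|∇φ| ≤ c δ⁻¹` and `|∇²φ| ≤ c δ⁻²`. -/
structure IsCutoff (δ c : ℝ) (φ : EuclideanSpace ℝ (Fin 2) → ℝ) : Prop where
  smooth : ContDiff ℝ ∞ φ
  eq_one : ∀ x ∈ Metric.closedBall (0 : EuclideanSpace ℝ (Fin 2)) (δ / 2), φ x = 1
  eq_zero : ∀ x ∉ Metric.closedBall (0 : EuclideanSpace ℝ (Fin 2)) δ, φ x = 0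
  nonneg : ∀ x, 0 ≤ φ x
  le_one : ∀ x, φ x ≤ 1
  grad_le : ∀ x, ‖fderiv ℝ φ x‖ ≤ c * δ⁻¹
  hess_le : ∀ x, ‖iteratedFDeriv ℝ 2 φ x‖ ≤ c * (δ ^ 2)⁻¹

/-- The rescaled solution `w(y, s) = u(e^{-s/2} y, T - e^{-s})`, where `u` is read in the
coordinates `e`. It is meaningful for `e^{-s/2} y ∈ B_δ`; elsewhere the cut-off vanishes. -/
def rescaledSolution {k : ℕ} (e : OpenPartialHomeomorph M (EuclideanSpace ℝ (Fin 2))) (T : ℝ)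
    (u : M → ℝ → EuclideanSpace ℝ (Fin k)) (y : EuclideanSpace ℝ (Fin 2)) (s : ℝ) :
    EuclideanSpace ℝ (Fin k) :=
  u (e.symm (Real.exp (-s / 2) • y)) (T - Real.exp (-s))

/-- The rescaled metric `g̃ᵢⱼ(y, s) = gᵢⱼ(e^{-s/2} y)`. -/
def rescaledMetric (g : SurfaceMetric M) (e : OpenPartialHomeomorph M (EuclideanSpace ℝ (Fin 2)))
    (y : EuclideanSpace ℝ (Fin 2)) (s : ℝ) : Matrix (Fin 2) (Fin 2) ℝ :=
  metricMatrix g e (Real.exp (-s / 2) • y)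

/-- The density `√(det g̃)` of `dV_g̃` with respect to `dy`. -/
def rescaledVolumeDensity (g : SurfaceMetric M)
    (e : OpenPartialHomeomorph M (EuclideanSpace ℝ (Fin 2)))
    (y : EuclideanSpace ℝ (Fin 2)) (s : ℝ) : ℝ :=
  Real.sqrt (rescaledMetric g e y s).det

/-- `|∇w|²_g̃ (y, s)`, the gradient being taken in `y`. -/
def rescaledGradSq {k : ℕ} (g : SurfaceMetric M)
    (e : OpenPartialHomeomorph M (EuclideanSpace ℝ (Fin 2))) (T : ℝ)
    (u : M → ℝ → EuclideanSpace ℝ (Fin k)) (y : EuclideanSpace ℝ (Fin 2)) (s : ℝ) : ℝ :=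
  gradSq (rescaledMetric g e y s) (fun z => rescaledSolution e T u z s) y

/-- The Gaussian weight `ρ(y) = e^{-|y|²/4}`. -/
def gaussWeight (y : EuclideanSpace ℝ (Fin 2)) : ℝ := Real.exp (-‖y‖ ^ 2 / 4)

/-- The expanding cut-off `φ(e^{-s/2} y)`. -/
def rescaledCutoff (φ : EuclideanSpace ℝ (Fin 2) → ℝ) (y : EuclideanSpace ℝ (Fin 2)) (s : ℝ) : ℝ :=
  φ (Real.exp (-s / 2) • y)

/-- The local energy `𝓔(w(s)) = ½ ∫ ρ |∇w|²_g̃ φ² dV_g̃`. -/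
def localEnergy {k : ℕ} (g : SurfaceMetric M)
    (e : OpenPartialHomeomorph M (EuclideanSpace ℝ (Fin 2))) (φ : EuclideanSpace ℝ (Fin 2) → ℝ)
    (T : ℝ) (u : M → ℝ → EuclideanSpace ℝ (Fin k)) (s : ℝ) : ℝ :=
  1 / 2 * ∫ y, gaussWeight y * rescaledGradSq g e T u y s * rescaledCutoff φ y s ^ 2
    * rescaledVolumeDensity g e y s

/-- The second local energy `½ ∫ ρ |y|² |∇w|²_g̃ φ² dV_g̃`. -/
def localEnergyTwo {k : ℕ} (g : SurfaceMetric M)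
    (e : OpenPartialHomeomorph M (EuclideanSpace ℝ (Fin 2))) (φ : EuclideanSpace ℝ (Fin 2) → ℝ)
    (T : ℝ) (u : M → ℝ → EuclideanSpace ℝ (Fin k)) (s : ℝ) : ℝ :=
  1 / 2 * ∫ y, gaussWeight y * ‖y‖ ^ 2 * rescaledGradSq g e T u y s * rescaledCutoff φ y s ^ 2
    * rescaledVolumeDensity g e y s

end Surface

end

noncomputable section

/-! ## Calculus of partial derivatives in the plane -/

section PartialDerivatives

variable {V : Type*} [NormedAddCommGroup V]

/-! In the variables y, s and for the flat metric the flow reads ρ w_s = div(ρ∇w) up to a vector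
normal to N. Both ∂ₜu and ∂ᵢu are tangent to N, so testing with them removes the second fundamental
form (`IsHarmonicHeatFlow.isPatchFlow`); this is why no constant depends on N. Testing with (|y|² +
λ) w_s gives d/ds (Ẽ + λE) = -∫ρ(|y|² + λ)|w_s|² - 2∫ρ w_s·(y·∇w), and testing with y·∇w gives, in
dimension two, the Pohozaev identity ∫ρ w_s·(y·∇w) = -¼∫ρ|y|²|∇w|². Together they yield d/ds (Ẽ +
λE) = -∫ρ[(|y|² + λ)|w_s|² + 4 w_s·(y·∇w) + ½|y|²|∇w|²]. Since |y·∇w| ≤ |y||∇w| and 4² < 4·λ·½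
precisely when λ > 8, the bracket controls (|y|² + 1)|w_s|² + |y|²|∇w|² from below
(`quadratic_rate_le`).

The computation is carried out in the fixed coordinates x at time T - τ, τ = e^{-s}, where the
weighted energy is ½∫ψ Aⁱʲ∂ᵢU·∂ⱼU with ψ = (|x|²/τ + λ)e^{-|x|²/4τ}φ² and Aⁱʲ = √g gⁱʲ.
Differentiation under the integral, integration by parts and the Pohozaev identity for a field η x
are combined in `IsPatchFlow.hasDerivAt_weightedEnergy`; with η = `dilationWeight` the integrand
becomes the bracket above plus errors (`weightedEnergyRate_eq`).

There are two kinds of error. The deviation of the metric from the flat one is O(|x|) and costs a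
factor r(1 + |y|²)², r = |x|, under the Gaussian; this is at most e^{-s/4} unless |y| is so large
that the Gaussian is below any prescribed e^{-ns} (`exists_weight_bound`). Derivatives of the
cut-off live where |x| ≥ δ/2, and there the Gaussian is again below e^{-ns}
(`exists_weight_bound_away`). With F = Ẽ + λE, `exists_rate_bound` thus leads to F' ≤ -R + C
e^{-s/4} F + C e^{-ns}(2E(u) + ∫|∂ₜu|²), where R dominates a multiple of the dissipation.

The global identity dE/dt = -∫|∂ₜu|² (`IsHarmonicHeatFlow.energy_identity`) absorbs the last term,
and the factor exp(4C e^{-s/4}) absorbs the middle one; the result is a decreasing functional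
(`lyapunov_spec`). That factor tends to 1, whence 1 + κ⁻¹ for large s', while n > κ gives the rate
e^{-κs'}. Integrating R over s ≥ max(-log T, 0) gives the space-time bound there. The remaining
times s ≤ 0, present only if T > 1, are covered by a crude bound of the dissipation by the global
energy (`exists_dissipation_bound`, `IsHarmonicHeatFlow.lintegral_Ioc_le`). -/

theorem pderiv2_mul {f h : EuclideanSpace ℝ (Fin 2) → ℝ} {x : EuclideanSpace ℝ (Fin 2)}
    (i : Fin 2) (hf : DifferentiableAt ℝ f x) (hh : DifferentiableAt ℝ h x) :
    pderiv2 i (fun z => f z * h z) x = pderiv2 i f x * h x + f x * pderiv2 i h x := by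
  simp only [pderiv2]
  rw [fderiv_fun_mul hf hh]
  simp; ring

theorem pderiv2_smul [NormedSpace ℝ V] {f : EuclideanSpace ℝ (Fin 2) → ℝ}
    {h : EuclideanSpace ℝ (Fin 2) → V} {x : EuclideanSpace ℝ (Fin 2)}
    (i : Fin 2) (hf : DifferentiableAt ℝ f x) (hh : DifferentiableAt ℝ h x) :
    pderiv2 i (fun z => f z • h z) x = pderiv2 i f x • h x + f x • pderiv2 i h x := by
  simp only [pderiv2]
  rw [fderiv_fun_smul hf hh]
  simp [add_comm]

theorem pderiv2_inner [InnerProductSpace ℝ V] {f h : EuclideanSpace ℝ (Fin 2) → V}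
    {x : EuclideanSpace ℝ (Fin 2)}
    (i : Fin 2) (hf : DifferentiableAt ℝ f x) (hh : DifferentiableAt ℝ h x) :
    pderiv2 i (fun z => (inner ℝ (f z) (h z) : ℝ)) x
      = inner ℝ (pderiv2 i f x) (h x) + inner ℝ (f x) (pderiv2 i h x) := by
  simp only [pderiv2]
  rw [fderiv_inner_apply ℝ hf hh, add_comm]

theorem pderiv2_add [NormedSpace ℝ V] {f h : EuclideanSpace ℝ (Fin 2) → V}
    {x : EuclideanSpace ℝ (Fin 2)}
    (i : Fin 2) (hf : DifferentiableAt ℝ f x) (hh : DifferentiableAt ℝ h x) :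
    pderiv2 i (fun z => f z + h z) x = pderiv2 i f x + pderiv2 i h x := by
  simp only [pderiv2]
  rw [fderiv_fun_add hf hh]
  simp

theorem pderiv2_sub [NormedSpace ℝ V] {f h : EuclideanSpace ℝ (Fin 2) → V}
    {x : EuclideanSpace ℝ (Fin 2)}
    (i : Fin 2) (hf : DifferentiableAt ℝ f x) (hh : DifferentiableAt ℝ h x) :
    pderiv2 i (fun z => f z - h z) x = pderiv2 i f x - pderiv2 i h x := by
  simp only [pderiv2]
  rw [fderiv_fun_sub hf hh]
  simp

theorem pderiv2_const [NormedSpace ℝ V] (c : V) (x : EuclideanSpace ℝ (Fin 2)) (i : Fin 2) :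
    pderiv2 i (fun _ => c) x = 0 := by
  simp [pderiv2]

theorem pderiv2_coord (x : EuclideanSpace ℝ (Fin 2)) (i j : Fin 2) :
    pderiv2 i (fun z => z j) x = if j = i then 1 else 0 := by
  have : HasFDerivAt (fun z : EuclideanSpace ℝ (Fin 2) => z j)
      (EuclideanSpace.proj j : EuclideanSpace ℝ (Fin 2) →L[ℝ] ℝ) x :=
    (EuclideanSpace.proj j : EuclideanSpace ℝ (Fin 2) →L[ℝ] ℝ).hasFDerivAt
  simp [pderiv2, this.fderiv]

theorem differentiableAt_coord (x : EuclideanSpace ℝ (Fin 2)) (j : Fin 2) :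
    DifferentiableAt ℝ (fun z : EuclideanSpace ℝ (Fin 2) => z j) x :=
  (EuclideanSpace.proj j : EuclideanSpace ℝ (Fin 2) →L[ℝ] ℝ).differentiableAt

theorem pderiv2_congr [NormedSpace ℝ V] {f h : EuclideanSpace ℝ (Fin 2) → V}
    {x : EuclideanSpace ℝ (Fin 2)} (i : Fin 2) (hfh : f =ᶠ[𝓝 x] h) :
    pderiv2 i f x = pderiv2 i h x := by
  simp only [pderiv2, hfh.fderiv_eq]

theorem contDiffOn_pderiv2 [NormedSpace ℝ V] {f : EuclideanSpace ℝ (Fin 2) → V}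
    {Ω : Set (EuclideanSpace ℝ (Fin 2))} (hΩ : IsOpen Ω) (hf : ContDiffOn ℝ ∞ f Ω) (i : Fin 2) :
    ContDiffOn ℝ ∞ (pderiv2 i f) Ω :=
  (hf.fderiv_of_isOpen hΩ (by simp)).clm_apply contDiffOn_const

end PartialDerivatives

/-! ## Functions supported in a compact subset -/

section Support

/-- Coordinate expressions are smooth only on the chart image Ω and arbitrary elsewhere. Vanishing
off a closed subset of Ω makes them globally smooth, so that whole-plane integration theorems apply.
-/
theorem contDiff_of_support {E V : Type*} [NormedAddCommGroup E] [NormedSpace ℝ E]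
    [NormedAddCommGroup V] [NormedSpace ℝ V] {n : WithTop ℕ∞} {F : E → V} {Ω K : Set E}
    (hΩ : IsOpen Ω) (hK : IsClosed K) (hKΩ : K ⊆ Ω) (hF : ContDiffOn ℝ n F Ω)
    (h0 : ∀ x ∉ K, F x = 0) : ContDiff ℝ n F := by
  rw [contDiff_iff_contDiffAt]
  intro x
  by_cases hx : x ∈ K
  · exact hF.contDiffAt (hΩ.mem_nhds (hKΩ hx))
  · refine (contDiffAt_const (c := (0 : V))).congr_of_eventuallyEq ?_
    filter_upwards [hK.isOpen_compl.mem_nhds hx] with z hz using h0 z hz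

theorem continuousOn_prod_of_support {X Y V : Type*} [TopologicalSpace X] [TopologicalSpace Y]
    [TopologicalSpace V] [Zero V] {F : X → Y → V} {Ω K : Set X} {J : Set Y}
    (hΩ : IsOpen Ω) (hK : IsClosed K) (hKΩ : K ⊆ Ω)
    (hF : ContinuousOn (fun z : X × Y => F z.1 z.2) (Ω ×ˢ J))
    (h0 : ∀ x ∉ K, ∀ y ∈ J, F x y = 0) :
    ContinuousOn (fun z : X × Y => F z.1 z.2) (univ ×ˢ J) := by
  rintro ⟨x, y⟩ ⟨-, hy⟩
  by_cases hx : x ∈ K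
  · refine ((hF (x, y) ⟨hKΩ hx, hy⟩).mono_of_mem_nhdsWithin ?_)
    rw [mem_nhdsWithin]
    exact ⟨Ω ×ˢ univ, hΩ.prod isOpen_univ, ⟨hKΩ hx, trivial⟩, fun z hz => ⟨hz.1.1, hz.2.2⟩⟩
  · have : ContinuousWithinAt (fun _ : X × Y => (0 : V)) (univ ×ˢ J) (x, y) :=
      continuousWithinAt_const
    refine this.congr_of_eventuallyEq ?_ (h0 x hx y hy)
    have : Kᶜ ×ˢ (univ : Set Y) ∈ 𝓝 (x, y) :=
      (hK.isOpen_compl.prod isOpen_univ).mem_nhds ⟨hx, trivial⟩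
    filter_upwards [mem_nhdsWithin_of_mem_nhds this, self_mem_nhdsWithin] with z hz hz'
    exact h0 _ hz.1 _ hz'.2

theorem integrable_of_support {F : EuclideanSpace ℝ (Fin 2) → ℝ}
    {Ω K : Set (EuclideanSpace ℝ (Fin 2))} (hK : IsCompact K) (hKΩ : K ⊆ Ω) (hF : ContinuousOn F Ω)
    (h0 : ∀ x ∉ K, F x = 0) : Integrable F := by
  have h1 : IntegrableOn F K := (hF.mono hKΩ).integrableOn_compact hK
  rw [← integrableOn_univ]
  refine (integrableOn_iff_integrable_of_support_subset ?_).1 h1 |>.integrableOn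
  intro x hx
  by_contra h
  exact hx (h0 x h)

theorem integral_pderiv2_eq_zero {F : EuclideanSpace ℝ (Fin 2) → ℝ}
    {Ω K : Set (EuclideanSpace ℝ (Fin 2))}
    (hΩ : IsOpen Ω) (hK : IsCompact K) (hKΩ : K ⊆ Ω) (hF : ContDiffOn ℝ ∞ F Ω)
    (h0 : ∀ x ∉ K, F x = 0) (i : Fin 2) :
    Integrable (pderiv2 i F) ∧ ∫ x, pderiv2 i F x = 0 := by
  have hF' := contDiff_of_support hΩ hK.isClosed hKΩ hF h0
  have hc : ∀ x ∉ K, pderiv2 i F x = 0 := by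
    intro x hx
    have : F =ᶠ[𝓝 x] fun _ => 0 := by
      filter_upwards [hK.isClosed.isOpen_compl.mem_nhds hx] with z hz using h0 z hz
    rw [pderiv2_congr i this, pderiv2_const]
  have hi : Integrable (pderiv2 i F) :=
    integrable_of_support hK (subset_univ _)
      (contDiffOn_pderiv2 isOpen_univ hF'.contDiffOn i).continuousOn hc
  refine ⟨hi, ?_⟩
  have hF0 : Integrable F :=
    integrable_of_support hK (subset_univ _) hF'.continuous.continuousOn h0
  -- Integration by parts against the constant function 1.
  have key := integral_mul_fderiv_eq_neg_fderiv_mul_of_integrable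
    (f := fun _ : EuclideanSpace ℝ (Fin 2) => (1 : ℝ)) (g := F)
    (v := EuclideanSpace.single i (1 : ℝ)) (μ := volume)
    (by simp) (by simpa [pderiv2] using! hi) (by simpa using hF0)
    (by fun_prop) (fun x _ => hF'.differentiable (by simp) x)
  simpa [pderiv2] using! key

/-- Differentiation under the integral sign, for compactly supported integrands. -/
theorem hasDerivAt_integral_of_support {q : EuclideanSpace ℝ (Fin 2) → ℝ → ℝ}
    {Ω K : Set (EuclideanSpace ℝ (Fin 2))} {J : Set ℝ}
    (hΩ : IsOpen Ω) (hJ : IsOpen J) (hK : IsCompact K) (hKΩ : K ⊆ Ω)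
    (hq : ContDiffOn ℝ ∞ (fun z : EuclideanSpace ℝ (Fin 2) × ℝ => q z.1 z.2) (Ω ×ˢ J))
    (h0 : ∀ x ∉ K, ∀ t ∈ J, q x t = 0) {t : ℝ} (ht : t ∈ J) :
    Integrable (fun x => deriv (fun s => q x s) t) ∧
      HasDerivAt (fun s => ∫ x, q x s) (∫ x, deriv (fun s => q x s) t) t := by
  have hqs : ∀ s ∈ J, ContinuousOn (fun x => q x s) Ω := fun s hs =>
    hq.continuousOn.comp (f := fun x => (x, s)) (by fun_prop) (fun x hx => ⟨hx, hs⟩)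
  have hqi : ∀ s ∈ J, Integrable (fun x => q x s) := fun s hs =>
    integrable_of_support hK hKΩ (hqs s hs) (fun x hx => h0 x hx s hs)
  have hdiff : ∀ x ∈ Ω, ∀ s ∈ J, HasDerivAt (fun s => q x s)
      (fderiv ℝ (fun z : EuclideanSpace ℝ (Fin 2) × ℝ => q z.1 z.2) (x, s) (0, 1)) s := by
    intro x hx s hs
    have h1 : DifferentiableAt ℝ (fun z : EuclideanSpace ℝ (Fin 2) × ℝ => q z.1 z.2) (x, s) :=
      (hq.differentiableOn (by simp)).differentiableAt ((hΩ.prod hJ).mem_nhds ⟨hx, hs⟩)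
    have h2 : HasDerivAt (fun s : ℝ => (x, s)) ((0 : EuclideanSpace ℝ (Fin 2)), (1 : ℝ)) s :=
      (hasDerivAt_const s x).prodMk (hasDerivAt_id s)
    exact h1.hasFDerivAt.comp_hasDerivAt s h2
  have hdz : ∀ x ∉ K, ∀ s ∈ J, HasDerivAt (fun s => q x s) 0 s := by
    intro x hx s hs
    refine (hasDerivAt_const s (0 : ℝ)).congr_of_eventuallyEq ?_
    filter_upwards [hJ.mem_nhds hs] with r hr using h0 x hx r hr
  have hcont : ContinuousOn (fun z : EuclideanSpace ℝ (Fin 2) × ℝ => deriv (fun s => q z.1 s) z.2)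
      (Ω ×ˢ J) := by
    have : ContinuousOn (fun z => fderiv ℝ (fun z : EuclideanSpace ℝ (Fin 2) × ℝ => q z.1 z.2) z
        (0, 1)) (Ω ×ˢ J) :=
      (hq.continuousOn_fderiv_of_isOpen (hΩ.prod hJ) (by simp)).clm_apply continuousOn_const
    exact this.congr fun z hz => (hdiff z.1 hz.1 z.2 hz.2).deriv
  obtain ⟨ε, hε, hεJ⟩ := Metric.isOpen_iff.1 hJ t ht
  have hsub : Metric.closedBall t (ε / 2) ⊆ J :=
    (Metric.closedBall_subset_ball (by linarith)).trans hεJ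
  -- The dominating function is the maximum of the time derivative over the compact set K × [t -
  -- ε/2, t + ε/2], cut off to K.
  obtain ⟨B, hB⟩ := (hK.prod (isCompact_closedBall t (ε / 2))).exists_bound_of_continuousOn
    (hcont.mono (prod_mono hKΩ hsub))
  have hall : ∀ x, ∀ s ∈ J, HasDerivAt (fun s => q x s) (deriv (fun s => q x s) s) s := by
    intro x s hs
    by_cases hx : x ∈ K
    · exact (hdiff x (hKΩ hx) s hs).differentiableAt.hasDerivAt
    · exact (hdz x hx s hs).differentiableAt.hasDerivAt
  have hderiv0 : ∀ x ∉ K, ∀ s ∈ J, deriv (fun s => q x s) s = 0 := fun x hx s hs =>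
    (hdz x hx s hs).deriv
  have hint : Integrable (fun x => deriv (fun s => q x s) t) :=
    integrable_of_support hK hKΩ
      (hcont.comp (f := fun x => (x, t)) (by fun_prop) (fun x hx => ⟨hx, ht⟩))
      (fun x hx => hderiv0 x hx t ht)
  refine hasDerivAt_integral_of_dominated_loc_of_deriv_le
    (bound := K.indicator fun _ => B) (F := fun s x => q x s)
    (F' := fun s x => deriv (fun s => q x s) s)
    (Metric.closedBall_mem_nhds t (by positivity : 0 < ε / 2)) ?_ (hqi t ht)
    hint.aestronglyMeasurable ?_ ?_ ?_
  · filter_upwards [hJ.mem_nhds ht] with s hs using (hqi s hs).aestronglyMeasurable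
  · refine Filter.Eventually.of_forall fun x s hs => ?_
    by_cases hx : x ∈ K
    · simpa [hx] using hB (x, s) ⟨hx, hs⟩
    · simp [hx, hderiv0 x hx s (hsub hs)]
  · exact (integrable_indicator_iff hK.measurableSet).2
      (integrableOn_const (hs := hK.measure_lt_top.ne))
  · exact Filter.Eventually.of_forall fun x s hs => hall x s (hsub hs)

end Support

/-! ## Smooth families of maps -/

section Families

variable {V : Type*} [NormedAddCommGroup V] [NormedSpace ℝ V]
  {U : EuclideanSpace ℝ (Fin 2) → ℝ → V} {Ω : Set (EuclideanSpace ℝ (Fin 2))} {J : Set ℝ}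

theorem pderiv2_slice (hΩ : IsOpen Ω) (hJ : IsOpen J)
    (hU : ContDiffOn ℝ ∞ (fun z : EuclideanSpace ℝ (Fin 2) × ℝ => U z.1 z.2) (Ω ×ˢ J))
    (i : Fin 2) {x : EuclideanSpace ℝ (Fin 2)} {t : ℝ} (hx : x ∈ Ω) (ht : t ∈ J) :
    pderiv2 i (fun z => U z t) x
      = fderiv ℝ (fun z : EuclideanSpace ℝ (Fin 2) × ℝ => U z.1 z.2) (x, t)
          (EuclideanSpace.single i 1, 0) := by
  have h1 : DifferentiableAt ℝ (fun z : EuclideanSpace ℝ (Fin 2) × ℝ => U z.1 z.2) (x, t) :=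
    (hU.differentiableOn (by simp)).differentiableAt ((hΩ.prod hJ).mem_nhds ⟨hx, ht⟩)
  have h2 := HasFDerivAt.comp (f := fun y => (y, t)) x h1.hasFDerivAt (hasFDerivAt_prodMk_left x t)
  have h3 : fderiv ℝ (fun z => U z t) x = _ := h2.fderiv
  rw [pderiv2, h3]
  rfl

theorem hasDerivAt_slice (hΩ : IsOpen Ω) (hJ : IsOpen J)
    (hU : ContDiffOn ℝ ∞ (fun z : EuclideanSpace ℝ (Fin 2) × ℝ => U z.1 z.2) (Ω ×ˢ J))
    {x : EuclideanSpace ℝ (Fin 2)} {t : ℝ} (hx : x ∈ Ω) (ht : t ∈ J) :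
    HasDerivAt (fun s => U x s)
      (fderiv ℝ (fun z : EuclideanSpace ℝ (Fin 2) × ℝ => U z.1 z.2) (x, t) (0, 1)) t := by
  have h1 : DifferentiableAt ℝ (fun z : EuclideanSpace ℝ (Fin 2) × ℝ => U z.1 z.2) (x, t) :=
    (hU.differentiableOn (by simp)).differentiableAt ((hΩ.prod hJ).mem_nhds ⟨hx, ht⟩)
  have h2 : HasDerivAt (fun s : ℝ => (x, s)) ((0 : EuclideanSpace ℝ (Fin 2)), (1 : ℝ)) t :=
    (hasDerivAt_const t x).prodMk (hasDerivAt_id t)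
  exact h1.hasFDerivAt.comp_hasDerivAt t h2

theorem contDiffOn_pderiv2_slice (hΩ : IsOpen Ω) (hJ : IsOpen J)
    (hU : ContDiffOn ℝ ∞ (fun z : EuclideanSpace ℝ (Fin 2) × ℝ => U z.1 z.2) (Ω ×ˢ J))
    (i : Fin 2) :
    ContDiffOn ℝ ∞ (fun z : EuclideanSpace ℝ (Fin 2) × ℝ => pderiv2 i (fun x => U x z.2) z.1)
      (Ω ×ˢ J) := by
  have : ContDiffOn ℝ ∞ (fun z => fderiv ℝ (fun z : EuclideanSpace ℝ (Fin 2) × ℝ => U z.1 z.2) z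
      (EuclideanSpace.single i 1, 0)) (Ω ×ˢ J) :=
    (hU.fderiv_of_isOpen (hΩ.prod hJ) (by simp)).clm_apply contDiffOn_const
  exact this.congr fun z hz => pderiv2_slice hΩ hJ hU i hz.1 hz.2

theorem contDiffOn_deriv_slice (hΩ : IsOpen Ω) (hJ : IsOpen J)
    (hU : ContDiffOn ℝ ∞ (fun z : EuclideanSpace ℝ (Fin 2) × ℝ => U z.1 z.2) (Ω ×ˢ J)) :
    ContDiffOn ℝ ∞ (fun z : EuclideanSpace ℝ (Fin 2) × ℝ => deriv (fun s => U z.1 s) z.2)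
      (Ω ×ˢ J) := by
  have : ContDiffOn ℝ ∞ (fun z => fderiv ℝ (fun z : EuclideanSpace ℝ (Fin 2) × ℝ => U z.1 z.2) z
      (0, 1)) (Ω ×ˢ J) :=
    (hU.fderiv_of_isOpen (hΩ.prod hJ) (by simp)).clm_apply contDiffOn_const
  exact this.congr fun z hz => (hasDerivAt_slice hΩ hJ hU hz.1 hz.2).deriv

theorem contDiffOn_slice
    (hU : ContDiffOn ℝ ∞ (fun z : EuclideanSpace ℝ (Fin 2) × ℝ => U z.1 z.2) (Ω ×ˢ J))
    {t : ℝ} (ht : t ∈ J) : ContDiffOn ℝ ∞ (fun x => U x t) Ω :=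
  hU.comp (f := fun x => (x, t)) (by fun_prop) (fun x hx => ⟨hx, ht⟩)

/-- Time and space derivatives of a smooth family commute. -/
theorem hasDerivAt_pderiv2_slice (hΩ : IsOpen Ω) (hJ : IsOpen J)
    (hU : ContDiffOn ℝ ∞ (fun z : EuclideanSpace ℝ (Fin 2) × ℝ => U z.1 z.2) (Ω ×ˢ J))
    (i : Fin 2) {x : EuclideanSpace ℝ (Fin 2)} {t : ℝ} (hx : x ∈ Ω) (ht : t ∈ J) :
    HasDerivAt (fun s => pderiv2 i (fun z => U z s) x)
      (pderiv2 i (fun z => deriv (fun s => U z s) t) x) t := by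
  set Ũ : EuclideanSpace ℝ (Fin 2) × ℝ → V := fun z => U z.1 z.2 with hŨ
  have hW := (hΩ.prod hJ).mem_nhds (show (x, t) ∈ Ω ×ˢ J from ⟨hx, ht⟩)
  have hU2 : DifferentiableAt ℝ (fderiv ℝ Ũ) (x, t) :=
    ((hU.fderiv_of_isOpen (m := ∞) (hΩ.prod hJ) (by simp)).differentiableOn
      (by simp)).differentiableAt hW
  have hsymm : IsSymmSndFDerivAt ℝ Ũ (x, t) :=
    (hU.contDiffAt hW).isSymmSndFDerivAt (by
      rw [minSmoothness_of_isRCLikeNormedField]; exact ENat.LEInfty.out)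
  have h2 : HasDerivAt (fun s : ℝ => (x, s)) ((0 : EuclideanSpace ℝ (Fin 2)), (1 : ℝ)) t :=
    (hasDerivAt_const t x).prodMk (hasDerivAt_id t)
  have h3 : HasDerivAt (fun s : ℝ => fderiv ℝ Ũ (x, s) (EuclideanSpace.single i 1, 0))
      (fderiv ℝ (fderiv ℝ Ũ) (x, t) (0, 1) (EuclideanSpace.single i 1, 0)) t := by
    have := (hU2.hasFDerivAt.comp_hasDerivAt t h2).clm_apply
      (hasDerivAt_const t ((EuclideanSpace.single i (1 : ℝ) : EuclideanSpace ℝ (Fin 2)), (0 : ℝ)))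
    simpa using! this
  have h4 : pderiv2 i (fun z => deriv (fun s => U z s) t) x
      = fderiv ℝ (fderiv ℝ Ũ) (x, t) (EuclideanSpace.single i 1, 0) (0, 1) := by
    have e1 : (fun z => deriv (fun s => U z s) t) =ᶠ[𝓝 x] fun z => fderiv ℝ Ũ (z, t) (0, 1) := by
      filter_upwards [hΩ.mem_nhds hx] with z hz
      exact (hasDerivAt_slice hΩ hJ hU hz ht).deriv
    rw [pderiv2_congr i e1]
    have h5 := (HasFDerivAt.comp (f := fun y => (y, t)) x hU2.hasFDerivAt
      (hasFDerivAt_prodMk_left x t)).clm_apply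
      (hasFDerivAt_const ((0 : EuclideanSpace ℝ (Fin 2)), (1 : ℝ)) x)
    have h6 : fderiv ℝ (fun z => fderiv ℝ Ũ (z, t) (0, 1)) x = _ := h5.fderiv
    rw [pderiv2, h6]
    simp
  rw [h4, hsymm.eq]
  refine h3.congr_of_eventuallyEq ?_
  filter_upwards [hJ.mem_nhds ht] with s hs using pderiv2_slice hΩ hJ hU i hx hs

/-- Spatial derivatives are continuous up to the initial time. -/
theorem continuousOn_pderiv2_slice {T : ℝ} (hΩ : IsOpen Ω)
    (hU : ContDiffOn ℝ ∞ (fun z : EuclideanSpace ℝ (Fin 2) × ℝ => U z.1 z.2) (Ω ×ˢ Ico 0 T))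
    (i : Fin 2) :
    ContinuousOn (fun z : EuclideanSpace ℝ (Fin 2) × ℝ => pderiv2 i (fun x => U x z.2) z.1)
      (Ω ×ˢ Ico 0 T) := by
  -- At t = 0 only one-sided information in time is available, so the joint derivative is taken
  -- within Ω × [0, T). Its spatial components agree with the ordinary partial derivatives because Ω
  -- is open.
  have hud : UniqueDiffOn ℝ (Ω ×ˢ Ico 0 T) := hΩ.uniqueDiffOn.prod (uniqueDiffOn_Ico 0 T)
  have h1 : ContinuousOn (fun z => fderivWithin ℝ
      (fun z : EuclideanSpace ℝ (Fin 2) × ℝ => U z.1 z.2) (Ω ×ˢ Ico 0 T) z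
      (EuclideanSpace.single i 1, 0)) (Ω ×ˢ Ico 0 T) :=
    (hU.continuousOn_fderivWithin hud (by simp)).clm_apply continuousOn_const
  refine h1.congr fun z hz => ?_
  obtain ⟨x, t⟩ := z
  have h2 := ((hU.differentiableOn (by simp)) (x, t) hz).hasFDerivWithinAt
  have h3 := HasFDerivWithinAt.comp (s := Ω) (f := fun y => (y, t)) x h2
    (hasFDerivAt_prodMk_left x t).hasFDerivWithinAt (fun y hy => ⟨hy, hz.2⟩)
  have h4 := h3.hasFDerivAt (hΩ.mem_nhds hz.1)
  have h5 : fderiv ℝ (fun y => U y t) x = _ := h4.fderiv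
  simp only [pderiv2]
  rw [h5]
  rfl

end Families

/-! ## Divergence identities in a coordinate patch -/

section Divergence

variable {k : ℕ}

/-- The divergence form operator `∂ᵢ (Aⁱʲ ∂ⱼ f)`. -/
def divGrad (A : EuclideanSpace ℝ (Fin 2) → Matrix (Fin 2) (Fin 2) ℝ)
    (f : EuclideanSpace ℝ (Fin 2) → EuclideanSpace ℝ (Fin k)) (x : EuclideanSpace ℝ (Fin 2)) :
    EuclideanSpace ℝ (Fin k) :=
  ∑ i, ∑ j, pderiv2 i (fun z => A z i j • pderiv2 j f z) x

/-- The quadratic form `Bⁱʲ ∂ᵢf · ∂ⱼf`. -/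
def dirichletForm (B : Matrix (Fin 2) (Fin 2) ℝ)
    (f : EuclideanSpace ℝ (Fin 2) → EuclideanSpace ℝ (Fin k)) (x : EuclideanSpace ℝ (Fin 2)) : ℝ :=
  ∑ i, ∑ j, B i j * inner ℝ (pderiv2 i f x) (pderiv2 j f x)

/-- The radial derivative `xᵏ ∂ₖ f`. -/
def radialDeriv {V : Type*} [NormedAddCommGroup V] [NormedSpace ℝ V]
    (f : EuclideanSpace ℝ (Fin 2) → V) (x : EuclideanSpace ℝ (Fin 2)) : V :=
  ∑ i, x i • pderiv2 i f x

/-- The `A`-gradient pairing `Aⁱʲ aᵢ ∂ⱼ f` with a covector `a`. -/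
def covectorPairing (B : Matrix (Fin 2) (Fin 2) ℝ) (a : Fin 2 → ℝ)
    (f : EuclideanSpace ℝ (Fin 2) → EuclideanSpace ℝ (Fin k)) (x : EuclideanSpace ℝ (Fin 2)) :
    EuclideanSpace ℝ (Fin k) :=
  ∑ i, ∑ j, (B i j * a i) • pderiv2 j f x

variable {A : EuclideanSpace ℝ (Fin 2) → Matrix (Fin 2) (Fin 2) ℝ}
  {f v : EuclideanSpace ℝ (Fin 2) → EuclideanSpace ℝ (Fin k)}
  {h : EuclideanSpace ℝ (Fin 2) → ℝ} {x : EuclideanSpace ℝ (Fin 2)}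

/-- The flux `h Aⁱʲ ∂ⱼf · v`. -/
def energyFlux (A : EuclideanSpace ℝ (Fin 2) → Matrix (Fin 2) (Fin 2) ℝ)
    (h : EuclideanSpace ℝ (Fin 2) → ℝ)
    (f v : EuclideanSpace ℝ (Fin 2) → EuclideanSpace ℝ (Fin k)) (i : Fin 2)
    (x : EuclideanSpace ℝ (Fin 2)) : ℝ :=
  h x * ∑ j, A x i j * inner ℝ (pderiv2 j f x) (v x)

/-- The flux `h (Aⁱʲ ∂ⱼf · (x·∇f) - ½ xⁱ Aʲˡ ∂ⱼf · ∂ₗf)` of the Pohozaev identity. -/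
def pohozaevFlux (A : EuclideanSpace ℝ (Fin 2) → Matrix (Fin 2) (Fin 2) ℝ)
    (h : EuclideanSpace ℝ (Fin 2) → ℝ)
    (f : EuclideanSpace ℝ (Fin 2) → EuclideanSpace ℝ (Fin k)) (i : Fin 2)
    (x : EuclideanSpace ℝ (Fin 2)) : ℝ :=
  h x * (∑ j, A x i j * inner ℝ (pderiv2 j f x) (radialDeriv f x)
    - 1 / 2 * (x i * dirichletForm (A x) f x))

theorem divGrad_eq (hA : ∀ i j, DifferentiableAt ℝ (fun z => A z i j) x)
    (hp : ∀ j, DifferentiableAt ℝ (pderiv2 j f) x) :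
    divGrad A f x = ∑ i, ∑ j, (pderiv2 i (fun z => A z i j) x • pderiv2 j f x
      + A x i j • pderiv2 i (pderiv2 j f) x) := by
  unfold divGrad
  congr 1; ext1 i; congr 1; ext1 j
  exact pderiv2_smul i (hA i j) (hp j)

theorem sum_pderiv2_energyFlux (hA : ∀ i j, DifferentiableAt ℝ (fun z => A z i j) x)
    (hp : ∀ j, DifferentiableAt ℝ (pderiv2 j f) x) (hv : DifferentiableAt ℝ v x)
    (hh : DifferentiableAt ℝ h x) :
    ∑ i, pderiv2 i (energyFlux A h f v i) x
      = h x * inner ℝ (divGrad A f x) (v x)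
        + inner ℝ (covectorPairing (A x) (fun i => pderiv2 i h x) f x) (v x)
        + h x * ∑ i, ∑ j, A x i j * inner ℝ (pderiv2 j f x) (pderiv2 i v x) := by
  have hip : ∀ j, DifferentiableAt ℝ (fun z => (inner ℝ (pderiv2 j f z) (v z) : ℝ)) x :=
    fun j => (hp j).inner ℝ hv
  have hA' : ∀ i j, DifferentiableAt ℝ
      (fun z => A z i j * (inner ℝ (pderiv2 j f z) (v z) : ℝ)) x := fun i j => (hA i j).fun_mul (hip j)
  have key : ∀ i, pderiv2 i (energyFlux A h f v i) x = pderiv2 i h x *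
      (∑ j, A x i j * inner ℝ (pderiv2 j f x) (v x)) + h x * (∑ j,
        (pderiv2 i (fun z => A z i j) x * inner ℝ (pderiv2 j f x) (v x) + A x i j *
          (inner ℝ (pderiv2 i (pderiv2 j f) x) (v x)
            + inner ℝ (pderiv2 j f x) (pderiv2 i v x)))) := by
    intro i
    unfold energyFlux
    simp only [Fin.sum_univ_two]
    rw [pderiv2_mul i hh ((hA' i 0).fun_add (hA' i 1)), pderiv2_add i (hA' i 0) (hA' i 1),
      pderiv2_mul i (hA i 0) (hip 0), pderiv2_mul i (hA i 1) (hip 1),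
      pderiv2_inner i (hp 0) hv, pderiv2_inner i (hp 1) hv]
  simp only [key, divGrad_eq hA hp, covectorPairing, Fin.sum_univ_two, inner_add_left,
    inner_smul_left, RCLike.conj_to_real]
  ring

/-- The radial field has ∂ᵢxⁱ = 2. Differentiating it in the first term of the flux yields +h
Aⁱʲ∂ᵢf·∂ⱼf, and in the second -½·2·h Aⁱʲ∂ᵢf·∂ⱼf. In dimension two these cancel, and by the symmetry
of A and of second derivatives so do all terms with second derivatives outside `divGrad`. Only
derivatives of h and the radial derivative of A survive. -/
theorem sum_pderiv2_pohozaevFlux (hA : ∀ i j, DifferentiableAt ℝ (fun z => A z i j) x)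
    (hs : A x 0 1 = A x 1 0)
    (hp : ∀ j, DifferentiableAt ℝ (pderiv2 j f) x)
    (hc : pderiv2 0 (pderiv2 1 f) x = pderiv2 1 (pderiv2 0 f) x)
    (hh : DifferentiableAt ℝ h x) :
    ∑ i, pderiv2 i (pohozaevFlux A h f i) x
      = h x * inner ℝ (divGrad A f x) (radialDeriv f x)
        + inner ℝ (covectorPairing (A x) (fun i => pderiv2 i h x) f x) (radialDeriv f x)
        - 1 / 2 * radialDeriv h x * dirichletForm (A x) f x
        - 1 / 2 * h x * dirichletForm
            (Matrix.of fun i j => radialDeriv (fun z => A z i j) x) f x := by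
  have hz : DifferentiableAt ℝ (radialDeriv f) x := by
    unfold radialDeriv
    simp only [Fin.sum_univ_two]
    exact ((differentiableAt_coord x 0).fun_smul (hp 0)).fun_add ((differentiableAt_coord x 1).fun_smul (hp 1))
  have hpz : ∀ i, pderiv2 i (radialDeriv f) x = pderiv2 i f x + ∑ j, x j • pderiv2 i (pderiv2 j f) x := by
    intro i
    have : radialDeriv f = fun z => z 0 • pderiv2 0 f z + z 1 • pderiv2 1 f z := by
      ext1 z; simp [radialDeriv]
    rw [this, pderiv2_add i ((differentiableAt_coord x 0).fun_smul (hp 0))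
        ((differentiableAt_coord x 1).fun_smul (hp 1)),
      pderiv2_smul i (differentiableAt_coord x 0) (hp 0),
      pderiv2_smul i (differentiableAt_coord x 1) (hp 1), pderiv2_coord, pderiv2_coord]
    fin_cases i <;> simp <;> abel
  have hip : ∀ i j, DifferentiableAt ℝ
      (fun z => (inner ℝ (pderiv2 i f z) (pderiv2 j f z) : ℝ)) x :=
    fun i j => (hp i).inner ℝ (hp j)
  have hq : ∀ i j, DifferentiableAt ℝ
      (fun z => A z i j * (inner ℝ (pderiv2 i f z) (pderiv2 j f z) : ℝ)) x :=
    fun i j => (hA i j).fun_mul (hip i j)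
  have hD : (fun z => dirichletForm (A z) f z) = fun z =>
      (A z 0 0 * inner ℝ (pderiv2 0 f z) (pderiv2 0 f z)
        + A z 0 1 * inner ℝ (pderiv2 0 f z) (pderiv2 1 f z))
      + (A z 1 0 * inner ℝ (pderiv2 1 f z) (pderiv2 0 f z)
        + A z 1 1 * inner ℝ (pderiv2 1 f z) (pderiv2 1 f z)) := by
    ext1 z; simp [dirichletForm]
  have hDd : DifferentiableAt ℝ (fun z => dirichletForm (A z) f z) x := by
    rw [hD]; exact ((hq 0 0).fun_add (hq 0 1)).fun_add ((hq 1 0).fun_add (hq 1 1))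
  have hpD : ∀ i, pderiv2 i (fun z => dirichletForm (A z) f z) x = ∑ j, ∑ l,
      (pderiv2 i (fun z => A z j l) x * inner ℝ (pderiv2 j f x) (pderiv2 l f x)
        + A x j l * (inner ℝ (pderiv2 i (pderiv2 j f) x) (pderiv2 l f x)
          + inner ℝ (pderiv2 j f x) (pderiv2 i (pderiv2 l f) x))) := by
    intro i
    rw [hD, pderiv2_add i ((hq 0 0).fun_add (hq 0 1)) ((hq 1 0).fun_add (hq 1 1)),
      pderiv2_add i (hq 0 0) (hq 0 1), pderiv2_add i (hq 1 0) (hq 1 1)]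
    simp only [pderiv2_mul i (hA _ _) (hip _ _), pderiv2_inner i (hp _) (hp _), Fin.sum_univ_two]
  have hF : ∀ i, pderiv2 i (pohozaevFlux A h f i) x = pderiv2 i (energyFlux A h f (radialDeriv f) i) x
      - (1 / 2 * pderiv2 i h x * (x i * dirichletForm (A x) f x) + 1 / 2 * h x *
          (dirichletForm (A x) f x + x i * pderiv2 i (fun z => dirichletForm (A z) f z) x)) := by
    intro i
    have e1 : pohozaevFlux A h f i = fun z => energyFlux A h f (radialDeriv f) i z
        - (1 / 2 * h z) * (z i * dirichletForm (A z) f z) := by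
      ext1 z; simp only [pohozaevFlux, energyFlux]; ring
    have e2 : DifferentiableAt ℝ (energyFlux A h f (radialDeriv f) i) x := by
      unfold energyFlux
      simp only [Fin.sum_univ_two]
      exact hh.fun_mul (((hA i 0).fun_mul ((hp 0).inner ℝ hz)).fun_add ((hA i 1).fun_mul ((hp 1).inner ℝ hz)))
    have e3 : DifferentiableAt ℝ (fun z => 1 / 2 * h z) x := by fun_prop
    have e4 := (differentiableAt_coord x i).fun_mul hDd
    rw [e1, pderiv2_sub i e2 (e3.fun_mul e4), pderiv2_mul i e3 e4,
      pderiv2_mul i (differentiableAt_coord x i) hDd, pderiv2_coord,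
      pderiv2_mul i (differentiableAt_const _) hh, pderiv2_const]
    simp
  have hE := sum_pderiv2_energyFlux (v := radialDeriv f) hA hp hz hh
  simp only [Fin.sum_univ_two] at hE ⊢
  rw [hF 0, hF 1]
  -- Solving the energy flux identity for one of the two divergence terms lets the other cancel in
  -- the sum, without expanding the second derivatives in either flux.
  have : pderiv2 0 (energyFlux A h f (radialDeriv f) 0) x
      = h x * inner ℝ (divGrad A f x) (radialDeriv f x)
        + inner ℝ (covectorPairing (A x) (fun i => pderiv2 i h x) f x) (radialDeriv f x)
        + h x * (A x 0 0 * inner ℝ (pderiv2 0 f x) (pderiv2 0 (radialDeriv f) x)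
          + A x 0 1 * inner ℝ (pderiv2 1 f x) (pderiv2 0 (radialDeriv f) x)
          + (A x 1 0 * inner ℝ (pderiv2 0 f x) (pderiv2 1 (radialDeriv f) x)
          + A x 1 1 * inner ℝ (pderiv2 1 f x) (pderiv2 1 (radialDeriv f) x)))
        - pderiv2 1 (energyFlux A h f (radialDeriv f) 1) x := by
    rw [← hE]; ring
  rw [this, hpD, hpD, hpz, hpz]
  have hr : radialDeriv h x = x 0 * pderiv2 0 h x + x 1 * pderiv2 1 h x := by simp [radialDeriv]
  rw [hr]
  simp only [dirichletForm, Matrix.of_apply, Fin.sum_univ_two, inner_add_right, inner_smul_right, hs,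
    hc, radialDeriv, smul_eq_mul]
  rw [real_inner_comm (pderiv2 0 f x) (pderiv2 1 f x),
    real_inner_comm (pderiv2 0 f x) (pderiv2 0 (pderiv2 0 f) x),
    real_inner_comm (pderiv2 0 f x) (pderiv2 1 (pderiv2 0 f) x),
    real_inner_comm (pderiv2 0 f x) (pderiv2 1 (pderiv2 1 f) x),
    real_inner_comm (pderiv2 1 f x) (pderiv2 0 (pderiv2 0 f) x),
    real_inner_comm (pderiv2 1 f x) (pderiv2 1 (pderiv2 0 f) x),
    real_inner_comm (pderiv2 1 f x) (pderiv2 1 (pderiv2 1 f) x)]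
  ring

theorem pderiv2_comm {Ω : Set (EuclideanSpace ℝ (Fin 2))} (hΩ : IsOpen Ω) (hf : ContDiffOn ℝ ∞ f Ω)
    (hx : x ∈ Ω) : pderiv2 0 (pderiv2 1 f) x = pderiv2 1 (pderiv2 0 f) x := by
  have h1 : DifferentiableAt ℝ (fderiv ℝ f) x :=
    ((hf.fderiv_of_isOpen (m := ∞) hΩ (by simp)).differentiableOn
      (by simp)).differentiableAt (hΩ.mem_nhds hx)
  have hsymm : IsSymmSndFDerivAt ℝ f x := (hf.contDiffAt (hΩ.mem_nhds hx)).isSymmSndFDerivAt (by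
      rw [minSmoothness_of_isRCLikeNormedField]; exact ENat.LEInfty.out)
  have h2 : ∀ i j, pderiv2 i (pderiv2 j f) x = fderiv ℝ (fderiv ℝ f) x
      (EuclideanSpace.single i 1) (EuclideanSpace.single j 1) := by
    intro i j
    have h5 := h1.hasFDerivAt.clm_apply
      (hasFDerivAt_const (EuclideanSpace.single j (1 : ℝ) : EuclideanSpace ℝ (Fin 2)) x)
    have h6 : fderiv ℝ (pderiv2 j f) x = _ := h5.fderiv
    conv_lhs => rw [pderiv2]
    rw [h6]
    simp
  rw [h2, h2, hsymm.eq]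

end Divergence

/-! ## Harmonic heat flow in a coordinate patch -/

section PatchFlow

variable {k : ℕ}

/-- A solution of the harmonic map heat flow in a coordinate patch `Ω` with conformal
coefficients `Aⁱʲ = √g gⁱʲ` and volume density `m = √g`: the equation is only retained in
the tangential directions `∂ₜ U`, `∂ᵢ U`. -/
structure IsPatchFlow (Ω : Set (EuclideanSpace ℝ (Fin 2))) (T : ℝ)
    (A : EuclideanSpace ℝ (Fin 2) → Matrix (Fin 2) (Fin 2) ℝ) (m : EuclideanSpace ℝ (Fin 2) → ℝ)
    (U : EuclideanSpace ℝ (Fin 2) → ℝ → EuclideanSpace ℝ (Fin k)) : Prop where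
  isOpen : IsOpen Ω
  coeff_smooth : ∀ i j, ContDiffOn ℝ ∞ (fun x => A x i j) Ω
  coeff_symm : ∀ x ∈ Ω, A x 0 1 = A x 1 0
  coeff_nonneg : ∀ x ∈ Ω, ∀ f : EuclideanSpace ℝ (Fin 2) → EuclideanSpace ℝ (Fin k),
    0 ≤ dirichletForm (A x) f x
  density_smooth : ContDiffOn ℝ ∞ m Ω
  density_pos : ∀ x ∈ Ω, 0 < m x
  smooth : ContDiffOn ℝ ∞ (fun z : EuclideanSpace ℝ (Fin 2) × ℝ => U z.1 z.2) (Ω ×ˢ Ico 0 T)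
  equation_time : ∀ x ∈ Ω, ∀ t ∈ Ioo 0 T,
    inner ℝ (divGrad A (fun z => U z t) x) (deriv (fun s => U x s) t)
      = m x * ‖deriv (fun s => U x s) t‖ ^ 2
  equation_space : ∀ x ∈ Ω, ∀ t ∈ Ioo 0 T, ∀ i,
    inner ℝ (divGrad A (fun z => U z t) x) (pderiv2 i (fun z => U z t) x)
      = m x * inner ℝ (deriv (fun s => U x s) t) (pderiv2 i (fun z => U z t) x)

variable {Ω K : Set (EuclideanSpace ℝ (Fin 2))} {T : ℝ}
  {A : EuclideanSpace ℝ (Fin 2) → Matrix (Fin 2) (Fin 2) ℝ} {m : EuclideanSpace ℝ (Fin 2) → ℝ}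
  {U : EuclideanSpace ℝ (Fin 2) → ℝ → EuclideanSpace ℝ (Fin k)}

theorem IsPatchFlow.smooth_Ioo (H : IsPatchFlow Ω T A m U) :
    ContDiffOn ℝ ∞ (fun z : EuclideanSpace ℝ (Fin 2) × ℝ => U z.1 z.2) (Ω ×ˢ Ioo 0 T) :=
  H.smooth.mono (prod_mono le_rfl Ioo_subset_Ico_self)

theorem IsPatchFlow.contDiffOn_dirichletForm (H : IsPatchFlow Ω T A m U) :
    ContDiffOn ℝ ∞ (fun z : EuclideanSpace ℝ (Fin 2) × ℝ =>
      dirichletForm (A z.1) (fun y => U y z.2) z.1) (Ω ×ˢ Ioo 0 T) := by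
  have hp := fun i => contDiffOn_pderiv2_slice H.isOpen isOpen_Ioo H.smooth_Ioo i
  have hA : ∀ i j, ContDiffOn ℝ ∞ (fun z : EuclideanSpace ℝ (Fin 2) × ℝ => A z.1 i j)
      (Ω ×ˢ Ioo 0 T) := fun i j =>
    (H.coeff_smooth i j).comp contDiff_fst.contDiffOn (fun z hz => hz.1)
  exact ContDiffOn.sum fun i _ => ContDiffOn.sum fun j _ => (hA i j).mul ((hp i).inner ℝ (hp j))

theorem IsPatchFlow.continuousOn_dirichletForm (H : IsPatchFlow Ω T A m U) :
    ContinuousOn (fun z : EuclideanSpace ℝ (Fin 2) × ℝ =>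
      dirichletForm (A z.1) (fun y => U y z.2) z.1) (Ω ×ˢ Ico 0 T) := by
  have hp := fun i => continuousOn_pderiv2_slice H.isOpen H.smooth i
  have hA : ∀ i j, ContinuousOn (fun z : EuclideanSpace ℝ (Fin 2) × ℝ => A z.1 i j)
      (Ω ×ˢ Ico 0 T) := fun i j =>
    (H.coeff_smooth i j).continuousOn.comp continuousOn_fst (fun z hz => hz.1)
  exact continuousOn_finsetSum _ fun i _ => continuousOn_finsetSum _ fun j _ =>
    (hA i j).mul ((hp i).inner (hp j))

theorem IsPatchFlow.hasDerivAt_dirichletForm (H : IsPatchFlow Ω T A m U)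
    {x : EuclideanSpace ℝ (Fin 2)} (hx : x ∈ Ω) {t : ℝ} (ht : t ∈ Ioo 0 T) :
    HasDerivAt (fun s => dirichletForm (A x) (fun y => U y s) x)
      (2 * ∑ i, ∑ j, A x i j * inner ℝ (pderiv2 j (fun y => U y t) x)
        (pderiv2 i (fun y => deriv (fun s => U y s) t) x)) t := by
  have hp := fun i => hasDerivAt_pderiv2_slice H.isOpen isOpen_Ioo H.smooth_Ioo i hx ht
  have h1 : HasDerivAt (fun s => dirichletForm (A x) (fun y => U y s) x) _ t :=
    HasDerivAt.fun_sum fun i _ => HasDerivAt.fun_sum fun j _ =>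
      ((hp i).inner ℝ (hp j)).const_mul (A x i j)
  convert h1 using 1
  simp only [Fin.sum_univ_two, H.coeff_symm x hx]
  simp only [real_inner_comm (pderiv2 _ (fun y => U y t) x)]
  ring

end PatchFlow

/-! ### Rate of change of weighted energies in a coordinate patch -/

section WeightedEnergy

variable {k : ℕ} {Ω K : Set (EuclideanSpace ℝ (Fin 2))} {T : ℝ}
  {A : EuclideanSpace ℝ (Fin 2) → Matrix (Fin 2) (Fin 2) ℝ} {m : EuclideanSpace ℝ (Fin 2) → ℝ}
  {U : EuclideanSpace ℝ (Fin 2) → ℝ → EuclideanSpace ℝ (Fin k)}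

/-- The integrand of the rate of change of `½ ∫ ψ Aⁱʲ ∂ᵢU · ∂ⱼU`, to which the Pohozaev identity
with vector field `η x` has been added. -/
def weightedEnergyRate (A : EuclideanSpace ℝ (Fin 2) → Matrix (Fin 2) (Fin 2) ℝ)
    (m : EuclideanSpace ℝ (Fin 2) → ℝ) (U : EuclideanSpace ℝ (Fin 2) → ℝ → EuclideanSpace ℝ (Fin k))
    (ψ : EuclideanSpace ℝ (Fin 2) → ℝ → ℝ) (η : EuclideanSpace ℝ (Fin 2) → ℝ) (t : ℝ)
    (x : EuclideanSpace ℝ (Fin 2)) : ℝ :=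
  1 / 2 * deriv (fun s => ψ x s) t * dirichletForm (A x) (fun z => U z t) x
    - ψ x t * (m x * ‖deriv (fun s => U x s) t‖ ^ 2)
    - inner ℝ (covectorPairing (A x) (fun i => pderiv2 i (fun z => ψ z t) x) (fun z => U z t) x)
        (deriv (fun s => U x s) t)
    + (η x * (m x * inner ℝ (deriv (fun s => U x s) t) (radialDeriv (fun z => U z t) x))
      + inner ℝ (covectorPairing (A x) (fun i => pderiv2 i η x) (fun z => U z t) x)
          (radialDeriv (fun z => U z t) x)
      - 1 / 2 * radialDeriv η x * dirichletForm (A x) (fun z => U z t) x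
      - 1 / 2 * η x * dirichletForm (Matrix.of fun i j => radialDeriv (fun z => A z i j) x)
          (fun z => U z t) x)

theorem pderiv2_eq_zero_of_support {V : Type*} [NormedAddCommGroup V] [NormedSpace ℝ V]
    {f : EuclideanSpace ℝ (Fin 2) → V} (hK : IsClosed K) (h0 : ∀ x ∉ K, f x = 0)
    {x : EuclideanSpace ℝ (Fin 2)} (hx : x ∉ K) (i : Fin 2) : pderiv2 i f x = 0 := by
  have : f =ᶠ[𝓝 x] fun _ => 0 := by
    filter_upwards [hK.isOpen_compl.mem_nhds hx] with z hz using h0 z hz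
  rw [pderiv2_congr i this, pderiv2_const]

/-- The rate is ½∂ₜ(ψ Aⁱʲ∂ᵢU·∂ⱼU) minus the divergence of the energy flux with v = ∂ₜU, plus the
divergence of the Pohozaev flux with weight η. Both divergences integrate to zero, so η is a free
parameter. The subtraction removes the derivatives of ∂ₜU, and the tested equations replace
`divGrad` by the time derivative. -/
theorem IsPatchFlow.hasDerivAt_weightedEnergy (H : IsPatchFlow Ω T A m U)
    (hK : IsCompact K) (hKΩ : K ⊆ Ω) {ψ : EuclideanSpace ℝ (Fin 2) → ℝ → ℝ}
    {η : EuclideanSpace ℝ (Fin 2) → ℝ}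
    (hψ : ContDiffOn ℝ ∞ (fun z : EuclideanSpace ℝ (Fin 2) × ℝ => ψ z.1 z.2) (Ω ×ˢ Ioo 0 T))
    (hψ0 : ∀ x ∉ K, ∀ t ∈ Ioo 0 T, ψ x t = 0)
    (hη : ContDiffOn ℝ ∞ η Ω) (hη0 : ∀ x ∉ K, η x = 0) {t : ℝ} (ht : t ∈ Ioo 0 T) :
    Integrable (weightedEnergyRate A m U ψ η t) ∧
      HasDerivAt (fun s => 1 / 2 * ∫ x, ψ x s * dirichletForm (A x) (fun z => U z s) x)
        (∫ x, weightedEnergyRate A m U ψ η t x) t := by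
  set f : EuclideanSpace ℝ (Fin 2) → EuclideanSpace ℝ (Fin k) := fun z => U z t with hf
  set v : EuclideanSpace ℝ (Fin 2) → EuclideanSpace ℝ (Fin k) :=
    fun z => deriv (fun s => U z s) t with hv
  have hfs : ContDiffOn ℝ ∞ f Ω := contDiffOn_slice H.smooth_Ioo ht
  have hvs : ContDiffOn ℝ ∞ v Ω :=
    contDiffOn_slice (contDiffOn_deriv_slice H.isOpen isOpen_Ioo H.smooth_Ioo) ht
  have hψs : ContDiffOn ℝ ∞ (fun z => ψ z t) Ω := contDiffOn_slice hψ ht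
  have hps := fun i => contDiffOn_pderiv2 H.isOpen hfs i
  have hes : ContDiffOn ℝ ∞ (fun x => dirichletForm (A x) f x) Ω :=
    contDiffOn_slice (U := fun x s => dirichletForm (A x) (fun z => U z s) x)
      H.contDiffOn_dirichletForm ht
  have hcs : ∀ i : Fin 2, ContDiffOn ℝ ∞ (fun z : EuclideanSpace ℝ (Fin 2) => z i) Ω := fun i =>
    (EuclideanSpace.proj i : EuclideanSpace ℝ (Fin 2) →L[ℝ] ℝ).contDiff.contDiffOn
  have hrs : ContDiffOn ℝ ∞ (radialDeriv f) Ω :=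
    ContDiffOn.sum fun i _ => (hcs i).smul (hps i)
  have hJ1 : ∀ i, ContDiffOn ℝ ∞ (energyFlux A (fun z => ψ z t) f v i) Ω := fun i =>
    hψs.mul (ContDiffOn.sum fun j _ => (H.coeff_smooth i j).mul ((hps j).inner ℝ hvs))
  have hJ2 : ∀ i, ContDiffOn ℝ ∞ (pohozaevFlux A η f i) Ω := fun i =>
    hη.mul ((ContDiffOn.sum fun j _ => (H.coeff_smooth i j).mul ((hps j).inner ℝ hrs)).sub
      (contDiffOn_const.mul ((hcs i).mul hes)))
  have hI1 := fun i => integral_pderiv2_eq_zero H.isOpen hK hKΩ (hJ1 i)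
    (fun x hx => by simp [energyFlux, hψ0 x hx t ht]) i
  have hI2 := fun i => integral_pderiv2_eq_zero H.isOpen hK hKΩ (hJ2 i)
    (fun x hx => by simp [pohozaevFlux, hη0 x hx]) i
  obtain ⟨hq1, hq2⟩ := hasDerivAt_integral_of_support
    (q := fun x s => ψ x s * dirichletForm (A x) (fun z => U z s) x) H.isOpen isOpen_Ioo hK hKΩ
    (hψ.mul H.contDiffOn_dirichletForm) (fun x hx s hs => by simp [hψ0 x hx s hs]) ht
  have heq : weightedEnergyRate A m U ψ η t = fun x =>
      1 / 2 * deriv (fun s => ψ x s * dirichletForm (A x) (fun z => U z s) x) t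
        - (pderiv2 0 (energyFlux A (fun z => ψ z t) f v 0) x
          + pderiv2 1 (energyFlux A (fun z => ψ z t) f v 1) x)
        + (pderiv2 0 (pohozaevFlux A η f 0) x + pderiv2 1 (pohozaevFlux A η f 1) x) := by
    ext1 x
    -- On K the product rules apply. Off K the weights vanish in a neighbourhood, and both sides are
    -- zero whatever the coordinate expressions are there.
    by_cases hx : x ∈ K
    · have hxΩ := hKΩ hx
      have hN := H.isOpen.mem_nhds hxΩ
      have dA : ∀ i j, DifferentiableAt ℝ (fun z => A z i j) x := fun i j =>
        ((H.coeff_smooth i j).differentiableOn (by simp)).differentiableAt hN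
      have dp : ∀ j, DifferentiableAt ℝ (pderiv2 j f) x := fun j =>
        ((hps j).differentiableOn (by simp)).differentiableAt hN
      have dv : DifferentiableAt ℝ v x := (hvs.differentiableOn (by simp)).differentiableAt hN
      have dψ : DifferentiableAt ℝ (fun z => ψ z t) x :=
        (hψs.differentiableOn (by simp)).differentiableAt hN
      have dη : DifferentiableAt ℝ η x := (hη.differentiableOn (by simp)).differentiableAt hN
      have e1 := sum_pderiv2_energyFlux (h := fun z => ψ z t) dA dp dv dψ
      have e2 := sum_pderiv2_pohozaevFlux dA (H.coeff_symm x hxΩ) dp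
        (pderiv2_comm H.isOpen hfs hxΩ) dη
      rw [Fin.sum_univ_two] at e1 e2
      have e3 : deriv (fun s => ψ x s * dirichletForm (A x) (fun z => U z s) x) t = _ :=
        ((hasDerivAt_slice H.isOpen isOpen_Ioo hψ hxΩ ht).differentiableAt.hasDerivAt.mul
          (H.hasDerivAt_dirichletForm hxΩ ht)).deriv
      have e4 : inner ℝ (divGrad A f x) (radialDeriv f x)
          = m x * inner ℝ (v x) (radialDeriv f x) := by
        simp only [radialDeriv, Fin.sum_univ_two, inner_add_right, inner_smul_right]
        have := H.equation_space x hxΩ t ht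
        rw [this 0, this 1]; ring
      rw [e1, e2, e3, e4, H.equation_time x hxΩ t ht, weightedEnergyRate]
      simp only [hf, hv]
      ring
    · have hc := hK.isClosed
      have e1 : ∀ i, pderiv2 i (energyFlux A (fun z => ψ z t) f v i) x = 0 := fun i =>
        pderiv2_eq_zero_of_support hc (fun z hz => by simp [energyFlux, hψ0 z hz t ht]) hx i
      have e2 : ∀ i, pderiv2 i (pohozaevFlux A η f i) x = 0 := fun i =>
        pderiv2_eq_zero_of_support hc (fun z hz => by simp [pohozaevFlux, hη0 z hz]) hx i
      have e3 : ∀ i, pderiv2 i (fun z => ψ z t) x = 0 := fun i =>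
        pderiv2_eq_zero_of_support hc (fun z hz => hψ0 z hz t ht) hx i
      have e4 : ∀ i, pderiv2 i η x = 0 := fun i => pderiv2_eq_zero_of_support hc hη0 hx i
      have e5 : deriv (fun s => ψ x s) t = 0 := by
        have : (fun s => ψ x s) =ᶠ[𝓝 t] fun _ => 0 := by
          filter_upwards [isOpen_Ioo.mem_nhds ht] with s hs using hψ0 x hx s hs
        rw [this.deriv_eq]; simp
      have e6 : deriv (fun s => ψ x s * dirichletForm (A x) (fun z => U z s) x) t = 0 := by
        have : (fun s => ψ x s * dirichletForm (A x) (fun z => U z s) x) =ᶠ[𝓝 t] fun _ => 0 := by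
          filter_upwards [isOpen_Ioo.mem_nhds ht] with s hs
          rw [hψ0 x hx s hs, zero_mul]
        rw [this.deriv_eq]; simp
      simp [weightedEnergyRate, e1, e2, e3, e4, e5, e6, covectorPairing, hψ0 x hx t ht, hη0 x hx,
        radialDeriv]
  have i1 := hq1.const_mul (1 / 2)
  have i2 := (hI1 0).1.add (hI1 1).1
  have i3 := (hI2 0).1.add (hI2 1).1
  rw [heq]
  refine ⟨(i1.sub i2).add i3, ?_⟩
  have : ∫ x, (1 / 2 * deriv (fun s => ψ x s * dirichletForm (A x) (fun z => U z s) x) t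
        - (pderiv2 0 (energyFlux A (fun z => ψ z t) f v 0) x
          + pderiv2 1 (energyFlux A (fun z => ψ z t) f v 1) x)
        + (pderiv2 0 (pohozaevFlux A η f 0) x + pderiv2 1 (pohozaevFlux A η f 1) x))
      = 1 / 2 * ∫ x, deriv (fun s => ψ x s * dirichletForm (A x) (fun z => U z s) x) t := by
    have j1 := integral_add (i1.sub i2) i3
    have j2 := integral_sub i1 i2
    have j3 := integral_add (hI1 0).1 (hI1 1).1
    have j4 := integral_add (hI2 0).1 (hI2 1).1
    simp only [Pi.add_apply, Pi.sub_apply] at j1 j2 j3 j4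
    rw [j1, j2, j3, j4, (hI1 0).2, (hI1 1).2, (hI2 0).2, (hI2 1).2, integral_const_mul]
    ring
  simp only [this]
  exact hq2.const_mul (1 / 2)

/-- Derivatives are available only for t > 0; continuity at t = 0 allows the monotonicity to start
at the initial time s' = -log T. -/
theorem IsPatchFlow.continuousOn_weightedEnergy (H : IsPatchFlow Ω T A m U)
    (hK : IsCompact K) (hKΩ : K ⊆ Ω) {ψ : EuclideanSpace ℝ (Fin 2) → ℝ → ℝ}
    (hψ : ContinuousOn (fun z : EuclideanSpace ℝ (Fin 2) × ℝ => ψ z.1 z.2) (Ω ×ˢ Ico 0 T))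
    (hψ0 : ∀ x ∉ K, ∀ t ∈ Ico 0 T, ψ x t = 0) :
    ContinuousOn (fun s => 1 / 2 * ∫ x, ψ x s * dirichletForm (A x) (fun z => U z s) x)
      (Ico 0 T) := by
  have h1 := continuousOn_prod_of_support
    (F := fun x s => ψ x s * dirichletForm (A x) (fun z => U z s) x) (J := Ico 0 T)
    H.isOpen hK.isClosed hKΩ (hψ.mul H.continuousOn_dirichletForm)
    (fun x hx t ht => by simp [hψ0 x hx t ht])
  refine continuousOn_const.mul (continuousOn_integral_of_compact_support hK
    (f := fun s x => ψ x s * dirichletForm (A x) (fun z => U z s) x) ?_ ?_)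
  · exact h1.comp (f := Prod.swap) continuous_swap.continuousOn (fun z hz => ⟨trivial, hz.1⟩)
  · intro s x hs hx
    simp [hψ0 x hx s hs]

end WeightedEnergy

/-! ## The metric in coordinates -/

section Charts

set_option linter.unusedSectionVars false

variable {M : Type*} [TopologicalSpace M] [ChartedSpace (EuclideanSpace ℝ (Fin 2)) M]
  [IsManifold (𝓡 2) ∞ M] {g : SurfaceMetric M}
  {e e₁ e₂ : OpenPartialHomeomorph M (EuclideanSpace ℝ (Fin 2))}

/-- The coordinate vector field is the tangent map of the inverse chart applied to a constant
section, and tangent maps of smooth maps are smooth. -/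
theorem contMDiffOn_mfderiv_symm_single (he : e ∈ IsManifold.maximalAtlas (𝓡 2) ∞ M) (i : Fin 2) :
    ContMDiffOn (𝓡 2) ((𝓡 2).tangent) ∞
      (fun x => (⟨e.symm x, mfderiv (𝓡 2) (𝓡 2) e.symm x (EuclideanSpace.single i (1 : ℝ))⟩ :
        TangentBundle (𝓡 2) M)) e.target := by
  have hs := contMDiffOn_symm_of_mem_maximalAtlas he
  have : IsManifold (𝓡 2) 1 M := IsManifold.of_le (n := ∞) (by simp)
  have h1 := hs.contMDiffOn_tangentMapWithin (m := ∞) (by simp) e.open_target.uniqueMDiffOn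
  have h2 : ContMDiffOn (𝓡 2) ((𝓡 2).tangent) ∞
      (fun x : EuclideanSpace ℝ (Fin 2) => (⟨x, EuclideanSpace.single i (1 : ℝ)⟩ :
        TangentBundle (𝓡 2) (EuclideanSpace ℝ (Fin 2)))) e.target :=
    contMDiffOn_vectorSpace_iff_contDiffOn.2 contDiffOn_const
  have h3 := h1.comp h2 (fun x hx => hx)
  refine h3.congr fun x hx => ?_
  simp [tangentMapWithin, mfderivWithin_of_isOpen e.open_target hx]

theorem contDiffOn_metricMatrix (he : e ∈ IsManifold.maximalAtlas (𝓡 2) ∞ M) (i j : Fin 2) :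
    ContDiffOn ℝ ∞ (fun x => metricMatrix g e x i j) e.target := by
  rw [← contMDiffOn_iff_contDiffOn]
  intro x hx
  have hv := contMDiffOn_mfderiv_symm_single he i x hx
  have hw := contMDiffOn_mfderiv_symm_single he j x hx
  have hb : ContMDiffWithinAt (𝓡 2) (𝓡 2) ∞ e.symm e.target x :=
    contMDiffOn_symm_of_mem_maximalAtlas he x hx
  have : ContMDiffWithinAt (𝓡 2) ((𝓡 2).prod 𝓘(ℝ)) ∞
      (fun z => Bundle.TotalSpace.mk' ℝ (E := Bundle.Trivial M ℝ) (e.symm z)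
        (g.inner (e.symm z)
          (mfderiv (𝓡 2) (𝓡 2) e.symm z (EuclideanSpace.single i (1 : ℝ)))
          (mfderiv (𝓡 2) (𝓡 2) e.symm z (EuclideanSpace.single j (1 : ℝ))))) e.target x := by
    apply ContMDiffWithinAt.clm_bundle_apply₂ (F₁ := EuclideanSpace ℝ (Fin 2))
      (F₂ := EuclideanSpace ℝ (Fin 2))
    · exact ContMDiffAt.comp_contMDiffWithinAt x g.contMDiff.contMDiffAt hb
    · exact hv
    · exact hw
  simp only [Bundle.contMDiffWithinAt_totalSpace] at this
  exact this.2

theorem mdifferentiableAt_chart_symm (he : e ∈ IsManifold.maximalAtlas (𝓡 2) ∞ M)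
    {x : EuclideanSpace ℝ (Fin 2)} (hx : x ∈ e.target) :
    MDifferentiableAt (𝓡 2) (𝓡 2) e.symm x :=
  (contMDiffAt_symm_of_mem_maximalAtlas he hx).mdifferentiableAt (by simp)

/-- The change of coordinates is smooth. -/
theorem contDiffOn_transition (he₁ : e₁ ∈ IsManifold.maximalAtlas (𝓡 2) ∞ M)
    (he₂ : e₂ ∈ IsManifold.maximalAtlas (𝓡 2) ∞ M) :
    ContDiffOn ℝ ∞ (fun z => e₁ (e₂.symm z)) (e₂.target ∩ e₂.symm ⁻¹' e₁.source) := by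
  rw [← contMDiffOn_iff_contDiffOn]
  exact (contMDiffOn_of_mem_maximalAtlas he₁).comp
    ((contMDiffOn_symm_of_mem_maximalAtlas he₂).mono inter_subset_left) (fun x hx => hx.2)

theorem isOpen_transition : IsOpen (e₂.target ∩ e₂.symm ⁻¹' e₁.source) :=
  e₂.symm.isOpen_inter_preimage e₁.open_source

theorem differentiableAt_transition (he₁ : e₁ ∈ IsManifold.maximalAtlas (𝓡 2) ∞ M)
    (he₂ : e₂ ∈ IsManifold.maximalAtlas (𝓡 2) ∞ M) {x : EuclideanSpace ℝ (Fin 2)}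
    (hx : x ∈ e₂.target) (hx₁ : e₂.symm x ∈ e₁.source) :
    DifferentiableAt ℝ (fun z => e₁ (e₂.symm z)) x :=
  ((contDiffOn_transition he₁ he₂).differentiableOn (by simp)).differentiableAt
    (isOpen_transition.mem_nhds ⟨hx, hx₁⟩)

/-- The Jacobian matrix of the change of coordinates. -/
def transitionJacobian (e₁ e₂ : OpenPartialHomeomorph M (EuclideanSpace ℝ (Fin 2)))
    (x : EuclideanSpace ℝ (Fin 2)) : Matrix (Fin 2) (Fin 2) ℝ :=
  Matrix.of fun k i => pderiv2 i (fun z => e₁ (e₂.symm z)) x k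

theorem euclidean_eq_sum (ξ : EuclideanSpace ℝ (Fin 2)) :
    ξ = ∑ i, ξ i • (EuclideanSpace.single i (1 : ℝ) : EuclideanSpace ℝ (Fin 2)) := by
  ext j; fin_cases j <;> simp [Fin.sum_univ_two]

theorem fderiv_transition_single (i : Fin 2) (x : EuclideanSpace ℝ (Fin 2)) :
    fderiv ℝ (fun z => e₁ (e₂.symm z)) x (EuclideanSpace.single i 1)
      = ∑ k, transitionJacobian e₁ e₂ x k i • EuclideanSpace.single k (1 : ℝ) :=
  euclidean_eq_sum _

theorem eventually_symm_transition {x : EuclideanSpace ℝ (Fin 2)}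
    (hx : x ∈ e₂.target) (hx₁ : e₂.symm x ∈ e₁.source) :
    ∀ᶠ z in 𝓝 x, e₂.symm z = e₁.symm (e₁ (e₂.symm z)) := by
  filter_upwards [isOpen_transition.mem_nhds ⟨hx, hx₁⟩] with z hz
  exact (e₁.left_inv hz.2).symm

theorem pderiv2_comp_chart {V : Type*} [NormedAddCommGroup V] [NormedSpace ℝ V] {f : M → V}
    (he₁ : e₁ ∈ IsManifold.maximalAtlas (𝓡 2) ∞ M) (he₂ : e₂ ∈ IsManifold.maximalAtlas (𝓡 2) ∞ M)
    {x : EuclideanSpace ℝ (Fin 2)} (hx : x ∈ e₂.target) (hx₁ : e₂.symm x ∈ e₁.source)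
    (hf : DifferentiableAt ℝ (fun z => f (e₁.symm z)) (e₁ (e₂.symm x))) (i : Fin 2) :
    pderiv2 i (fun z => f (e₂.symm z)) x
      = ∑ k, transitionJacobian e₁ e₂ x k i •
          pderiv2 k (fun z => f (e₁.symm z)) (e₁ (e₂.symm x)) := by
  have h1 : (fun z => f (e₂.symm z)) =ᶠ[𝓝 x]
      (fun z => f (e₁.symm z)) ∘ fun z => e₁ (e₂.symm z) := by
    filter_upwards [eventually_symm_transition hx hx₁] with z hz
    exact congrArg f hz
  rw [pderiv2_congr i h1, pderiv2, fderiv_comp x hf (differentiableAt_transition he₁ he₂ hx hx₁)]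
  simp only [ContinuousLinearMap.comp_apply, fderiv_transition_single, map_sum, map_smul]
  rfl

theorem mfderiv_symm_transition (he₁ : e₁ ∈ IsManifold.maximalAtlas (𝓡 2) ∞ M)
    (he₂ : e₂ ∈ IsManifold.maximalAtlas (𝓡 2) ∞ M)
    {x : EuclideanSpace ℝ (Fin 2)} (hx : x ∈ e₂.target) (hx₁ : e₂.symm x ∈ e₁.source)
    (ξ : EuclideanSpace ℝ (Fin 2)) :
    (mfderiv (𝓡 2) (𝓡 2) e₂.symm x ξ : EuclideanSpace ℝ (Fin 2))
      = mfderiv (𝓡 2) (𝓡 2) e₁.symm (e₁ (e₂.symm x))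
          (fderiv ℝ (fun z => e₁ (e₂.symm z)) x ξ) := by
  have h1 : e₂.symm =ᶠ[𝓝 x] e₁.symm ∘ fun z => e₁ (e₂.symm z) := by
    filter_upwards [eventually_symm_transition hx hx₁] with z hz using hz
  have h2 := mdifferentiableAt_chart_symm he₁ (e₁.map_source hx₁)
  have h3 : MDifferentiableAt (𝓡 2) (𝓡 2) (fun z => e₁ (e₂.symm z)) x :=
    (differentiableAt_transition he₁ he₂ hx hx₁).mdifferentiableAt
  have h4 := mfderiv_comp (I := 𝓡 2) (I' := 𝓡 2) (I'' := 𝓡 2) x h2 h3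
  rw [h1.mfderiv_eq, h4, mfderiv_eq_fderiv]
  rfl

theorem metricMatrix_symm (x : EuclideanSpace ℝ (Fin 2)) (i j : Fin 2) :
    metricMatrix g e x i j = metricMatrix g e x j i :=
  g.symm _ _ _

/-- The metric at the point with coordinates `x`, as a bilinear form on the coordinate plane. -/
def metricForm (g : SurfaceMetric M) (e : OpenPartialHomeomorph M (EuclideanSpace ℝ (Fin 2)))
    (x : EuclideanSpace ℝ (Fin 2)) :
    EuclideanSpace ℝ (Fin 2) →L[ℝ] EuclideanSpace ℝ (Fin 2) →L[ℝ] ℝ :=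
  let Q : EuclideanSpace ℝ (Fin 2) →L[ℝ] EuclideanSpace ℝ (Fin 2) →L[ℝ] ℝ := g.inner (e.symm x)
  let L : EuclideanSpace ℝ (Fin 2) →L[ℝ] EuclideanSpace ℝ (Fin 2) :=
    mfderiv (𝓡 2) (𝓡 2) e.symm x
  Q.bilinearComp L L

theorem metricForm_apply (x ξ ζ : EuclideanSpace ℝ (Fin 2)) :
    metricForm g e x ξ ζ = g.inner (e.symm x) (mfderiv (𝓡 2) (𝓡 2) e.symm x ξ)
      (mfderiv (𝓡 2) (𝓡 2) e.symm x ζ) := rfl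

theorem metricMatrix_apply (x : EuclideanSpace ℝ (Fin 2)) (i j : Fin 2) :
    metricMatrix g e x i j
      = metricForm g e x (EuclideanSpace.single i 1) (EuclideanSpace.single j 1) := rfl

/-- All later invariance statements (energy density, gradient pairing, volume) are matrix algebra
based on this congruence G₂ = Jᵀ G₁ J. -/
theorem metricMatrix_transition (he₁ : e₁ ∈ IsManifold.maximalAtlas (𝓡 2) ∞ M)
    (he₂ : e₂ ∈ IsManifold.maximalAtlas (𝓡 2) ∞ M)
    {x : EuclideanSpace ℝ (Fin 2)} (hx : x ∈ e₂.target) (hx₁ : e₂.symm x ∈ e₁.source) :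
    metricMatrix g e₂ x = (transitionJacobian e₁ e₂ x).transpose
      * metricMatrix g e₁ (e₁ (e₂.symm x)) * transitionJacobian e₁ e₂ x := by
  ext i j
  have h1 := fun i => mfderiv_symm_transition he₁ he₂ hx hx₁ (EuclideanSpace.single i 1)
  have h2 : e₁.symm (e₁ (e₂.symm x)) = e₂.symm x := e₁.left_inv hx₁
  have h3 : metricMatrix g e₂ x i j = metricForm g e₁ (e₁ (e₂.symm x))
      (fderiv ℝ (fun z => e₁ (e₂.symm z)) x (EuclideanSpace.single i 1))
      (fderiv ℝ (fun z => e₁ (e₂.symm z)) x (EuclideanSpace.single j 1)) := by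
    rw [metricForm_apply]
    simp only [metricMatrix, Matrix.of_apply]
    rw [h2]
    exact congrArg₂ (fun a b => g.inner (e₂.symm x) a b) (h1 i) (h1 j)
  rw [h3, fderiv_transition_single, fderiv_transition_single]
  simp only [Matrix.mul_apply, Matrix.transpose_apply, Fin.sum_univ_two, metricMatrix_apply,
    map_add, map_smul, add_apply, smul_apply, smul_eq_mul]
  ring

theorem metricForm_eq_sum (x ξ : EuclideanSpace ℝ (Fin 2)) :
    metricForm g e x ξ ξ = ∑ i, ∑ j, metricMatrix g e x i j * ξ i * ξ j := by
  conv_lhs => rw [euclidean_eq_sum ξ]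
  simp only [Fin.sum_univ_two, metricMatrix_apply,
    map_add, map_smul, add_apply, smul_apply, smul_eq_mul]
  ring

theorem transitionJacobian_self {x : EuclideanSpace ℝ (Fin 2)} (hx : x ∈ e.target) :
    fderiv ℝ (fun z => e (e.symm z)) x = ContinuousLinearMap.id ℝ _ := by
  have : (fun z => e (e.symm z)) =ᶠ[𝓝 x] id := by
    filter_upwards [e.open_target.mem_nhds hx] with z hz using e.right_inv hz
  rw [this.fderiv_eq, fderiv_id]

theorem metricForm_pos (he : e ∈ IsManifold.maximalAtlas (𝓡 2) ∞ M)
    {x : EuclideanSpace ℝ (Fin 2)} (hx : x ∈ e.target) {ξ : EuclideanSpace ℝ (Fin 2)} (hξ : ξ ≠ 0) :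
    0 < metricForm g e x ξ ξ := by
  rw [metricForm_apply]
  refine g.pos _ _ fun h0 => hξ ?_
  have h2 := mdifferentiableAt_chart_symm he hx
  have h1 : MDifferentiableAt (𝓡 2) (𝓡 2) e (e.symm x) :=
    (contMDiffAt_of_mem_maximalAtlas he (e.map_target hx)).mdifferentiableAt (by simp)
  have h4 := mfderiv_comp (I := 𝓡 2) (I' := 𝓡 2) (I'' := 𝓡 2) x h1 h2
  have h5 : mfderiv (𝓡 2) (𝓡 2) (e ∘ e.symm) x = ContinuousLinearMap.id ℝ _ := by
    rw [mfderiv_eq_fderiv]; exact transitionJacobian_self hx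
  have h6 : mfderiv (𝓡 2) (𝓡 2) (e ∘ e.symm) x ξ = ξ := by rw [h5]; rfl
  rw [h4] at h6
  rw [← h6]
  refine (congrArg (mfderiv (𝓡 2) (𝓡 2) e (e.symm x)) h0).trans ?_
  exact map_zero _

theorem metricMatrix_zero_zero_pos (he : e ∈ IsManifold.maximalAtlas (𝓡 2) ∞ M)
    {x : EuclideanSpace ℝ (Fin 2)} (hx : x ∈ e.target) : 0 < metricMatrix g e x 0 0 := by
  rw [metricMatrix_apply]
  exact metricForm_pos he hx (by simp)

theorem metricMatrix_det_pos (he : e ∈ IsManifold.maximalAtlas (𝓡 2) ∞ M)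
    {x : EuclideanSpace ℝ (Fin 2)} (hx : x ∈ e.target) : 0 < (metricMatrix g e x).det := by
  have h0 := metricMatrix_zero_zero_pos (g := g) he hx
  -- On the vector (g₀₁, -g₀₀) the quadratic form takes the value g₀₀ det g.
  have h1 := metricForm_pos (g := g) he hx (ξ := !₂[metricMatrix g e x 0 1, -metricMatrix g e x 0 0])
    (by
      intro h
      have := congrArg (fun ξ : EuclideanSpace ℝ (Fin 2) => ξ 1) h
      simp at this
      exact h0.ne' this)
  rw [metricForm_eq_sum] at h1
  simp only [Fin.sum_univ_two, metricMatrix_symm x 1 0] at h1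
  rw [Matrix.det_fin_two, metricMatrix_symm x 1 0]
  simp at h1
  have h2 : 0 < metricMatrix g e x 0 0 * (metricMatrix g e x 0 0 * metricMatrix g e x 1 1
      - metricMatrix g e x 0 1 * metricMatrix g e x 0 1) := by linarith
  exact pos_of_mul_pos_right h2 h0.le

theorem transitionJacobian_det_ne_zero (he₁ : e₁ ∈ IsManifold.maximalAtlas (𝓡 2) ∞ M)
    (he₂ : e₂ ∈ IsManifold.maximalAtlas (𝓡 2) ∞ M) (g : SurfaceMetric M)
    {x : EuclideanSpace ℝ (Fin 2)} (hx : x ∈ e₂.target) (hx₁ : e₂.symm x ∈ e₁.source) :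
    (transitionJacobian e₁ e₂ x).det ≠ 0 := by
  intro h
  have h1 := metricMatrix_det_pos (g := g) he₂ hx
  rw [metricMatrix_transition he₁ he₂ hx hx₁, Matrix.det_mul, h, mul_zero] at h1
  exact h1.ne' rfl

theorem metricMatrix_inv_transition (he₁ : e₁ ∈ IsManifold.maximalAtlas (𝓡 2) ∞ M)
    (he₂ : e₂ ∈ IsManifold.maximalAtlas (𝓡 2) ∞ M)
    {x : EuclideanSpace ℝ (Fin 2)} (hx : x ∈ e₂.target) (hx₁ : e₂.symm x ∈ e₁.source) :
    transitionJacobian e₁ e₂ x * (metricMatrix g e₂ x)⁻¹ * (transitionJacobian e₁ e₂ x).transpose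
      = (metricMatrix g e₁ (e₁ (e₂.symm x)))⁻¹ := by
  have h0 := transitionJacobian_det_ne_zero he₁ he₂ g hx hx₁
  have h1 : IsUnit (transitionJacobian e₁ e₂ x).det := h0.isUnit
  have h2 : IsUnit (transitionJacobian e₁ e₂ x).transpose.det := by rwa [Matrix.det_transpose]
  rw [metricMatrix_transition he₁ he₂ hx hx₁, Matrix.mul_inv_rev, Matrix.mul_inv_rev]
  calc _ = (transitionJacobian e₁ e₂ x * (transitionJacobian e₁ e₂ x)⁻¹)
        * (metricMatrix g e₁ (e₁ (e₂.symm x)))⁻¹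
        * ((transitionJacobian e₁ e₂ x).transpose⁻¹ * (transitionJacobian e₁ e₂ x).transpose) := by
          simp only [Matrix.mul_assoc]
    _ = _ := by rw [Matrix.mul_nonsing_inv _ h1, Matrix.nonsing_inv_mul _ h2]; simp

theorem gradSq_transition {k : ℕ} {f : M → EuclideanSpace ℝ (Fin k)}
    (he₁ : e₁ ∈ IsManifold.maximalAtlas (𝓡 2) ∞ M) (he₂ : e₂ ∈ IsManifold.maximalAtlas (𝓡 2) ∞ M)
    {x : EuclideanSpace ℝ (Fin 2)} (hx : x ∈ e₂.target) (hx₁ : e₂.symm x ∈ e₁.source)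
    (hf : DifferentiableAt ℝ (fun z => f (e₁.symm z)) (e₁ (e₂.symm x))) :
    gradSq (metricMatrix g e₂ x) (fun z => f (e₂.symm z)) x
      = gradSq (metricMatrix g e₁ (e₁ (e₂.symm x))) (fun z => f (e₁.symm z)) (e₁ (e₂.symm x)) := by
  have h := metricMatrix_inv_transition (g := g) he₁ he₂ hx hx₁
  simp only [gradSq, pderiv2_comp_chart he₁ he₂ hx hx₁ hf, ← h, Matrix.mul_apply,
    Matrix.transpose_apply, Fin.sum_univ_two, inner_add_left, inner_add_right, inner_smul_left,
    inner_smul_right, RCLike.conj_to_real]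
  ring

theorem covectorPairing_transition {k : ℕ} {f : M → EuclideanSpace ℝ (Fin k)} {χ : M → ℝ}
    (he₁ : e₁ ∈ IsManifold.maximalAtlas (𝓡 2) ∞ M) (he₂ : e₂ ∈ IsManifold.maximalAtlas (𝓡 2) ∞ M)
    {x : EuclideanSpace ℝ (Fin 2)} (hx : x ∈ e₂.target) (hx₁ : e₂.symm x ∈ e₁.source)
    (hf : DifferentiableAt ℝ (fun z => f (e₁.symm z)) (e₁ (e₂.symm x)))
    (hχ : DifferentiableAt ℝ (fun z => χ (e₁.symm z)) (e₁ (e₂.symm x))) :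
    covectorPairing (metricMatrix g e₂ x)⁻¹ (fun i => pderiv2 i (fun z => χ (e₂.symm z)) x)
        (fun z => f (e₂.symm z)) x
      = covectorPairing (metricMatrix g e₁ (e₁ (e₂.symm x)))⁻¹
          (fun i => pderiv2 i (fun z => χ (e₁.symm z)) (e₁ (e₂.symm x)))
          (fun z => f (e₁.symm z)) (e₁ (e₂.symm x)) := by
  have h := metricMatrix_inv_transition (g := g) he₁ he₂ hx hx₁
  simp only [covectorPairing, pderiv2_comp_chart he₁ he₂ hx hx₁ hf,
    pderiv2_comp_chart he₁ he₂ hx hx₁ hχ, ← h, Matrix.mul_apply,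
    Matrix.transpose_apply, Fin.sum_univ_two, smul_add, smul_smul, smul_eq_mul]
  module

theorem sqrt_det_transition (he₁ : e₁ ∈ IsManifold.maximalAtlas (𝓡 2) ∞ M)
    (he₂ : e₂ ∈ IsManifold.maximalAtlas (𝓡 2) ∞ M)
    {x : EuclideanSpace ℝ (Fin 2)} (hx : x ∈ e₂.target) (hx₁ : e₂.symm x ∈ e₁.source) :
    Real.sqrt (metricMatrix g e₂ x).det = |(fderiv ℝ (fun z => e₁ (e₂.symm z)) x).det|
      * Real.sqrt (metricMatrix g e₁ (e₁ (e₂.symm x))).det := by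
  have h1 : (fderiv ℝ (fun z => e₁ (e₂.symm z)) x).det = (transitionJacobian e₁ e₂ x).det := by
    rw [ContinuousLinearMap.det, ← LinearMap.det_toMatrix (EuclideanSpace.basisFun (Fin 2) ℝ).toBasis]
    congr 1
  rw [metricMatrix_transition he₁ he₂ hx hx₁, Matrix.det_mul, Matrix.det_mul, Matrix.det_transpose, h1,
    ← Real.sqrt_sq_eq_abs, ← Real.sqrt_mul (sq_nonneg _)]
  congr 1; ring

end Charts

/-! ## Tangency -/

section Tangency

variable {k : ℕ} {N : Set (EuclideanSpace ℝ (Fin k))}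

/-- A derivative maps the tangent cone of the source, here everything, into the tangent cone of the
image. It is used both in time and in space. -/
theorem fderiv_mem_tangentSpaceOf {E : Type*} [NormedAddCommGroup E] [NormedSpace ℝ E]
    {f : E → EuclideanSpace ℝ (Fin k)} {s : Set E} {x : E} (hs : s ∈ 𝓝 x) (hfN : MapsTo f s N)
    (hf : DifferentiableAt ℝ f x) (ξ : E) : fderiv ℝ f x ξ ∈ tangentSpaceOf N (f x) := by
  have h1 := hf.hasFDerivAt.hasFDerivWithinAt (s := s)
  have h2 := h1.mapsTo_tangent_cone (show ξ ∈ tangentConeAt ℝ s x by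
    simp [tangentConeAt_of_mem_nhds hs])
  exact Submodule.subset_span (tangentConeAt_mono hfN.image_subset h2)

/-- Each value of the second fundamental form is a projection onto the normal space. Nothing else
about N enters the estimates. -/
theorem inner_secondFormTrace (G : Matrix (Fin 2) (Fin 2) ℝ)
    (f : EuclideanSpace ℝ (Fin 2) → EuclideanSpace ℝ (Fin k)) (x : EuclideanSpace ℝ (Fin 2))
    {v : EuclideanSpace ℝ (Fin k)} (hv : v ∈ tangentSpaceOf N (f x)) :
    inner ℝ (secondFormTrace N G f x) v = 0 := by
  have h : ∀ X Y, inner ℝ (secondFundamentalForm N (f x) X Y) v = 0 := fun X Y =>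
    Submodule.inner_left_of_mem_orthogonal hv (Submodule.starProjection_apply_mem _ _)
  simp [secondFormTrace, inner_add_left, inner_smul_left, h]

end Tangency

/-! ## The flow in coordinates -/

section FlowInChart

set_option linter.unusedSectionVars false

variable {M : Type*} [TopologicalSpace M] [ChartedSpace (EuclideanSpace ℝ (Fin 2)) M]
  [IsManifold (𝓡 2) ∞ M] {g : SurfaceMetric M}
  {e : OpenPartialHomeomorph M (EuclideanSpace ℝ (Fin 2))}
  {k : ℕ} {N : Set (EuclideanSpace ℝ (Fin k))} {T : ℝ} {u : M → ℝ → EuclideanSpace ℝ (Fin k)}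

/-- The conformally invariant coefficients `√g gⁱʲ`. -/
def conformalCoeff (g : SurfaceMetric M) (e : OpenPartialHomeomorph M (EuclideanSpace ℝ (Fin 2)))
    (x : EuclideanSpace ℝ (Fin 2)) : Matrix (Fin 2) (Fin 2) ℝ :=
  Matrix.of fun i j => Real.sqrt (metricMatrix g e x).det * (metricMatrix g e x)⁻¹ i j

/-- The volume density `√g`. -/
def volumeDensity (g : SurfaceMetric M) (e : OpenPartialHomeomorph M (EuclideanSpace ℝ (Fin 2)))
    (x : EuclideanSpace ℝ (Fin 2)) : ℝ :=
  Real.sqrt (metricMatrix g e x).det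

theorem matrix_inv_fin_two (G : Matrix (Fin 2) (Fin 2) ℝ) :
    G⁻¹ 0 0 = G.det⁻¹ * G 1 1 ∧ G⁻¹ 0 1 = -(G.det⁻¹ * G 0 1) ∧
      G⁻¹ 1 0 = -(G.det⁻¹ * G 1 0) ∧ G⁻¹ 1 1 = G.det⁻¹ * G 0 0 := by
  rw [Matrix.inv_def, Matrix.adjugate_fin_two]
  simp

theorem dirichletForm_conformalCoeff
    (f : EuclideanSpace ℝ (Fin 2) → EuclideanSpace ℝ (Fin k)) (x : EuclideanSpace ℝ (Fin 2)) :
    dirichletForm (conformalCoeff g e x) f x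
      = volumeDensity g e x * gradSq (metricMatrix g e x) f x := by
  simp only [dirichletForm, conformalCoeff, volumeDensity, gradSq, Fin.sum_univ_two, Matrix.of_apply]
  ring

theorem covectorPairing_conformalCoeff (a : Fin 2 → ℝ)
    (f : EuclideanSpace ℝ (Fin 2) → EuclideanSpace ℝ (Fin k)) (x : EuclideanSpace ℝ (Fin 2)) :
    covectorPairing (conformalCoeff g e x) a f x
      = volumeDensity g e x • covectorPairing (metricMatrix g e x)⁻¹ a f x := by
  simp [covectorPairing, conformalCoeff, volumeDensity, smul_smul, mul_assoc]

/-- Multiplying by g₀₀ det g > 0 turns the quantity into |g₀₀∂₁f - g₀₁∂₀f|² + det g |∂₀f|². -/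
theorem gradSq_nonneg (he : e ∈ IsManifold.maximalAtlas (𝓡 2) ∞ M)
    {x : EuclideanSpace ℝ (Fin 2)} (hx : x ∈ e.target)
    (f : EuclideanSpace ℝ (Fin 2) → EuclideanSpace ℝ (Fin k)) :
    0 ≤ gradSq (metricMatrix g e x) f x := by
  have h0 := metricMatrix_zero_zero_pos (g := g) he hx
  have h1 := metricMatrix_det_pos (g := g) he hx
  obtain ⟨i1, i2, i3, i4⟩ := matrix_inv_fin_two (metricMatrix g e x)
  set G := metricMatrix g e x with hG
  have hs : G 1 0 = G 0 1 := metricMatrix_symm x 1 0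
  have h2 : G.det = G 0 0 * G 1 1 - G 0 1 * G 0 1 := by rw [Matrix.det_fin_two, hs]
  have h3 : 0 ≤ ‖G 0 0 • pderiv2 1 f x - G 0 1 • pderiv2 0 f x‖ ^ 2
      + G.det * ‖pderiv2 0 f x‖ ^ 2 := by positivity
  rw [norm_sub_sq_real, norm_smul, norm_smul, inner_smul_left, inner_smul_right, mul_pow, mul_pow,
    Real.norm_eq_abs, Real.norm_eq_abs, sq_abs, sq_abs] at h3
  have h4 : G 0 0 * (G.det * gradSq G f x) = G 0 0 ^ 2 * ‖pderiv2 1 f x‖ ^ 2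
      - 2 * (G 0 0 * (G 0 1 * inner ℝ (pderiv2 1 f x) (pderiv2 0 f x)))
      + G 0 1 ^ 2 * ‖pderiv2 0 f x‖ ^ 2 + G.det * ‖pderiv2 0 f x‖ ^ 2 := by
    simp only [gradSq, Fin.sum_univ_two, i1, i2, i3, i4, hs, real_inner_self_eq_norm_sq,
      real_inner_comm (pderiv2 1 f x) (pderiv2 0 f x)]
    field_simp
    rw [h2]
    ring
  have h5 : 0 ≤ G 0 0 * (G.det * gradSq G f x) := by
    rw [h4]; simpa using h3
  exact (mul_nonneg_iff_of_pos_left h1).1 ((mul_nonneg_iff_of_pos_left h0).1 h5)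

theorem contDiffOn_det_metricMatrix (he : e ∈ IsManifold.maximalAtlas (𝓡 2) ∞ M) :
    ContDiffOn ℝ ∞ (fun x => (metricMatrix g e x).det) e.target := by
  simp only [Matrix.det_fin_two]
  exact ((contDiffOn_metricMatrix he 0 0).mul (contDiffOn_metricMatrix he 1 1)).sub
    ((contDiffOn_metricMatrix he 0 1).mul (contDiffOn_metricMatrix he 1 0))

theorem contDiffOn_volumeDensity (he : e ∈ IsManifold.maximalAtlas (𝓡 2) ∞ M) :
    ContDiffOn ℝ ∞ (volumeDensity g e) e.target :=
  (contDiffOn_det_metricMatrix he).sqrt fun _ hx => (metricMatrix_det_pos he hx).ne'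

theorem volumeDensity_pos (he : e ∈ IsManifold.maximalAtlas (𝓡 2) ∞ M)
    {x : EuclideanSpace ℝ (Fin 2)} (hx : x ∈ e.target) : 0 < volumeDensity g e x :=
  Real.sqrt_pos.2 (metricMatrix_det_pos he hx)

theorem contDiffOn_metricMatrix_inv (he : e ∈ IsManifold.maximalAtlas (𝓡 2) ∞ M) (i j : Fin 2) :
    ContDiffOn ℝ ∞ (fun x => (metricMatrix g e x)⁻¹ i j) e.target := by
  have h1 := (contDiffOn_det_metricMatrix (g := g) he).inv
    (fun _ hx => (metricMatrix_det_pos he hx).ne')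
  have h2 := fun x => matrix_inv_fin_two (metricMatrix g e x)
  fin_cases i <;> fin_cases j <;> simp [h2]
  · exact h1.mul (contDiffOn_metricMatrix he 1 1)
  · exact (h1.mul (contDiffOn_metricMatrix he 0 1)).neg
  · exact (h1.mul (contDiffOn_metricMatrix he 1 0)).neg
  · exact h1.mul (contDiffOn_metricMatrix he 0 0)

theorem contDiffOn_conformalCoeff (he : e ∈ IsManifold.maximalAtlas (𝓡 2) ∞ M) (i j : Fin 2) :
    ContDiffOn ℝ ∞ (fun x => conformalCoeff g e x i j) e.target := by
  have h := (contDiffOn_volumeDensity (g := g) he).mul (contDiffOn_metricMatrix_inv (g := g) he i j)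
  exact h.congr fun x _ => rfl

theorem IsHarmonicHeatFlow.contDiffOn_chart (hu : IsHarmonicHeatFlow g N T u)
    (he : e ∈ IsManifold.maximalAtlas (𝓡 2) ∞ M) :
    ContDiffOn ℝ ∞ (fun z : EuclideanSpace ℝ (Fin 2) × ℝ => u (e.symm z.1) z.2)
      (e.target ×ˢ Ico 0 T) := by
  rw [← contMDiffOn_iff_contDiffOn]
  have h1 : ContMDiffOn 𝓘(ℝ, EuclideanSpace ℝ (Fin 2) × ℝ) ((𝓡 2).prod 𝓘(ℝ, ℝ)) ∞
      (fun z : EuclideanSpace ℝ (Fin 2) × ℝ => ((e.symm z.1, z.2) : M × ℝ))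
      (e.target ×ˢ Ico 0 T) :=
    ((contMDiffOn_symm_of_mem_maximalAtlas he).comp contDiff_fst.contMDiff.contMDiffOn
      (fun z hz => hz.1)).prodMk contDiff_snd.contMDiff.contMDiffOn
  exact hu.smooth.comp h1 (fun z hz => ⟨trivial, hz.2⟩)

/-- By tangency the normal term of the equation drops out when paired with ∂ₜu or ∂ᵢu; multiplying
by √g puts the Laplacian in divergence form. -/
theorem IsHarmonicHeatFlow.isPatchFlow (hu : IsHarmonicHeatFlow g N T u)
    (he : e ∈ IsManifold.maximalAtlas (𝓡 2) ∞ M) :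
    IsPatchFlow e.target T (conformalCoeff g e) (volumeDensity g e)
      (fun x t => u (e.symm x) t) := by
  have hsm := hu.contDiffOn_chart he
  have hsm' := hsm.mono (prod_mono le_rfl Ioo_subset_Ico_self)
  have htime : ∀ x ∈ e.target, ∀ t ∈ Ioo 0 T,
      deriv (fun s => u (e.symm x) s) t ∈ tangentSpaceOf N (u (e.symm x) t) := by
    intro x hx t ht
    have h1 := (hasDerivAt_slice (U := fun x t => u (e.symm x) t) e.open_target isOpen_Ioo hsm' hx ht).differentiableAt
    exact fderiv_mem_tangentSpaceOf (f := fun s => u (e.symm x) s) (isOpen_Ioo.mem_nhds ht)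
      (fun s hs => hu.mem_target _ s (Ioo_subset_Ico_self hs)) h1 1
  have hspace : ∀ x ∈ e.target, ∀ t ∈ Ioo 0 T, ∀ i,
      pderiv2 i (fun z => u (e.symm z) t) x ∈ tangentSpaceOf N (u (e.symm x) t) := by
    intro x hx t ht i
    have h1 := ((contDiffOn_slice (U := fun x t => u (e.symm x) t) hsm' ht).differentiableOn (by simp)).differentiableAt
      (e.open_target.mem_nhds hx)
    exact fderiv_mem_tangentSpaceOf (f := fun z => u (e.symm z) t) (e.open_target.mem_nhds hx)
      (fun s hs => hu.mem_target _ t (Ioo_subset_Ico_self ht)) h1 _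
  have heq : ∀ x ∈ e.target, ∀ t ∈ Ioo 0 T, ∀ v ∈ tangentSpaceOf N (u (e.symm x) t),
      inner ℝ (divGrad (conformalCoeff g e) (fun z => u (e.symm z) t) x) v
        = volumeDensity g e x * inner ℝ (deriv (fun s => u (e.symm x) s) t) v := by
    intro x hx t ht v hv
    have hd := volumeDensity_pos (g := g) he hx
    have h1 : divGrad (conformalCoeff g e) (fun z => u (e.symm z) t) x = volumeDensity g e x •
        laplaceBeltrami (metricMatrix g e) (fun z => u (e.symm z) t) x := by
      rw [laplaceBeltrami, smul_smul]
      have : volumeDensity g e x * (Real.sqrt (metricMatrix g e x).det)⁻¹ = 1 :=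
        mul_inv_cancel₀ hd.ne'
      rw [this, one_smul]
      rfl
    have h2 : inner ℝ (secondFormTrace N (metricMatrix g e x) (fun z => u (e.symm z) t) x) v = 0 :=
      inner_secondFormTrace (N := N) _ (fun z => u (e.symm z) t) x hv
    rw [hu.equation e he x hx t ht, h1, real_inner_smul_left, inner_sub_left, h2, sub_zero]
  refine ⟨e.open_target, contDiffOn_conformalCoeff he, fun x hx => ?_, fun x hx f => ?_,
    contDiffOn_volumeDensity he, fun x hx => volumeDensity_pos he hx, hsm, fun x hx t ht => ?_,
    fun x hx t ht i => heq x hx t ht _ (hspace x hx t ht i)⟩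
  · obtain ⟨-, i2, i3, -⟩ := matrix_inv_fin_two (metricMatrix g e x)
    simp only [conformalCoeff, Matrix.of_apply, i2, i3, metricMatrix_symm x 1 0]
  · rw [dirichletForm_conformalCoeff]
    exact mul_nonneg (volumeDensity_pos he hx).le (gradSq_nonneg he hx f)
  · rw [heq x hx t ht _ (htime x hx t ht), real_inner_self_eq_norm_sq]

end FlowInChart

/-! ## The volume measure in coordinates -/

section Volume

set_option linter.unusedSectionVars false

variable {M : Type*} [TopologicalSpace M] [ChartedSpace (EuclideanSpace ℝ (Fin 2)) M]
  [IsManifold (𝓡 2) ∞ M] [MeasurableSpace M] [BorelSpace M] {g : SurfaceMetric M}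
  {e e₁ e₂ : OpenPartialHomeomorph M (EuclideanSpace ℝ (Fin 2))}

theorem measurableSet_chart_preimage (e : OpenPartialHomeomorph M (EuclideanSpace ℝ (Fin 2)))
    {S : Set M} (hS : MeasurableSet S) : MeasurableSet (e.symm ⁻¹' S ∩ e.target) := by
  have h1 : Measurable (e.target.domRestrict e.symm) :=
    (continuousOn_iff_continuous_domRestrict.1 e.continuousOn_symm).measurable
  have h2 := e.open_target.measurableSet.subtype_image (h1 hS)
  convert h2 using 1
  ext x
  simp [and_comm, domRestrict]

theorem measurableSet_chart_image (e : OpenPartialHomeomorph M (EuclideanSpace ℝ (Fin 2)))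
    {S : Set (EuclideanSpace ℝ (Fin 2))} (hS : MeasurableSet S) (hSe : S ⊆ e.target) :
    MeasurableSet (e.symm '' S) := by
  have h1 : Measurable (e.source.domRestrict e) :=
    (continuousOn_iff_continuous_domRestrict.1 e.continuousOn).measurable
  have h2 := e.open_source.measurableSet.subtype_image (h1 hS)
  convert h2 using 1
  ext p
  simp only [mem_image, mem_preimage, domRestrict_apply, Subtype.exists, exists_and_right,
    exists_eq_right]
  constructor
  · rintro ⟨x, hx, rfl⟩
    exact ⟨e.map_target (hSe hx), by simpa [domRestrict, e.right_inv (hSe hx)] using hx⟩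
  · rintro ⟨hp, hpS⟩
    exact ⟨e p, hpS, e.left_inv hp⟩

theorem aemeasurable_chart_symm (μ : Measure (EuclideanSpace ℝ (Fin 2)))
    (hμ : μ ≪ volume.restrict e.target) : AEMeasurable e.symm μ :=
  (e.continuousOn_symm.aemeasurable e.open_target.measurableSet).mono_ac hμ

theorem chartVolume_apply {S : Set M} (hS : MeasurableSet S) :
    chartVolume g e S = ∫⁻ x in e.symm ⁻¹' S ∩ e.target, ENNReal.ofReal (volumeDensity g e x) := by
  rw [chartVolume, Measure.map_apply_of_aemeasurable
    (aemeasurable_chart_symm _ (withDensity_absolutelyContinuous _ _)) hS, withDensity_apply',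
    Measure.restrict_restrict' e.open_target.measurableSet]
  rfl

theorem chartVolume_inter_source {S : Set M} (hS : MeasurableSet S) :
    chartVolume g e (S ∩ e.source) = chartVolume g e S := by
  rw [chartVolume_apply (hS.inter e.open_source.measurableSet), chartVolume_apply hS]
  congr 2
  ext x
  simp only [mem_inter_iff, mem_preimage]
  exact ⟨fun h => ⟨h.1.1, h.2⟩, fun h => ⟨⟨h.1, e.map_target h.2⟩, h.2⟩⟩

/-- This is the change of variables formula for the transition map, whose Jacobian determinant is
the ratio of the two volume densities. -/
theorem chartVolume_eq (he₁ : e₁ ∈ IsManifold.maximalAtlas (𝓡 2) ∞ M)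
    (he₂ : e₂ ∈ IsManifold.maximalAtlas (𝓡 2) ∞ M) {S : Set M} (hS : MeasurableSet S)
    (h₁ : S ⊆ e₁.source) (h₂ : S ⊆ e₂.source) : chartVolume g e₁ S = chartVolume g e₂ S := by
  rw [chartVolume_apply hS, chartVolume_apply hS]
  have himg : e₁.symm ⁻¹' S ∩ e₁.target
      = (fun z => e₁ (e₂.symm z)) '' (e₂.symm ⁻¹' S ∩ e₂.target) := by
    ext x
    constructor
    · rintro ⟨hx, hxt⟩
      refine ⟨e₂ (e₁.symm x), ⟨?_, e₂.map_source (h₂ hx)⟩, ?_⟩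
      · simpa [e₂.left_inv (h₂ hx)] using hx
      · simp [e₂.left_inv (h₂ hx), e₁.right_inv hxt]
    · rintro ⟨z, ⟨hz, hzt⟩, rfl⟩
      refine ⟨?_, e₁.map_source (h₁ hz)⟩
      simpa [e₁.left_inv (h₁ hz)] using hz
  have hm := measurableSet_chart_preimage e₂ hS
  have hinj : InjOn (fun z => e₁ (e₂.symm z)) (e₂.symm ⁻¹' S ∩ e₂.target) := by
    rintro a ⟨ha, hat⟩ b ⟨hb, hbt⟩ hab
    exact e₂.symm.injOn hat hbt (e₁.injOn (h₁ ha) (h₁ hb) hab)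
  rw [himg, lintegral_image_eq_lintegral_abs_det_fderiv_mul volume hm
    (fun x hx => (differentiableAt_transition he₁ he₂ hx.2 (h₁ hx.1)).hasFDerivAt.hasFDerivWithinAt)
    hinj]
  refine setLIntegral_congr_fun hm fun x hx => ?_
  rw [volumeDensity, volumeDensity, sqrt_det_transition he₁ he₂ hx.2 (h₁ hx.1),
    ENNReal.ofReal_mul (abs_nonneg _)]

theorem surfaceVolume_apply (he : e ∈ IsManifold.maximalAtlas (𝓡 2) ∞ M) {S : Set M}
    (hS : MeasurableSet S) (hSe : S ⊆ e.source) : surfaceVolume g S = chartVolume g e S := by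
  refine le_antisymm ?_ ?_
  -- The supremum of measures is bounded by a single measure: the patch measure of e plus infinitely
  -- many times the counting measure off the domain of e. A set inside the domain is handled by the
  -- agreement on overlaps; any other set has infinite mass on the right.
  · have hle : surfaceVolume g ≤ chartVolume g e + (⊤ : ENNReal) • Measure.count.restrict e.sourceᶜ := by
      refine iSup₂_le fun e' he' => Measure.le_iff.2 fun s hs => ?_
      rw [Measure.add_apply, Measure.smul_apply, Measure.restrict_apply hs]
      by_cases hse : s ⊆ e.source
      · refine le_trans ?_ le_self_add
        have hs' := hs.inter e'.open_source.measurableSet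
        rw [← chartVolume_inter_source hs, chartVolume_eq he' he hs' inter_subset_right
          (inter_subset_left.trans hse)]
        exact measure_mono inter_subset_left
      · have : Measure.count (s ∩ e.sourceᶜ) ≠ 0 := by
          rw [Ne, Measure.count_eq_zero_iff]
          rw [not_subset] at hse
          obtain ⟨p, hp, hp'⟩ := hse
          exact Set.Nonempty.ne_empty ⟨p, hp, hp'⟩
        rw [smul_eq_mul, ENNReal.top_mul this]
        simp
    refine (hle S).trans ?_
    rw [Measure.add_apply, Measure.smul_apply, Measure.restrict_apply hS]
    have : S ∩ e.sourceᶜ = ∅ := by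
      rw [← sdiff_eq, sdiff_eq_empty]; exact hSe
    simp [this]
  · exact (le_iSup₂ (f := fun e (_ : e ∈ IsManifold.maximalAtlas (𝓡 2) ∞ M) => chartVolume g e)
      e he : chartVolume g e ≤ surfaceVolume g) S

theorem surfaceVolume_restrict (he : e ∈ IsManifold.maximalAtlas (𝓡 2) ∞ M) :
    (surfaceVolume g).restrict e.source = chartVolume g e := by
  ext s hs
  rw [Measure.restrict_apply hs, surfaceVolume_apply he (hs.inter e.open_source.measurableSet)
    inter_subset_right, chartVolume_inter_source hs]

theorem surfaceVolume_restrict_image (he : e ∈ IsManifold.maximalAtlas (𝓡 2) ∞ M)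
    {S : Set (EuclideanSpace ℝ (Fin 2))} (hS : MeasurableSet S) (hSe : S ⊆ e.target) :
    (surfaceVolume g).restrict (e.symm '' S)
      = ((volume.restrict S).withDensity
          (fun x => ENNReal.ofReal (volumeDensity g e x))).map e.symm := by
  have hm := measurableSet_chart_image e hS hSe
  have hsub : e.symm '' S ⊆ e.source := by
    rintro _ ⟨x, hx, rfl⟩
    exact e.map_target (hSe hx)
  have hpre : e.symm ⁻¹' (e.symm '' S) ∩ e.target = S := by
    ext x
    constructor
    · rintro ⟨⟨y, hy, hyx⟩, hx⟩
      rwa [← e.symm.injOn (hSe hy) hx hyx]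
    · exact fun hx => ⟨⟨x, hx, rfl⟩, hSe hx⟩
  rw [← inter_eq_self_of_subset_left hsub, ← Measure.restrict_restrict hm,
    surfaceVolume_restrict he, chartVolume, Measure.restrict_map_of_aemeasurable
    (aemeasurable_chart_symm _ (withDensity_absolutelyContinuous _ _)) hm,
    restrict_withDensity', Measure.restrict_restrict' e.open_target.measurableSet, hpre]
  rfl

theorem integrableOn_chart_image (he : e ∈ IsManifold.maximalAtlas (𝓡 2) ∞ M) {f : M → ℝ}
    (hf : ContinuousOn (fun x => f (e.symm x)) e.target)
    {S : Set (EuclideanSpace ℝ (Fin 2))} (hS : MeasurableSet S) (hSe : S ⊆ e.target) :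
    (IntegrableOn f (e.symm '' S) (surfaceVolume g)
      ↔ IntegrableOn (fun x => volumeDensity g e x * f (e.symm x)) S) ∧
    ∫ p in e.symm '' S, f p ∂(surfaceVolume g) = ∫ x in S, volumeDensity g e x * f (e.symm x) := by
  have hm := measurableSet_chart_image e hS hSe
  have hsub : e.symm '' S ⊆ e.source := by
    rintro _ ⟨x, hx, rfl⟩
    exact e.map_target (hSe hx)
  have hfc : ContinuousOn f e.source := by
    refine (hf.comp e.continuousOn (fun p hp => e.map_source hp)).congr fun p hp => ?_
    simp [e.left_inv hp]
  have hfm : AEStronglyMeasurable f ((surfaceVolume g).restrict (e.symm '' S)) :=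
    (hfc.mono hsub).aestronglyMeasurable hm
  have hac : (volume.restrict S).withDensity (fun x => ENNReal.ofReal (volumeDensity g e x))
      ≪ volume.restrict e.target :=
    (withDensity_absolutelyContinuous _ _).trans (Measure.restrict_mono hSe le_rfl).absolutelyContinuous
  have hdm : AEMeasurable (fun x => ENNReal.ofReal (volumeDensity g e x)) (volume.restrict S) :=
    ((((contDiffOn_volumeDensity (g := g) he).continuousOn.mono hSe).aemeasurable hS)).ennreal_ofReal
  have hpos : ∀ᵐ x ∂(volume.restrict S), 0 ≤ volumeDensity g e x :=
    (ae_restrict_mem hS).mono fun x hx => (volumeDensity_pos he (hSe hx)).le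
  have htop : ∀ᵐ x ∂(volume.restrict S), ENNReal.ofReal (volumeDensity g e x) < ⊤ :=
    Filter.Eventually.of_forall fun x => ENNReal.ofReal_lt_top
  constructor
  · rw [IntegrableOn, IntegrableOn]
    rw [surfaceVolume_restrict_image he hS hSe] at hfm ⊢
    rw [integrable_map_measure hfm (aemeasurable_chart_symm _ hac)]
    rw [integrable_withDensity_iff_integrable_smul₀' hdm htop]
    refine integrable_congr (hpos.mono fun x hx => ?_)
    simp [ENNReal.toReal_ofReal hx]
  · rw [surfaceVolume_restrict_image he hS hSe] at hfm ⊢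
    rw [integral_map (aemeasurable_chart_symm _ hac) hfm,
      integral_withDensity_eq_integral_toReal_smul₀ hdm htop]
    refine integral_congr_ae (hpos.mono fun x hx => ?_)
    simp [ENNReal.toReal_ofReal hx]

/-- Integration over the surface of a function supported in a coordinate patch. -/
theorem integral_eq_chart_integral (he : e ∈ IsManifold.maximalAtlas (𝓡 2) ∞ M) {f : M → ℝ}
    (hf : ContinuousOn (fun x => f (e.symm x)) e.target) {K : Set (EuclideanSpace ℝ (Fin 2))}
    (hK : IsCompact K) (hKe : K ⊆ e.target) (h0 : ∀ p ∉ e.symm '' K, f p = 0)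
    {F : EuclideanSpace ℝ (Fin 2) → ℝ} (hF : ∀ x ∈ K, F x = volumeDensity g e x * f (e.symm x))
    (hF0 : ∀ x ∉ K, F x = 0) :
    Integrable f (surfaceVolume g) ∧ ∫ p, f p ∂(surfaceVolume g) = ∫ x, F x := by
  obtain ⟨h1, h2⟩ := integrableOn_chart_image (g := g) he hf hK.measurableSet hKe
  have h3 : IntegrableOn (fun x => volumeDensity g e x * f (e.symm x)) K :=
    (((contDiffOn_volumeDensity he).continuousOn.mul hf).mono hKe).integrableOn_compact hK
  constructor
  · exact (integrableOn_iff_integrable_of_support_subset (fun p hp => by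
      by_contra h; exact hp (h0 p h))).1 (h1.2 h3)
  · rw [← setIntegral_eq_integral_of_forall_compl_eq_zero (s := e.symm '' K) h0, h2,
      ← setIntegral_eq_integral_of_forall_compl_eq_zero (s := K) hF0]
    exact (setIntegral_congr_fun hK.measurableSet hF).symm

end Volume

/-! ## The global energy identity -/

section GlobalEnergy

set_option linter.unusedSectionVars false

variable {M : Type*} [TopologicalSpace M] [ChartedSpace (EuclideanSpace ℝ (Fin 2)) M]
  [IsManifold (𝓡 2) ∞ M] {g : SurfaceMetric M}
  {e : OpenPartialHomeomorph M (EuclideanSpace ℝ (Fin 2))}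
  {k : ℕ} {N : Set (EuclideanSpace ℝ (Fin k))} {T : ℝ} {u : M → ℝ → EuclideanSpace ℝ (Fin k)}

theorem exists_chart_partition [T2Space M] [CompactSpace M] :
    ∃ (t : Finset M) (c : t → OpenPartialHomeomorph M (EuclideanSpace ℝ (Fin 2)))
      (χ : t → M → ℝ) (K : t → Set (EuclideanSpace ℝ (Fin 2))),
      (∀ i, c i ∈ IsManifold.maximalAtlas (𝓡 2) ∞ M) ∧
      (∀ i, IsCompact (K i)) ∧ (∀ i, K i ⊆ (c i).target) ∧
      (∀ i, ContMDiff (𝓡 2) 𝓘(ℝ, ℝ) ∞ (χ i)) ∧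
      (∀ i, ∀ p ∉ (c i).symm '' K i, χ i p = 0) ∧ ∀ p, ∑ i, χ i p = 1 := by
  obtain ⟨t, ht⟩ := isCompact_univ.elim_nhds_subcover
    (fun p : M => (chartAt (EuclideanSpace ℝ (Fin 2)) p).source)
    (fun p _ => chart_source_mem_nhds _ p)
  obtain ⟨f, hf⟩ := SmoothPartitionOfUnity.exists_isSubordinate (𝓡 2) (isClosed_univ (X := M))
    (fun i : t => (chartAt (EuclideanSpace ℝ (Fin 2)) (i : M)).source)
    (fun i => (chartAt (EuclideanSpace ℝ (Fin 2)) (i : M)).open_source)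
    (by
      intro p hp
      obtain ⟨q, hq, hpq⟩ := mem_iUnion₂.1 (ht.2 hp)
      exact mem_iUnion.2 ⟨⟨q, hq⟩, hpq⟩)
  refine ⟨t, fun i => chartAt (EuclideanSpace ℝ (Fin 2)) (i : M),
    -- The compact sets are the chart images of the closed supports of the partition functions.
    fun i => f i, fun i => chartAt (EuclideanSpace ℝ (Fin 2)) (i : M) '' tsupport (f i),
    fun i => IsManifold.chart_mem_maximalAtlas _, fun i => ?_, fun i => ?_,
    fun i => (f i).contMDiff, fun i p hp => ?_, fun p => ?_⟩
  · exact (isClosed_tsupport _).isCompact.image_of_continuousOn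
      ((chartAt (EuclideanSpace ℝ (Fin 2)) (i : M)).continuousOn.mono (hf i))
  · rintro _ ⟨p, hp, rfl⟩
    exact (chartAt (EuclideanSpace ℝ (Fin 2)) (i : M)).map_source (hf i hp)
  · by_contra h
    have hp' : p ∈ tsupport (f i) := subset_tsupport _ h
    exact hp ⟨_, ⟨p, hp', rfl⟩, (chartAt (EuclideanSpace ℝ (Fin 2)) (i : M)).left_inv (hf i hp')⟩
  · rw [← finsum_eq_sum_of_fintype]
    exact f.sum_eq_one (mem_univ p)

theorem energyDensity_chart (he : e ∈ IsManifold.maximalAtlas (𝓡 2) ∞ M)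
    {f : M → EuclideanSpace ℝ (Fin k)} {x : EuclideanSpace ℝ (Fin 2)} (hx : x ∈ e.target)
    (hf : DifferentiableAt ℝ (fun z => f (e.symm z)) x) :
    energyDensity g f (e.symm x) = gradSq (metricMatrix g e x) (fun z => f (e.symm z)) x := by
  have h1 : (chartAt (EuclideanSpace ℝ (Fin 2)) (e.symm x)).symm
      (chartAt (EuclideanSpace ℝ (Fin 2)) (e.symm x) (e.symm x)) = e.symm x :=
    (chartAt _ _).left_inv (mem_chart_source _ _)
  rw [energyDensity, gradSq_transition he (IsManifold.chart_mem_maximalAtlas (e.symm x))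
    (mem_chart_target _ _) (by rw [h1]; exact e.map_target hx)
    (by rw [h1, e.right_inv hx]; exact hf), h1, e.right_inv hx]

/-- The pairing `g^{ij} ∂ᵢχ ∂ⱼf`, computed in the preferred chart. -/
def gradPairing (g : SurfaceMetric M) (χ : M → ℝ) (f : M → EuclideanSpace ℝ (Fin k)) (p : M) :
    EuclideanSpace ℝ (Fin k) :=
  covectorPairing (metricMatrix g (chartAt (EuclideanSpace ℝ (Fin 2)) p)
      (chartAt (EuclideanSpace ℝ (Fin 2)) p p))⁻¹
    (fun i => pderiv2 i (fun z => χ ((chartAt (EuclideanSpace ℝ (Fin 2)) p).symm z))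
      (chartAt (EuclideanSpace ℝ (Fin 2)) p p))
    (fun z => f ((chartAt (EuclideanSpace ℝ (Fin 2)) p).symm z))
    (chartAt (EuclideanSpace ℝ (Fin 2)) p p)

theorem gradPairing_chart (he : e ∈ IsManifold.maximalAtlas (𝓡 2) ∞ M)
    {f : M → EuclideanSpace ℝ (Fin k)} {χ : M → ℝ} {x : EuclideanSpace ℝ (Fin 2)}
    (hx : x ∈ e.target) (hf : DifferentiableAt ℝ (fun z => f (e.symm z)) x)
    (hχ : DifferentiableAt ℝ (fun z => χ (e.symm z)) x) :
    gradPairing g χ f (e.symm x) = covectorPairing (metricMatrix g e x)⁻¹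
      (fun i => pderiv2 i (fun z => χ (e.symm z)) x) (fun z => f (e.symm z)) x := by
  have h1 : (chartAt (EuclideanSpace ℝ (Fin 2)) (e.symm x)).symm
      (chartAt (EuclideanSpace ℝ (Fin 2)) (e.symm x) (e.symm x)) = e.symm x :=
    (chartAt _ _).left_inv (mem_chart_source _ _)
  rw [gradPairing, covectorPairing_transition he (IsManifold.chart_mem_maximalAtlas (e.symm x))
    (mem_chart_target _ _) (by rw [h1]; exact e.map_target hx)
    (by rw [h1, e.right_inv hx]; exact hf) (by rw [h1, e.right_inv hx]; exact hχ), h1,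
    e.right_inv hx]

theorem contDiffOn_comp_chart {χ : M → ℝ} (hχ : ContMDiff (𝓡 2) 𝓘(ℝ, ℝ) ∞ χ)
    (he : e ∈ IsManifold.maximalAtlas (𝓡 2) ∞ M) :
    ContDiffOn ℝ ∞ (fun z => χ (e.symm z)) e.target := by
  rw [← contMDiffOn_iff_contDiffOn]
  exact hχ.comp_contMDiffOn (contMDiffOn_symm_of_mem_maximalAtlas he)

/-- Since the functions sum to 1, their gradients sum to 0. This makes the localisation errors
cancel in the global energy identity. -/
theorem sum_gradPairing {ι : Type*} [Fintype ι] {χ : ι → M → ℝ}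
    (hχ : ∀ i, ContMDiff (𝓡 2) 𝓘(ℝ, ℝ) ∞ (χ i)) (h1 : ∀ p, ∑ i, χ i p = 1)
    (f : M → EuclideanSpace ℝ (Fin k)) (p : M) : ∑ i, gradPairing g (χ i) f p = 0 := by
  set e := chartAt (EuclideanSpace ℝ (Fin 2)) p
  have h2 : ∀ j, ∑ i, pderiv2 j (fun z => χ i (e.symm z)) (e p) = 0 := by
    intro j
    have hd : ∀ i ∈ Finset.univ, DifferentiableAt ℝ (fun z => χ i (e.symm z)) (e p) := fun i _ =>
      ((contDiffOn_comp_chart (hχ i)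
        (IsManifold.chart_mem_maximalAtlas p)).differentiableOn (by simp)).differentiableAt
        (e.open_target.mem_nhds (mem_chart_target _ p))
    have h3 := fderiv_fun_sum hd
    simp only [h1, fderiv_fun_const] at h3
    have h4 := congrArg (fun L => L (EuclideanSpace.single j (1 : ℝ))) h3
    simpa [pderiv2] using! h4.symm
  simp only [gradPairing, covectorPairing, Fin.sum_univ_two, Finset.sum_add_distrib,
    ← Finset.sum_smul, ← Finset.mul_sum]
  rw [h2 0, h2 1]
  simp

variable [MeasurableSpace M] [BorelSpace M]

theorem IsHarmonicHeatFlow.volumeDensity_mul_energyDensity (hu : IsHarmonicHeatFlow g N T u)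
    (he : e ∈ IsManifold.maximalAtlas (𝓡 2) ∞ M) {t : ℝ} (ht : t ∈ Ico 0 T)
    {x : EuclideanSpace ℝ (Fin 2)} (hx : x ∈ e.target) :
    volumeDensity g e x * energyDensity g (fun p => u p t) (e.symm x)
      = dirichletForm (conformalCoeff g e x) (fun z => u (e.symm z) t) x := by
  have hs : ContDiffOn ℝ ∞ (fun z => u (e.symm z) t) e.target :=
    contDiffOn_slice (U := fun z t => u (e.symm z) t) (hu.contDiffOn_chart he) ht
  rw [energyDensity_chart he hx ((hs.differentiableOn (by simp)).differentiableAt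
    (e.open_target.mem_nhds hx)), dirichletForm_conformalCoeff]

theorem IsHarmonicHeatFlow.continuousOn_energyDensity (hu : IsHarmonicHeatFlow g N T u)
    (he : e ∈ IsManifold.maximalAtlas (𝓡 2) ∞ M) {t : ℝ} (ht : t ∈ Ico 0 T) :
    ContinuousOn (fun x => energyDensity g (fun p => u p t) (e.symm x)) e.target := by
  have h1 : ContinuousOn
      (fun x => dirichletForm (conformalCoeff g e x) (fun z => u (e.symm z) t) x) e.target :=
    (hu.isPatchFlow he).continuousOn_dirichletForm.comp (f := fun x => (x, t)) (by fun_prop)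
      (fun x hx => ⟨hx, ht⟩)
  have h2 := (contDiffOn_volumeDensity (g := g) he).continuousOn
  refine (h1.div h2 fun x hx => (volumeDensity_pos he hx).ne').congr fun x hx => ?_
  have h3 := (volumeDensity_pos (g := g) he hx).ne'
  simp only [Pi.div_apply]
  rw [← hu.volumeDensity_mul_energyDensity he ht hx]
  field_simp

/-- The energy is continuous up to the initial time and dissipates at the rate `∫ |∂ₜu|²`. -/
theorem IsHarmonicHeatFlow.energy_identity [T2Space M] [CompactSpace M]
    (hu : IsHarmonicHeatFlow g N T u) :
    (∀ t ∈ Ico 0 T, Integrable (energyDensity g (fun p => u p t)) (surfaceVolume g)) ∧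
    ContinuousOn (fun t => dirichletEnergy g (fun p => u p t)) (Ico 0 T) ∧
    ∀ t ∈ Ioo 0 T,
      Integrable (fun p => ‖deriv (fun s => u p s) t‖ ^ 2) (surfaceVolume g) ∧
      HasDerivAt (fun t => dirichletEnergy g (fun p => u p t))
        (-∫ p, ‖deriv (fun s => u p s) t‖ ^ 2 ∂(surfaceVolume g)) t := by
  obtain ⟨S, c, χ, K, hc, hK, hKt, hχ, hχ0, hsum⟩ := exists_chart_partition (M := M)
  -- The inverse chart is meaningless outside the chart image, so the partition function is read in
  -- coordinates and extended by zero.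
  set χ' : S → EuclideanSpace ℝ (Fin 2) → ℝ :=
    fun i => (K i).indicator fun x => χ i ((c i).symm x) with hχ'
  have hχ'eq : ∀ i, ∀ x ∈ (c i).target, χ' i x = χ i ((c i).symm x) := by
    intro i x hx
    by_cases hxK : x ∈ K i
    · simp [hχ', hxK]
    · simp only [hχ', indicator_of_notMem hxK]
      refine (hχ0 i _ ?_).symm
      rintro ⟨y, hy, hyx⟩
      exact hxK ((c i).symm.injOn (hKt i hy) hx hyx ▸ hy)
  have hχ's : ∀ i, ContDiffOn ℝ ∞ (χ' i) (c i).target := fun i =>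
    (contDiffOn_comp_chart (hχ i) (hc i)).congr (hχ'eq i)
  have hχ'0 : ∀ i, ∀ x ∉ K i, χ' i x = 0 := fun i x hx => indicator_of_notMem hx _
  have hP := fun i => hu.isPatchFlow (hc i)
  have hpart : ∀ i, ∀ t ∈ Ico 0 T,
      Integrable (fun p => χ i p * energyDensity g (fun p => u p t) p) (surfaceVolume g) ∧
      ∫ p, χ i p * energyDensity g (fun p => u p t) p ∂(surfaceVolume g)
        = ∫ x, χ' i x * dirichletForm (conformalCoeff g (c i) x)
            (fun z => u ((c i).symm z) t) x := by
    intro i t ht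
    refine integral_eq_chart_integral (hc i)
      ((contDiffOn_comp_chart (hχ i) (hc i)).continuousOn.mul
        (hu.continuousOn_energyDensity (hc i) ht)) (hK i) (hKt i)
      (fun p hp => by simp [hχ0 i p hp]) (fun x hx => ?_) (fun x hx => by simp [hχ'0 i x hx])
    rw [hχ'eq i x (hKt i hx), ← hu.volumeDensity_mul_energyDensity (hc i) ht (hKt i hx)]
    ring
  have hden : ∀ t, energyDensity g (fun p => u p t)
      = fun p => ∑ i, χ i p * energyDensity g (fun p => u p t) p := by
    intro t; ext1 p
    rw [← Finset.sum_mul, hsum, one_mul]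
  have hint : ∀ t ∈ Ico 0 T, Integrable (energyDensity g (fun p => u p t)) (surfaceVolume g) := by
    intro t ht
    rw [hden]
    exact integrable_finsetSum _ fun i _ => (hpart i t ht).1
  have hE : ∀ t ∈ Ico 0 T, dirichletEnergy g (fun p => u p t)
      = ∑ i, 1 / 2 * ∫ x, χ' i x * dirichletForm (conformalCoeff g (c i) x)
          (fun z => u ((c i).symm z) t) x := by
    intro t ht
    rw [dirichletEnergy, hden, integral_finsetSum _ fun i _ => (hpart i t ht).1, Finset.mul_sum]
    exact Finset.sum_congr rfl fun i _ => by rw [(hpart i t ht).2]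
  refine ⟨hint, ?_, fun t ht => ?_⟩
  · refine ContinuousOn.congr (continuousOn_finsetSum _ fun i _ => ?_) hE
    exact (hP i).continuousOn_weightedEnergy (hK i) (hKt i) (ψ := fun x _ => χ' i x)
      ((hχ's i).continuousOn.comp continuousOn_fst fun z hz => hz.1)
      (fun x hx t _ => hχ'0 i x hx)
  -- With η = 0 the Pohozaev terms vanish; a time-independent weight leaves only the dissipation and
  -- the gradient pairing with the partition function.
  · have hrate := fun i => (hP i).hasDerivAt_weightedEnergy (hK i) (hKt i) (ψ := fun x _ => χ' i x)
      (η := fun _ => 0) ((hχ's i).comp contDiff_fst.contDiffOn fun z hz => hz.1)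
      (fun x hx t _ => hχ'0 i x hx) contDiffOn_const (fun _ _ => rfl) ht
    have htI := Ioo_subset_Ico_self ht
    have hfs : ∀ i, ContDiffOn ℝ ∞ (fun z => u ((c i).symm z) t) (c i).target := fun i =>
      contDiffOn_slice (U := fun z t => u ((c i).symm z) t) (hu.contDiffOn_chart (hc i)) htI
    have hvs : ∀ i, ContDiffOn ℝ ∞ (fun z => deriv (fun s => u ((c i).symm z) s) t)
        (c i).target := fun i => contDiffOn_slice (J := Ioo 0 T)
          (U := fun z t => deriv (fun s => u ((c i).symm z) s) t)
          (contDiffOn_deriv_slice (U := fun x t => u ((c i).symm x) t) (c i).open_target isOpen_Ioo (hP i).smooth_Ioo) ht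
    -- This is the rate of the i-th localised energy as a function on the surface. Being chart
    -- independent, it can be summed over i, which leaves -|∂ₜu|².
    set F : S → M → ℝ := fun i p => -(χ i p * ‖deriv (fun s => u p s) t‖ ^ 2)
      - inner ℝ (gradPairing g (χ i) (fun p => u p t) p) (deriv (fun s => u p s) t) with hF
    have hgp : ∀ i, ∀ x ∈ (c i).target, gradPairing g (χ i) (fun p => u p t) ((c i).symm x)
        = covectorPairing (metricMatrix g (c i) x)⁻¹
          (fun j => pderiv2 j (χ' i) x) (fun z => u ((c i).symm z) t) x := by
      intro i x hx
      have hn := (c i).open_target.mem_nhds hx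
      rw [gradPairing_chart (hc i) hx (((hfs i).differentiableOn (by simp)).differentiableAt hn)
        (((contDiffOn_comp_chart (hχ i) (hc i)).differentiableOn (by simp)).differentiableAt hn)]
      congr 1
      ext1 j
      exact pderiv2_congr j (by filter_upwards [hn] with z hz using (hχ'eq i z hz).symm)
    have hcont : ∀ i, ContinuousOn (fun x => F i ((c i).symm x)) (c i).target := by
      intro i
      have h1 : ContDiffOn ℝ ∞ (fun x => covectorPairing (metricMatrix g (c i) x)⁻¹
          (fun j => pderiv2 j (χ' i) x) (fun z => u ((c i).symm z) t) x) (c i).target :=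
        ContDiffOn.sum fun a _ => ContDiffOn.sum fun b _ =>
          ((contDiffOn_metricMatrix_inv (hc i) a b).mul
            (contDiffOn_pderiv2 (c i).open_target (hχ's i) a)).smul
            (contDiffOn_pderiv2 (c i).open_target (hfs i) b)
      have h2 := (((hχ's i).continuousOn.mul ((hvs i).continuousOn.norm.pow 2)).neg).sub
        (h1.continuousOn.inner (𝕜 := ℝ) (hvs i).continuousOn)
      refine h2.congr fun x hx => ?_
      simp only [hF, hgp i x hx]
      simp [hχ'eq i x hx]
    have hF0 : ∀ i, ∀ p ∉ (c i).symm '' K i, F i p = 0 := by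
      intro i p hp
      have hcl : IsClosed ((c i).symm '' K i) :=
        ((hK i).image_of_continuousOn ((c i).continuousOn_symm.mono (hKt i))).isClosed
      have h1 : gradPairing g (χ i) (fun p => u p t) p = 0 := by
        set e := chartAt (EuclideanSpace ℝ (Fin 2)) p
        have h2 : ∀ j, pderiv2 j (fun z => χ i (e.symm z)) (e p) = 0 := by
          intro j
          have h3 : (fun z => χ i (e.symm z)) =ᶠ[𝓝 (e p)] fun _ => 0 := by
            have h4 : ∀ᶠ q in 𝓝 (e.symm (e p)), χ i q = 0 := by
              rw [e.left_inv (mem_chart_source _ p)]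
              filter_upwards [hcl.isOpen_compl.mem_nhds hp] with q hq using hχ0 i q hq
            exact (e.symm.continuousAt (mem_chart_target _ p)).eventually h4
          rw [pderiv2_congr j h3, pderiv2_const]
        simp only [gradPairing, covectorPairing]
        simp only [e] at h2
        simp [h2]
      simp [hF, h1, hχ0 i p hp]
    have hpart' := fun i => integral_eq_chart_integral (g := g) (hc i) (hcont i) (hK i) (hKt i)
      (hF0 i)
      (F := weightedEnergyRate (conformalCoeff g (c i)) (volumeDensity g (c i))
        (fun x t => u ((c i).symm x) t) (fun x _ => χ' i x) (fun _ => 0) t)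
      (fun x hx => by
        simp only [weightedEnergyRate, hF, hgp i x (hKt i hx), covectorPairing_conformalCoeff,
          hχ'eq i x (hKt i hx), real_inner_smul_left]
        simp [radialDeriv, pderiv2_const, covectorPairing]
        ring)
      (fun x hx => by
        have h1 : ∀ j, pderiv2 j (χ' i) x = 0 := fun j =>
          pderiv2_eq_zero_of_support (hK i).isClosed (hχ'0 i) hx j
        have h2 : ∀ j, pderiv2 j (fun z => χ' i z) x = 0 := h1
        simp [weightedEnergyRate, hχ'0 i x hx, h2, covectorPairing, radialDeriv, pderiv2_const])
    have hFsum : (fun p => ‖deriv (fun s => u p s) t‖ ^ 2) = fun p => -∑ i, F i p := by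
      ext1 p
      have h1 := sum_gradPairing (g := g) hχ hsum (fun p => u p t) p
      simp only [hF, Finset.sum_sub_distrib, ← sum_inner, h1, Finset.sum_neg_distrib,
        ← Finset.sum_mul, hsum]
      simp
    have hFi : Integrable (fun p => ∑ i, F i p) (surfaceVolume g) :=
      integrable_finsetSum _ fun i _ => (hpart' i).1
    refine ⟨by rw [hFsum]; exact hFi.neg, ?_⟩
    have h1 : -∫ p, ‖deriv (fun s => u p s) t‖ ^ 2 ∂(surfaceVolume g)
        = ∑ i, ∫ x, weightedEnergyRate (conformalCoeff g (c i)) (volumeDensity g (c i))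
          (fun x t => u ((c i).symm x) t) (fun x _ => χ' i x) (fun _ => 0) t x := by
      rw [hFsum, integral_neg, neg_neg, integral_finsetSum _ fun i _ => (hpart' i).1]
      exact Finset.sum_congr rfl fun i _ => (hpart' i).2
    rw [h1]
    refine (HasDerivAt.fun_sum fun i _ => (hrate i).2).congr_of_eventuallyEq ?_
    filter_upwards [isOpen_Ioo.mem_nhds ht] with s hs using hE s (Ioo_subset_Ico_self hs)

theorem energyDensity_nonneg (f : M → EuclideanSpace ℝ (Fin k)) (p : M) :
    0 ≤ energyDensity g f p :=
  gradSq_nonneg (IsManifold.chart_mem_maximalAtlas p) (mem_chart_target _ p) _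

theorem dirichletEnergy_nonneg (f : M → EuclideanSpace ℝ (Fin k)) : 0 ≤ dirichletEnergy g f :=
  mul_nonneg (by norm_num) (integral_nonneg fun p => energyDensity_nonneg f p)

theorem IsHarmonicHeatFlow.antitoneOn_energy [T2Space M] [CompactSpace M]
    (hu : IsHarmonicHeatFlow g N T u) :
    AntitoneOn (fun t => dirichletEnergy g (fun p => u p t)) (Ico 0 T) := by
  obtain ⟨-, h2, h3⟩ := hu.energy_identity
  refine antitoneOn_of_deriv_nonpos (convex_Ico 0 T) h2 (fun t ht => ?_) fun t ht => ?_
  · rw [interior_Ico] at ht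
    exact (h3 t ht).2.differentiableAt.differentiableWithinAt
  · rw [interior_Ico] at ht
    rw [(h3 t ht).2.deriv]
    exact neg_nonpos.2 (integral_nonneg fun p => by positivity)

/-- The energy in a compact part of a coordinate patch is at most the total energy. -/
theorem IsHarmonicHeatFlow.setIntegral_dirichletForm_le [T2Space M] [CompactSpace M]
    (hu : IsHarmonicHeatFlow g N T u) (he : e ∈ IsManifold.maximalAtlas (𝓡 2) ∞ M)
    {K : Set (EuclideanSpace ℝ (Fin 2))} (hK : IsCompact K) (hKe : K ⊆ e.target) {t : ℝ}
    (ht : t ∈ Ico 0 T) :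
    ∫ x in K, dirichletForm (conformalCoeff g e x) (fun z => u (e.symm z) t) x
      ≤ 2 * dirichletEnergy g (fun p => u p t) := by
  obtain ⟨h1, -, -⟩ := hu.energy_identity
  obtain ⟨-, h2⟩ := integrableOn_chart_image (g := g) he (hu.continuousOn_energyDensity he ht)
    hK.measurableSet hKe
  rw [setIntegral_congr_fun hK.measurableSet
    (fun x hx => (hu.volumeDensity_mul_energyDensity he ht (hKe hx)).symm), ← h2, dirichletEnergy]
  have := setIntegral_le_integral (s := e.symm '' K) (h1 t ht)
    (Filter.Eventually.of_forall fun p => energyDensity_nonneg (g := g) _ p)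
  linarith

/-- The dissipation in a compact part of a coordinate patch is at most the total one. -/
theorem IsHarmonicHeatFlow.setIntegral_deriv_le [T2Space M] [CompactSpace M]
    (hu : IsHarmonicHeatFlow g N T u) (he : e ∈ IsManifold.maximalAtlas (𝓡 2) ∞ M)
    {K : Set (EuclideanSpace ℝ (Fin 2))} (hK : IsCompact K) (hKe : K ⊆ e.target) {t : ℝ}
    (ht : t ∈ Ioo 0 T) :
    ∫ x in K, volumeDensity g e x * ‖deriv (fun s => u (e.symm x) s) t‖ ^ 2
      ≤ ∫ p, ‖deriv (fun s => u p s) t‖ ^ 2 ∂(surfaceVolume g) := by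
  obtain ⟨-, -, h1⟩ := hu.energy_identity
  have hvs : ContDiffOn ℝ ∞ (fun z => deriv (fun s => u (e.symm z) s) t) e.target :=
    contDiffOn_slice (J := Ioo 0 T) (U := fun z t => deriv (fun s => u (e.symm z) s) t)
      (contDiffOn_deriv_slice (U := fun x t => u (e.symm x) t) e.open_target isOpen_Ioo (hu.isPatchFlow he).smooth_Ioo) ht
  obtain ⟨-, h2⟩ := integrableOn_chart_image (g := g) he
    (f := fun p => ‖deriv (fun s => u p s) t‖ ^ 2) (hvs.continuousOn.norm.pow 2)
    hK.measurableSet hKe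
  rw [← h2]
  exact setIntegral_le_integral (h1 t ht).1 (Filter.Eventually.of_forall fun p => by positivity)

end GlobalEnergy

/-! ## Pointwise estimates -/

section Weights

/-- This is the exponential series bound xⁿ/n! ≤ eˣ at x = (1 + z)/4. -/
theorem one_add_pow_mul_exp_le (n : ℕ) {z : ℝ} (hz : 0 ≤ z) :
    (1 + z) ^ n * Real.exp (-z / 4) ≤ 4 ^ n * n.factorial * Real.exp (1 / 4) := by
  have h1 := Real.pow_div_factorial_le_exp ((1 + z) / 4) (by positivity) n
  have h2 : (0 : ℝ) < n.factorial := by positivity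
  rw [div_pow, div_div, div_le_iff₀ (by positivity)] at h1
  have h3 : Real.exp ((1 + z) / 4) * Real.exp (-z / 4) = Real.exp (1 / 4) := by
    rw [← Real.exp_add]; congr 1; ring
  calc (1 + z) ^ n * Real.exp (-z / 4)
      ≤ Real.exp ((1 + z) / 4) * (4 ^ n * n.factorial) * Real.exp (-z / 4) := by gcongr
    _ = 4 ^ n * n.factorial * Real.exp (1 / 4) := by rw [← h3]; ring

/-- Polynomially growing errors are absorbed by the Gaussian weight near the origin. -/
theorem exists_weight_bound (n : ℕ) : ∃ C, 0 ≤ C ∧ ∀ s r z : ℝ, 0 ≤ s → 0 ≤ r →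
    z = r ^ 2 * Real.exp s → r * (1 + z) ^ 2 * Real.exp (-z / 4)
      ≤ Real.exp (-s / 4) * Real.exp (-z / 4) + C * Real.exp (-(n * s)) := by
  refine ⟨4 ^ (3 + 12 * n) * (3 + 12 * n).factorial * Real.exp (1 / 4), by positivity, ?_⟩
  intro s r z hs hr hz
  have hz0 : 0 ≤ z := by rw [hz]; positivity
  -- The arithmetic-geometric inequality for e^{-s/2} and r²e^{s/2} = e^{-s/2}z.
  have hrz : r ≤ Real.exp (-s / 2) * (1 + z) := by
    have h1 : Real.exp (-s / 2) * Real.exp s = Real.exp (s / 2) := by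
      rw [← Real.exp_add]; congr 1; ring
    have h2 : Real.exp (-s / 2) * Real.exp (s / 2) = 1 := by
      rw [← Real.exp_add, show -s / 2 + s / 2 = 0 by ring, Real.exp_zero]
    have h3 : r ≤ Real.exp (-s / 2) + r ^ 2 * Real.exp (s / 2) := by
      have ha := Real.exp_pos (-s / 2)
      have hb := Real.exp_pos (s / 2)
      set a := Real.exp (-s / 2)
      set b := Real.exp (s / 2)
      have h5 : b * (a + r ^ 2 * b - r) = (r * b - 1 / 2) ^ 2 + 3 / 4 := by
        linear_combination h2
      have h6 : 0 < b * (a + r ^ 2 * b - r) := by rw [h5]; positivity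
      have := pos_of_mul_pos_right h6 hb.le
      linarith
    calc r ≤ Real.exp (-s / 2) + r ^ 2 * Real.exp (s / 2) := h3
      _ = Real.exp (-s / 2) * (1 + z) := by rw [hz, ← h1]; ring
  have hle : r * (1 + z) ^ 2 ≤ Real.exp (-s / 2) * (1 + z) ^ 3 := by
    calc r * (1 + z) ^ 2 ≤ Real.exp (-s / 2) * (1 + z) * (1 + z) ^ 2 := by gcongr
      _ = _ := by ring
  -- If (1 + z)³ ≤ e^{s/4}, half of the gain e^{-s/2} pays for the polynomial and e^{-s/4} remains.
  -- Otherwise (1 + z)^{12n} exceeds e^{ns}, and inserting this factor costs only a higher moment of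
  -- the Gaussian.
  by_cases hc : (1 + z) ^ 3 ≤ Real.exp (s / 4)
  · have h1 : r * (1 + z) ^ 2 ≤ Real.exp (-s / 4) := by
      calc r * (1 + z) ^ 2 ≤ Real.exp (-s / 2) * (1 + z) ^ 3 := hle
        _ ≤ Real.exp (-s / 2) * Real.exp (s / 4) := by gcongr
        _ = Real.exp (-s / 4) := by rw [← Real.exp_add]; congr 1; ring
    calc r * (1 + z) ^ 2 * Real.exp (-z / 4) ≤ Real.exp (-s / 4) * Real.exp (-z / 4) := by gcongr
      _ ≤ _ := le_add_of_nonneg_right (by positivity)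
  · push Not at hc
    have h1 : 1 ≤ (1 + z) ^ (12 * n) * Real.exp (-(n * s)) := by
      have h2 : Real.exp (n * s) ≤ (1 + z) ^ (12 * n) := by
        calc Real.exp (n * s) = Real.exp (s / 4) ^ (4 * n) := by
              rw [← Real.exp_nat_mul]; congr 1; push_cast; ring
          _ ≤ ((1 + z) ^ 3) ^ (4 * n) := by gcongr
          _ = _ := by rw [← pow_mul]; congr 1; ring
      calc (1 : ℝ) = Real.exp (n * s) * Real.exp (-(n * s)) := by
            rw [← Real.exp_add, add_neg_cancel, Real.exp_zero]
        _ ≤ _ := by gcongr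
    have h3 : Real.exp (-s / 2) ≤ 1 := Real.exp_le_one_iff.2 (by linarith)
    calc r * (1 + z) ^ 2 * Real.exp (-z / 4)
        ≤ (1 * (1 + z) ^ 3) * Real.exp (-z / 4) := by
          refine mul_le_mul_of_nonneg_right (hle.trans ?_) (by positivity)
          gcongr
      _ = ((1 + z) ^ 3 * Real.exp (-z / 4)) * 1 := by ring
      _ ≤ ((1 + z) ^ 3 * Real.exp (-z / 4)) * ((1 + z) ^ (12 * n) * Real.exp (-(n * s))) := by
          gcongr
      _ = ((1 + z) ^ (3 + 12 * n) * Real.exp (-z / 4)) * Real.exp (-(n * s)) := by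
          rw [pow_add]; ring
      _ ≤ (4 ^ (3 + 12 * n) * (3 + 12 * n).factorial * Real.exp (1 / 4)) * Real.exp (-(n * s)) := by
          exact mul_le_mul_of_nonneg_right (one_add_pow_mul_exp_le _ hz0) (by positivity)
      _ ≤ _ := le_add_of_nonneg_left (by positivity)

/-- The Gaussian weight is negligible away from the origin. -/
theorem exists_weight_bound_away {δ : ℝ} (hδ : 0 < δ) (n : ℕ) : ∃ C, 0 ≤ C ∧ ∀ s r z : ℝ,
    δ / 2 ≤ r → z = r ^ 2 * Real.exp s →
    (1 + z) * Real.exp (-z / 4) ≤ C * Real.exp (-(n * s)) := by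
  refine ⟨(4 / δ ^ 2) ^ n * (4 ^ (1 + n) * (1 + n).factorial * Real.exp (1 / 4)), by positivity, ?_⟩
  intro s r z hr hz
  have hz0 : 0 ≤ z := by rw [hz]; positivity
  -- Away from the origin z is at least (δ²/4)e^s, so powers of e^s are powers of 1 + z.
  have h1 : Real.exp s ≤ 4 / δ ^ 2 * (1 + z) := by
    have h2 : (δ / 2) ^ 2 ≤ r ^ 2 := by gcongr
    rw [div_mul_eq_mul_div, le_div_iff₀ (by positivity)]
    have h3 : Real.exp s * (δ / 2) ^ 2 ≤ z := by rw [hz, mul_comm]; gcongr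
    nlinarith
  have h2 : 1 ≤ (4 / δ ^ 2 * (1 + z)) ^ n * Real.exp (-(n * s)) := by
    calc (1 : ℝ) = Real.exp s ^ n * Real.exp (-(n * s)) := by
          rw [← Real.exp_nat_mul, ← Real.exp_add, add_neg_cancel, Real.exp_zero]
      _ ≤ _ := by gcongr
  calc (1 + z) * Real.exp (-z / 4) = (1 + z) * Real.exp (-z / 4) * 1 := by ring
    _ ≤ (1 + z) * Real.exp (-z / 4) * ((4 / δ ^ 2 * (1 + z)) ^ n * Real.exp (-(n * s))) := by
        gcongr
    _ = (4 / δ ^ 2) ^ n * ((1 + z) ^ (1 + n) * Real.exp (-z / 4)) * Real.exp (-(n * s)) := by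
        rw [pow_add, mul_pow]; ring
    _ ≤ _ := by
        refine mul_le_mul_of_nonneg_right (mul_le_mul_of_nonneg_left
          (one_add_pow_mul_exp_le _ hz0) (by positivity)) (by positivity)

end Weights

/-! ### The quadratic inequality that requires λ > 8 -/

section Algebra

/-- The quadratic estimate behind the monotonicity of the weighted energy. The quantities `nv`,
`nz`, `nw` are the norms of `V = τ ∂ₜU - ½ Z`, of `Z = x·∇U` and of the defect
`W = Aⁱʲ xᵢ ∂ⱼU - m Z`, while `P = |∇U|²` and `e = Aⁱʲ ∂ᵢU · ∂ⱼU`. -/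
theorem quadratic_rate_le {lam L r Y τ m e P nv nz nw vz vw zw B : ℝ} (hlam : 8 < lam) (hL : 1 ≤ L)
    (hr : 0 ≤ r) (hτ : 0 < τ) (hY0 : 0 ≤ Y)
    (hm : L⁻¹ ≤ m) (hP : 0 ≤ P) (he : 0 ≤ e)
    (hvz : |vz| ≤ nv * nz) (hvw : |vw| ≤ nv * nw) (hzw : |zw| ≤ nz * nw)
    (hz2 : nz ^ 2 ≤ r ^ 2 * P) (hw2 : nw ^ 2 ≤ 18 * L ^ 2 * r ^ 4 * P)
    (hmP : m * P ≤ e + 3 * L * r * P) (hB : |B| ≤ 2 * L * r * P) :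
    -(1 / 2) * r ^ 2 * e - (Y + lam) * m * nv ^ 2 - 4 * m * vz - (2 - (Y + lam) / 2) * vw + zw
        + 1 / 2 * (2 - (Y + lam) / 2) * τ * B
      ≤ -(min (3 / 4) ((lam - 8) / (2 * (lam + 24)))) * (m * (Y + 1) * nv ^ 2 + r ^ 2 * e)
        + (7 * L * r ^ 3 + (Y + lam) * (18 * L ^ 3 * lam / (lam - 8)) * r ^ 4
          + (Y + lam) * τ * L * r) * P := by
  set σ := Y + lam with hσ
  have hσ8 : 8 < σ := by linarith
  have hm0 : 0 < m := lt_of_lt_of_le (by positivity) hm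
  have hLm : 1 ≤ L * m := by
    have : L * L⁻¹ = 1 := mul_inv_cancel₀ (by positivity)
    nlinarith
  have hl0 : 0 < lam - 8 := by linarith
  have hl24 : 0 < lam + 24 := by linarith
  -- This choice gives ½ - β = 16/(λ + 24). Young's inequality for 4|V||Z| with coefficients (λ +
  -- 24)/4 and 16/(λ + 24), whose product is 4, then leaves β of the gradient term and 3(λ - 8)/4 of
  -- the λ|V|² term.
  set β := (lam - 8) / (2 * (lam + 24)) with hβ
  set c := min (3 / 4) β with hc
  have hβ0 : 0 < β := by positivity
  have hc0 : 0 ≤ c := le_min (by norm_num) hβ0.le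
  have hcβ : c ≤ β := min_le_right _ _
  have hc34 : c ≤ 3 / 4 := min_le_left _ _
  have hβ' : β ≤ (lam - 8) / 2 := by
    rw [hβ]
    gcongr
    linarith
  -- the cross term with `Z`
  have s1 : -4 * m * vz ≤ (lam + 24) / 4 * (m * nv ^ 2) + (1 / 2 - β) * (m * nz ^ 2) := by
    have h1 : -vz ≤ nv * nz := (neg_le_abs _).trans hvz
    have h2 : (1 / 2 - β) = 16 / (lam + 24) := by rw [hβ]; field_simp; ring
    have h3 : 4 * (nv * nz) ≤ (lam + 24) / 4 * nv ^ 2 + 16 / (lam + 24) * nz ^ 2 := by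
      have h4 : (lam + 24) / 4 * nv ^ 2 + 16 / (lam + 24) * nz ^ 2 - 4 * (nv * nz)
          = ((lam + 24) * nv - 8 * nz) ^ 2 / (4 * (lam + 24)) := by field_simp; ring
      have h5 : 0 ≤ ((lam + 24) * nv - 8 * nz) ^ 2 / (4 * (lam + 24)) := by positivity
      linarith
    rw [h2]
    calc -4 * m * vz = m * (4 * -vz) := by ring
      _ ≤ m * (4 * (nv * nz)) := by gcongr
      _ ≤ m * ((lam + 24) / 4 * nv ^ 2 + 16 / (lam + 24) * nz ^ 2) := by gcongr
      _ = _ := by ring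
  have hβ2 : 0 ≤ 1 / 2 - β := by
    have h2 : (1 / 2 - β) = 16 / (lam + 24) := by rw [hβ]; field_simp; ring
    rw [h2]; positivity
  have s2 : (1 / 2 - β) * (m * nz ^ 2) ≤ (1 / 2 - β) * (r ^ 2 * e) + 2 * L * r ^ 3 * P := by
    have h1 : m * nz ^ 2 ≤ r ^ 2 * e + 3 * L * r ^ 3 * P := by
      calc m * nz ^ 2 ≤ m * (r ^ 2 * P) := by gcongr
        _ = r ^ 2 * (m * P) := by ring
        _ ≤ r ^ 2 * (e + 3 * L * r * P) := by gcongr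
        _ = _ := by ring
    have h2 : (1 / 2 - β) * (3 * L * r ^ 3 * P) ≤ 1 / 2 * (3 * L * r ^ 3 * P) := by
      gcongr; linarith
    have h3 : 0 ≤ L * r ^ 3 * P := by positivity
    calc (1 / 2 - β) * (m * nz ^ 2) ≤ (1 / 2 - β) * (r ^ 2 * e + 3 * L * r ^ 3 * P) := by gcongr
      _ ≤ _ := by linarith
  -- the cross term with `W`
  have hζ : |2 - σ / 2| ≤ σ := by rw [abs_le]; constructor <;> linarith
  -- The defect W is quadratic in r, so a small share (λ - 8)/(4λ) of σ m|V|² suffices; it uses (λ -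
  -- 8)/4 of the constant part and less than a quarter of the Y part.
  have s3 : -(2 - σ / 2) * vw ≤ (lam - 8) / (4 * lam) * (σ * (m * nv ^ 2))
      + σ * (18 * L ^ 3 * lam / (lam - 8)) * r ^ 4 * P := by
    have hl : 0 < lam := by linarith
    have h1 : -(2 - σ / 2) * vw ≤ σ * (nv * nw) := by
      calc -(2 - σ / 2) * vw ≤ |-(2 - σ / 2) * vw| := le_abs_self _
        _ = |2 - σ / 2| * |vw| := by rw [abs_mul, abs_neg]
        _ ≤ σ * (nv * nw) := by gcongr
    have h2 : nv * nw ≤ (lam - 8) / (4 * lam) * (m * nv ^ 2)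
        + (18 * L ^ 3 * lam / (lam - 8)) * r ^ 4 * P := by
      have h3 : nv * nw ≤ (lam - 8) / (4 * lam) * (m * nv ^ 2) + lam / (lam - 8) * L * nw ^ 2 := by
        have h4 : nv * nw ≤ (lam - 8) / (4 * lam) * (m * nv ^ 2) + lam / ((lam - 8) * m) * nw ^ 2 := by
          have h5 : (lam - 8) / (4 * lam) * (m * nv ^ 2) + lam / ((lam - 8) * m) * nw ^ 2 - nv * nw
              = ((lam - 8) * m * nv - 2 * lam * nw) ^ 2 / (4 * lam * (lam - 8) * m) := by
            field_simp; ring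
          have h6 : 0 ≤ ((lam - 8) * m * nv - 2 * lam * nw) ^ 2 / (4 * lam * (lam - 8) * m) := by
            positivity
          linarith
        have h7 : lam / ((lam - 8) * m) ≤ lam / (lam - 8) * L := by
          rw [div_mul_eq_mul_div, div_le_div_iff₀ (by positivity) hl0]
          have : lam * (lam - 8) * 1 ≤ lam * (lam - 8) * (L * m) := by gcongr
          linarith
        have h8 : lam / ((lam - 8) * m) * nw ^ 2 ≤ lam / (lam - 8) * L * nw ^ 2 := by gcongr
        linarith
      have h9 : lam / (lam - 8) * L * nw ^ 2 ≤ lam / (lam - 8) * L * (18 * L ^ 2 * r ^ 4 * P) := by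
        gcongr
      have h10 : lam / (lam - 8) * L * (18 * L ^ 2 * r ^ 4 * P)
          = (18 * L ^ 3 * lam / (lam - 8)) * r ^ 4 * P := by ring
      linarith
    have h11 := mul_le_mul_of_nonneg_left h2 (by linarith : 0 ≤ σ)
    linarith
  -- The constant 5 is a rounding of √18.
  have s4 : zw ≤ 5 * L * r ^ 3 * P := by
    have h1 : nz * nw ≤ 5 * L * r ^ 3 * P := by
      refine abs_le_of_sq_le_sq' ?_ (by positivity) |>.2
      calc (nz * nw) ^ 2 = nz ^ 2 * nw ^ 2 := by ring
        _ ≤ (r ^ 2 * P) * (18 * L ^ 2 * r ^ 4 * P) := by gcongr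
        _ = 18 * (L * r ^ 3 * P) ^ 2 := by ring
        _ ≤ 25 * (L * r ^ 3 * P) ^ 2 := by gcongr; norm_num
        _ = _ := by ring
    exact (le_abs_self _).trans (hzw.trans h1)
  have s5 : 1 / 2 * (2 - σ / 2) * τ * B ≤ σ * τ * L * r * P := by
    calc 1 / 2 * (2 - σ / 2) * τ * B ≤ |1 / 2 * (2 - σ / 2) * τ * B| := le_abs_self _
      _ = 1 / 2 * |2 - σ / 2| * τ * |B| := by
          rw [abs_mul, abs_mul, abs_mul, abs_of_pos hτ]; norm_num
      _ ≤ 1 / 2 * σ * τ * (2 * L * r * P) := by gcongr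
      _ = _ := by ring
  -- collect
  have hmn : 0 ≤ m * nv ^ 2 := by positivity
  have hre : 0 ≤ r ^ 2 * e := by positivity
  -- What remains is (λ - 8)/2 in the constant part, which is at least β, and 3/4 in the coefficient
  -- of Y; this is the origin of the minimum defining c.
  have k1 : (lam + 24) / 4 * (m * nv ^ 2) + (lam - 8) / (4 * lam) * (σ * (m * nv ^ 2))
      - σ * m * nv ^ 2 ≤ -(c * (m * (Y + 1) * nv ^ 2)) := by
    have h1 : (lam + 24) / 4 + (lam - 8) / (4 * lam) * σ - σ ≤ -(c * (Y + 1)) := by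
      have h2 : (lam - 8) / (4 * lam) ≤ 1 / 4 := by
        rw [div_le_div_iff₀ (by linarith) (by norm_num)]; linarith
      have h3 : (lam - 8) / (4 * lam) * σ = (lam - 8) / (4 * lam) * Y + (lam - 8) / 4 := by
        rw [hσ]; field_simp
      have h4 : (lam - 8) / (4 * lam) * Y ≤ 1 / 4 * Y := by gcongr
      have h5 : c * Y ≤ 3 / 4 * Y := by gcongr
      rw [h3, hσ]
      linarith
    have := mul_le_mul_of_nonneg_right h1 hmn
    linarith
  have k2 : c * (r ^ 2 * e) ≤ β * (r ^ 2 * e) := by gcongr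
  linarith

end Algebra

/-! ## The metric in normalized coordinates -/

section NormalizedMetric

set_option linter.unusedSectionVars false

variable {k : ℕ}

theorem radialDeriv_eq_fderiv {V : Type*} [NormedAddCommGroup V] [NormedSpace ℝ V]
    (f : EuclideanSpace ℝ (Fin 2) → V) (x : EuclideanSpace ℝ (Fin 2)) :
    radialDeriv f x = fderiv ℝ f x x := by
  conv_rhs => rw [euclidean_eq_sum x]
  simp only [radialDeriv, pderiv2, map_sum, map_smul]
  rw [← euclidean_eq_sum x]

theorem radialDeriv_mul {f h : EuclideanSpace ℝ (Fin 2) → ℝ} {x : EuclideanSpace ℝ (Fin 2)}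
    (hf : DifferentiableAt ℝ f x) (hh : DifferentiableAt ℝ h x) :
    radialDeriv (fun z => f z * h z) x = radialDeriv f x * h x + f x * radialDeriv h x := by
  simp only [radialDeriv, pderiv2_mul _ hf hh, Fin.sum_univ_two, smul_eq_mul]
  ring

theorem radialDeriv_sub {f h : EuclideanSpace ℝ (Fin 2) → ℝ} {x : EuclideanSpace ℝ (Fin 2)}
    (hf : DifferentiableAt ℝ f x) (hh : DifferentiableAt ℝ h x) :
    radialDeriv (fun z => f z - h z) x = radialDeriv f x - radialDeriv h x := by
  simp only [radialDeriv, pderiv2_sub _ hf hh, Fin.sum_univ_two, smul_eq_mul]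
  ring

theorem radialDeriv_neg {f : EuclideanSpace ℝ (Fin 2) → ℝ} {x : EuclideanSpace ℝ (Fin 2)} :
    radialDeriv (fun z => -f z) x = -radialDeriv f x := by
  simp [radialDeriv_eq_fderiv]

theorem radialDeriv_congr {V : Type*} [NormedAddCommGroup V] [NormedSpace ℝ V]
    {f h : EuclideanSpace ℝ (Fin 2) → V} {x : EuclideanSpace ℝ (Fin 2)} (hfh : f =ᶠ[𝓝 x] h) :
    radialDeriv f x = radialDeriv h x := by
  simp only [radialDeriv_eq_fderiv, hfh.fderiv_eq]

/-- Quantitative closeness at `x` of conformal coefficients and volume density to the flat ones. -/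
structure IsNearlyFlat (L : ℝ) (A : EuclideanSpace ℝ (Fin 2) → Matrix (Fin 2) (Fin 2) ℝ)
    (m : EuclideanSpace ℝ (Fin 2) → ℝ) (x : EuclideanSpace ℝ (Fin 2)) : Prop where
  symm : A x 1 0 = A x 0 1
  coeff_le : ∀ i j, |A x i j| ≤ L
  coeff_sub_le : ∀ i j, |A x i j - (1 : Matrix (Fin 2) (Fin 2) ℝ) i j| ≤ L * ‖x‖
  radial_le : ∀ i j, |radialDeriv (fun z => A z i j) x| ≤ L * ‖x‖
  density_lower : L⁻¹ ≤ m x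
  density_upper : m x ≤ L
  density_sub_le : |m x - 1| ≤ L * ‖x‖
  coercive : ∀ (k : ℕ) (f : EuclideanSpace ℝ (Fin 2) → EuclideanSpace ℝ (Fin k)),
    L⁻¹ * (‖pderiv2 0 f x‖ ^ 2 + ‖pderiv2 1 f x‖ ^ 2) ≤ dirichletForm (A x) f x

variable {M : Type*} [TopologicalSpace M] [ChartedSpace (EuclideanSpace ℝ (Fin 2)) M]
  [IsManifold (𝓡 2) ∞ M] {g : SurfaceMetric M}
  {e : OpenPartialHomeomorph M (EuclideanSpace ℝ (Fin 2))} {δ K : ℝ} {p₀ : M}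

/-- In dimension two √g times A is the adjugate of the metric matrix, and (√g)² is its determinant.
These polynomial identities let bounds on A and √g be read off, and differentiated, without handling
an inverse matrix. -/
theorem conformalCoeff_eq (he : e ∈ IsManifold.maximalAtlas (𝓡 2) ∞ M)
    {x : EuclideanSpace ℝ (Fin 2)} (hx : x ∈ e.target) :
    conformalCoeff g e x 0 0 * volumeDensity g e x = metricMatrix g e x 1 1 ∧
    conformalCoeff g e x 0 1 * volumeDensity g e x = -metricMatrix g e x 0 1 ∧
    conformalCoeff g e x 1 0 * volumeDensity g e x = -metricMatrix g e x 0 1 ∧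
    conformalCoeff g e x 1 1 * volumeDensity g e x = metricMatrix g e x 0 0 ∧
    volumeDensity g e x * volumeDensity g e x = metricMatrix g e x 0 0 * metricMatrix g e x 1 1
      - metricMatrix g e x 0 1 * metricMatrix g e x 0 1 := by
  have hd := metricMatrix_det_pos (g := g) he hx
  have hs : metricMatrix g e x 1 0 = metricMatrix g e x 0 1 := metricMatrix_symm x 1 0
  obtain ⟨i1, i2, i3, i4⟩ := matrix_inv_fin_two (metricMatrix g e x)
  have hsq : volumeDensity g e x * volumeDensity g e x = (metricMatrix g e x).det :=
    Real.mul_self_sqrt hd.le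
  have hm : Real.sqrt (metricMatrix g e x).det = volumeDensity g e x := rfl
  have key : ∀ a : ℝ, volumeDensity g e x * ((metricMatrix g e x).det⁻¹ * a)
      * volumeDensity g e x = a := by
    intro a
    rw [← hsq]
    have := (volumeDensity_pos (g := g) he hx).ne'
    field_simp
  refine ⟨?_, ?_, ?_, ?_, ?_⟩
  · simp only [conformalCoeff, Matrix.of_apply, i1, hm, key]
  · simp only [conformalCoeff, Matrix.of_apply, i2, hm, mul_neg, neg_mul, key]
  · simp only [conformalCoeff, Matrix.of_apply, i3, hm, mul_neg, neg_mul, key, hs]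
  · simp only [conformalCoeff, Matrix.of_apply, i4, hm, key]
  · rw [hsq, Matrix.det_fin_two, hs]

theorem IsNormalizedChart.one_le (h : IsNormalizedChart g δ K p₀ e) (hδ : 0 < δ) : 1 ≤ K := by
  have h1 := h.metric_upper 0 (Metric.mem_closedBall_self hδ.le) ![1, 0]
  rw [h.metric_zero] at h1
  simpa using h1

set_option maxHeartbeats 1600000 in
-- The coefficients satisfy |gᵢⱼ - δᵢⱼ| ≤ Kr by the mean value inequality from the origin, and √g
-- lies between K⁻¹ and K. All bounds follow from the adjugate identities, each division by √g
-- costing a factor K. The constant 4K⁶ is a common bound for the resulting polynomials such as K² +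
-- 2K⁶ and K² + 3K³.
theorem IsNormalizedChart.isNearlyFlat (h : IsNormalizedChart g δ K p₀ e) (hδ : 0 < δ)
    {x : EuclideanSpace ℝ (Fin 2)} (hx : x ∈ Metric.closedBall (0 : EuclideanSpace ℝ (Fin 2)) δ) :
    IsNearlyFlat (4 * K ^ 6) (conformalCoeff g e) (volumeDensity g e) x := by
  have hK := h.one_le hδ
  have hK0 : 0 < K := by linarith
  have hxt := h.ball_subset hx
  have he := h.mem_atlas
  have hn := e.open_target.mem_nhds hxt
  obtain ⟨c1, c2, c3, c4, c5⟩ := conformalCoeff_eq (g := g) he hxt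
  have hm0 := volumeDensity_pos (g := g) he hxt
  set G := metricMatrix g e with hG
  set m := volumeDensity g e with hm
  set A := conformalCoeff g e with hA
  set r := ‖x‖ with hr
  have hr0 : 0 ≤ r := norm_nonneg x
  have dG : ∀ z ∈ e.target, ∀ i j, DifferentiableAt ℝ (fun z => G z i j) z := fun z hz i j =>
    ((contDiffOn_metricMatrix he i j).differentiableOn (by simp)).differentiableAt
      (e.open_target.mem_nhds hz)
  have dm : DifferentiableAt ℝ m x :=
    ((contDiffOn_volumeDensity he).differentiableOn (by simp)).differentiableAt hn
  have dA : ∀ i j, DifferentiableAt ℝ (fun z => A z i j) x := fun i j =>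
    ((contDiffOn_conformalCoeff he i j).differentiableOn (by simp)).differentiableAt hn
  -- entries of the metric
  have hGsub : ∀ i j, |G x i j - (1 : Matrix (Fin 2) (Fin 2) ℝ) i j| ≤ K * r := by
    intro i j
    have h1 := (convex_closedBall (0 : EuclideanSpace ℝ (Fin 2)) δ).norm_image_sub_le_of_norm_fderiv_le
      (f := fun z => G z i j) (C := K) (fun z hz => dG z (h.ball_subset hz) i j)
      (fun z hz => h.metric_deriv_bound z hz i j) (Metric.mem_closedBall_self hδ.le) hx
    simpa [hG, h.metric_zero] using h1
  have hDG : ∀ i j, |radialDeriv (fun z => G z i j) x| ≤ K * r := by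
    intro i j
    rw [radialDeriv_eq_fderiv]
    exact ((fderiv ℝ (fun z => G z i j) x).le_opNorm x).trans
      (mul_le_mul_of_nonneg_right (h.metric_deriv_bound x hx i j) hr0)
  have u0 := h.metric_upper x hx ![1, 0]
  have u1 := h.metric_upper x hx ![0, 1]
  have l0 := h.metric_lower x hx ![1, 0]
  have l1 := h.metric_lower x hx ![0, 1]
  -- Here the quadratic form equals g₀₀ det g, which yields the lower bound for the determinant.
  have l2 := h.metric_lower x hx ![-G x 0 1, G x 0 0]
  have hs : G x 1 0 = G x 0 1 := metricMatrix_symm x 1 0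
  simp [← hG] at u0 u1 l0 l1
  simp only [Fin.sum_univ_two, ← hG, Matrix.cons_val_zero, Matrix.cons_val_one, hs] at l2
  have hKi : 0 < K⁻¹ := by positivity
  have g00 : |G x 0 0| ≤ K := abs_le.2 ⟨by linarith, u0⟩
  have g11 : |G x 1 1| ≤ K := abs_le.2 ⟨by linarith, u1⟩
  have hdet : K⁻¹ ^ 2 ≤ m x * m x := by
    have h1 : K⁻¹ * G x 0 0 ≤ m x * m x := by
      have h2 : G x 0 0 * (K⁻¹ * G x 0 0) ≤ G x 0 0 * (m x * m x) := by
        have h3 : 0 ≤ K⁻¹ * (G x 0 1) ^ 2 := by positivity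
        rw [c5]
        nlinarith
      exact le_of_mul_le_mul_left h2 (by linarith)
    have h2 : K⁻¹ * K⁻¹ ≤ K⁻¹ * G x 0 0 := by gcongr
    calc K⁻¹ ^ 2 = K⁻¹ * K⁻¹ := by ring
      _ ≤ _ := h2.trans h1
  have hml : K⁻¹ ≤ m x := by
    refine le_of_sq_le_sq ?_ hm0.le
    rw [sq (m x)]; exact hdet
  have hmu : m x ≤ K := by
    refine le_of_sq_le_sq ?_ hK0.le
    have h1 : G x 0 0 * G x 1 1 ≤ K * K := by
      have : 0 ≤ G x 1 1 := by linarith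
      gcongr
    nlinarith [mul_self_nonneg (G x 0 1)]
  have g01 : |G x 0 1| ≤ K := by
    refine abs_le_of_sq_le_sq ?_ hK0.le
    have h1 : G x 0 0 * G x 1 1 ≤ K * K := by
      have : 0 ≤ G x 1 1 := by linarith
      gcongr
    nlinarith [mul_self_nonneg (m x)]
  have e00 := hGsub 0 0
  have e01 := hGsub 0 1
  have e11 := hGsub 1 1
  simp at e00 e01 e11
  have hmi : 1 ≤ K * m x := by
    have : K * K⁻¹ = 1 := mul_inv_cancel₀ hK0.ne'
    nlinarith
  -- dividing by the density
  have hdiv : ∀ a b B : ℝ, a * m x = b → |b| ≤ B → |a| ≤ K * B := by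
    intro a b B hab hb
    have hB : 0 ≤ B := (abs_nonneg _).trans hb
    calc |a| = |a| * 1 := by ring
      _ ≤ |a| * (K * m x) := by gcongr
      _ = K * |a * m x| := by rw [abs_mul, abs_of_pos hm0]; ring
      _ ≤ K * B := by rw [hab]; gcongr
  have hK2 : K ≤ K ^ 6 := le_self_pow₀ hK (by norm_num)
  have hK22 : K ^ 2 ≤ K ^ 6 := pow_le_pow_right₀ hK (by norm_num)
  have hK3 : K ^ 3 ≤ K ^ 6 := pow_le_pow_right₀ hK (by norm_num)
  have hK6 : 1 ≤ K ^ 6 := one_le_pow₀ hK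
  have hmsub : |m x - 1| ≤ 3 * K ^ 2 * r := by
    have h1 : |m x * m x - 1| ≤ 3 * K ^ 2 * r := by
      have h2 : m x * m x - 1 = (G x 0 0 - 1) * G x 1 1 + (G x 1 1 - 1) - G x 0 1 * G x 0 1 := by
        rw [c5]; ring
      calc |m x * m x - 1| ≤ |(G x 0 0 - 1) * G x 1 1| + |G x 1 1 - 1| + |G x 0 1 * G x 0 1| := by
            rw [h2]
            exact (abs_sub _ _).trans (by gcongr; exact abs_add_le _ _)
        _ ≤ K * r * K + K * r + K * r * K := by
            rw [abs_mul, abs_mul]; gcongr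
        _ ≤ _ := by
            have : K * r ≤ K ^ 2 * r := by gcongr; nlinarith
            nlinarith
    have h3 : |m x * m x - 1| = |m x - 1| * (m x + 1) := by
      rw [show m x * m x - 1 = (m x - 1) * (m x + 1) by ring, abs_mul,
        abs_of_pos (by linarith : 0 < m x + 1)]
    calc |m x - 1| = |m x - 1| * 1 := by ring
      _ ≤ |m x - 1| * (m x + 1) := by gcongr; linarith
      _ ≤ _ := by rw [← h3]; exact h1
  have hsub : ∀ a b : ℝ, a * m x = b → |b - 1| ≤ K * r → |a - 1| ≤ 4 * K ^ 6 * r := by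
    intro a b hab hb
    have h1 := hdiv (a - 1) (b - m x) (K * r + 3 * K ^ 2 * r) (by rw [← hab]; ring) (by
      calc |b - m x| = |(b - 1) - (m x - 1)| := by congr 1; ring
        _ ≤ |b - 1| + |m x - 1| := abs_sub _ _
        _ ≤ _ := by gcongr)
    refine h1.trans ?_
    have : K * (K * r + 3 * K ^ 2 * r) = (K ^ 2 + 3 * K ^ 3) * r := by ring
    rw [this]
    gcongr
    linarith
  -- derivative of the density
  have hDm : |radialDeriv m x| ≤ 2 * K ^ 3 * r := by
    have h1 : radialDeriv (fun z => m z * m z) x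
        = radialDeriv (fun z => G z 0 0 * G z 1 1 - G z 0 1 * G z 0 1) x := by
      refine radialDeriv_congr ?_
      filter_upwards [hn] with z hz using (conformalCoeff_eq he hz).2.2.2.2
    rw [radialDeriv_mul dm dm, radialDeriv_sub ((dG x hxt 0 0).fun_mul (dG x hxt 1 1))
      ((dG x hxt 0 1).fun_mul (dG x hxt 0 1)), radialDeriv_mul (dG x hxt 0 0) (dG x hxt 1 1),
      radialDeriv_mul (dG x hxt 0 1) (dG x hxt 0 1)] at h1
    have h2 := hdiv (radialDeriv m x) _ (2 * K ^ 2 * r)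
      (show radialDeriv m x * m x = 1 / 2 * ((radialDeriv (fun z => G z 0 0) x * G x 1 1
        + G x 0 0 * radialDeriv (fun z => G z 1 1) x) - (radialDeriv (fun z => G z 0 1) x * G x 0 1
        + G x 0 1 * radialDeriv (fun z => G z 0 1) x)) by linarith) (by
      rw [abs_mul, abs_of_pos (by norm_num : (0 : ℝ) < 1 / 2)]
      calc _ ≤ 1 / 2 * ((K * r * K + K * (K * r)) + (K * r * K + K * (K * r))) := by
            gcongr
            refine (abs_sub _ _).trans ?_
            gcongr
            · refine (abs_add_le _ _).trans ?_
              rw [abs_mul, abs_mul]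
              gcongr
              · exact hDG 0 0
              · exact hDG 1 1
            · refine (abs_add_le _ _).trans ?_
              rw [abs_mul, abs_mul]
              gcongr
              · exact hDG 0 1
              · exact hDG 0 1
        _ = 2 * K ^ 2 * r := by ring)
    refine h2.trans (le_of_eq ?_)
    ring
  have hDA : ∀ i j, ∀ B : EuclideanSpace ℝ (Fin 2) → ℝ, (∀ z ∈ e.target, A z i j * m z = B z) →
      |radialDeriv B x| ≤ K * r → |A x i j| ≤ K ^ 2 →
      |radialDeriv (fun z => A z i j) x| ≤ 4 * K ^ 6 * r := by
    intro i j B hB hBd hAb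
    have h1 : radialDeriv (fun z => A z i j * m z) x = radialDeriv B x := by
      refine radialDeriv_congr ?_
      filter_upwards [hn] with z hz using hB z hz
    rw [radialDeriv_mul (dA i j) dm] at h1
    have h2 := hdiv (radialDeriv (fun z => A z i j) x) (radialDeriv B x - A x i j * radialDeriv m x)
      (K * r + K ^ 2 * (2 * K ^ 3 * r)) (by rw [← h1]; ring) (by
        refine (abs_sub _ _).trans ?_
        rw [abs_mul]
        gcongr)
    refine h2.trans ?_
    have : K * (K * r + K ^ 2 * (2 * K ^ 3 * r)) = (K ^ 2 + 2 * K ^ 6) * r := by ring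
    rw [this]
    gcongr
    linarith
  have a00 : |A x 0 0| ≤ K ^ 2 := (hdiv _ _ _ c1 g11).trans (le_of_eq (by ring))
  have a01 : |A x 0 1| ≤ K ^ 2 := (hdiv _ _ K c2 (by rwa [abs_neg])).trans (le_of_eq (by ring))
  have a10 : |A x 1 0| ≤ K ^ 2 := (hdiv _ _ K c3 (by rwa [abs_neg])).trans (le_of_eq (by ring))
  have a11 : |A x 1 1| ≤ K ^ 2 := (hdiv _ _ _ c4 g00).trans (le_of_eq (by ring))
  have hL0 : (0 : ℝ) < 4 * K ^ 6 := by positivity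
  have off : ∀ a : ℝ, a * m x = -G x 0 1 → |a| ≤ 4 * K ^ 6 * r := by
    intro a ha
    refine (hdiv _ _ (K * r) ha (by rwa [abs_neg])).trans ?_
    rw [← mul_assoc]
    refine mul_le_mul_of_nonneg_right ?_ hr0
    linarith [sq K]
  have hDneg : |radialDeriv (fun z => -G z 0 1) x| ≤ K * r := by
    rw [radialDeriv_neg, abs_neg]; exact hDG 0 1
  refine ⟨?_, ?_, ?_, ?_, ?_, ?_, ?_, ?_⟩
  · exact mul_right_cancel₀ hm0.ne' (c3.trans c2.symm)
  · intro i j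
    have : K ^ 2 ≤ 4 * K ^ 6 := by linarith
    fin_cases i <;> fin_cases j <;> simp only [Fin.zero_eta, Fin.mk_one]
    · exact a00.trans this
    · exact a01.trans this
    · exact a10.trans this
    · exact a11.trans this
  · intro i j
    fin_cases i <;> fin_cases j <;> simp
    · exact hsub _ _ c1 e11
    · exact off _ c2
    · exact off _ c3
    · exact hsub _ _ c4 e00
  · intro i j
    fin_cases i <;> fin_cases j <;> simp only [Fin.zero_eta, Fin.mk_one]
    · exact hDA 0 0 (fun z => G z 1 1) (fun z hz => (conformalCoeff_eq he hz).1) (hDG 1 1) a00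
    · exact hDA 0 1 (fun z => -G z 0 1) (fun z hz => (conformalCoeff_eq he hz).2.1) hDneg a01
    · exact hDA 1 0 (fun z => -G z 0 1) (fun z hz => (conformalCoeff_eq he hz).2.2.1) hDneg a10
    · exact hDA 1 1 (fun z => G z 0 0) (fun z hz => (conformalCoeff_eq he hz).2.2.2.1) (hDG 0 0) a11
  · exact (inv_anti₀ hK0 (by linarith)).trans hml
  · linarith
  · refine hmsub.trans ?_
    gcongr
    linarith
  · intro k f
    set a := ‖pderiv2 0 f x‖
    set b := ‖pderiv2 1 f x‖
    have hip : |(inner ℝ (pderiv2 0 f x) (pderiv2 1 f x) : ℝ)| ≤ a * b := abs_real_inner_le_norm _ _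
    have h1 : dirichletForm (A x) f x * m x = G x 1 1 * a ^ 2
        - 2 * G x 0 1 * inner ℝ (pderiv2 0 f x) (pderiv2 1 f x) + G x 0 0 * b ^ 2 := by
      simp only [dirichletForm, Fin.sum_univ_two, real_inner_self_eq_norm_sq,
        real_inner_comm (pderiv2 0 f x) (pderiv2 1 f x)]
      linear_combination a ^ 2 * c1 + inner ℝ (pderiv2 0 f x) (pderiv2 1 f x) * c2
        + inner ℝ (pderiv2 0 f x) (pderiv2 1 f x) * c3 + b ^ 2 * c4
    -- The adjugate form at (a, ∓b) is the metric form at (b, ±a); the sign is chosen so that the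
    -- cross term has the worst sign.
    have h2 : K⁻¹ * (a ^ 2 + b ^ 2) ≤ G x 1 1 * a ^ 2 - 2 * |G x 0 1| * (a * b) + G x 0 0 * b ^ 2 := by
      rcases le_total 0 (G x 0 1) with hs0 | hs0
      · have h3 := h.metric_lower x hx ![b, -a]
        simp only [Fin.sum_univ_two, ← hG, Matrix.cons_val_zero, Matrix.cons_val_one, hs] at h3
        rw [abs_of_nonneg hs0]
        linarith
      · have h3 := h.metric_lower x hx ![b, a]
        simp only [Fin.sum_univ_two, ← hG, Matrix.cons_val_zero, Matrix.cons_val_one, hs] at h3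
        rw [abs_of_nonpos hs0]
        linarith
    have h3 : G x 0 1 * inner ℝ (pderiv2 0 f x) (pderiv2 1 f x) ≤ |G x 0 1| * (a * b) := by
      refine (le_abs_self _).trans ?_
      rw [abs_mul]
      gcongr
    have h4 : K⁻¹ * (a ^ 2 + b ^ 2) ≤ dirichletForm (A x) f x * m x := by rw [h1]; linarith
    have hab : 0 ≤ a ^ 2 + b ^ 2 := by positivity
    have h5 : 0 ≤ dirichletForm (A x) f x := by
      refine le_of_mul_le_mul_right ?_ hm0
      rw [zero_mul]
      exact le_trans (by positivity) h4
    have h6 : K⁻¹ * (a ^ 2 + b ^ 2) ≤ dirichletForm (A x) f x * K :=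
      h4.trans (by gcongr)
    have h7 : (4 * K ^ 6)⁻¹ ≤ K⁻¹ * K⁻¹ := by
      rw [← mul_inv]
      exact inv_anti₀ (by positivity) (by nlinarith)
    calc (4 * K ^ 6)⁻¹ * (a ^ 2 + b ^ 2) ≤ K⁻¹ * K⁻¹ * (a ^ 2 + b ^ 2) := by gcongr
      _ = K⁻¹ * (K⁻¹ * (a ^ 2 + b ^ 2)) := by ring
      _ ≤ K⁻¹ * (dirichletForm (A x) f x * K) := by gcongr
      _ = dirichletForm (A x) f x := by field_simp

end NormalizedMetric

/-! ## The self-similar weights -/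

section SimilarityWeights

/-- The backward Gaussian weight `e^{-|x|²/(4τ)} φ²`. -/
def gaussCutoff (φ : EuclideanSpace ℝ (Fin 2) → ℝ) (τ : ℝ) (x : EuclideanSpace ℝ (Fin 2)) : ℝ :=
  Real.exp (-(‖x‖ ^ 2 / τ) / 4) * φ x ^ 2

/-- The weight `(|x|²/(T-t) + λ) e^{-|x|²/(4(T-t))} φ²`. -/
def similarityWeight (lam T : ℝ) (φ : EuclideanSpace ℝ (Fin 2) → ℝ)
    (x : EuclideanSpace ℝ (Fin 2)) (t : ℝ) : ℝ :=
  (‖x‖ ^ 2 / (T - t) + lam) * gaussCutoff φ (T - t) x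

/-- The weight of the dilation field in the Pohozaev identity. -/
def dilationWeight (lam τ : ℝ) (φ : EuclideanSpace ℝ (Fin 2) → ℝ)
    (x : EuclideanSpace ℝ (Fin 2)) : ℝ :=
  -((2 - (‖x‖ ^ 2 / τ + lam) / 2) * gaussCutoff φ τ x / τ)

variable {lam T τ δ c : ℝ} {φ : EuclideanSpace ℝ (Fin 2) → ℝ} {x : EuclideanSpace ℝ (Fin 2)}

theorem gaussCutoff_nonneg : 0 ≤ gaussCutoff φ τ x :=
  mul_nonneg (Real.exp_pos _).le (sq_nonneg _)

theorem pderiv2_comp_norm_sq_mul {F : ℝ → ℝ} {F' : ℝ} {χ : EuclideanSpace ℝ (Fin 2) → ℝ}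
    (hF : HasDerivAt F F' (‖x‖ ^ 2)) (hχ : DifferentiableAt ℝ χ x) (i : Fin 2) :
    pderiv2 i (fun z => F (‖z‖ ^ 2) * χ z) x
      = F' * (2 * x i) * χ x + F (‖x‖ ^ 2) * pderiv2 i χ x := by
  have h1 : HasFDerivAt (fun z : EuclideanSpace ℝ (Fin 2) => ‖z‖ ^ 2) _ x :=
    (hasStrictFDerivAt_norm_sq x).hasFDerivAt
  have h2 := hF.comp_hasFDerivAt x h1
  refine (pderiv2_mul i h2.differentiableAt hχ).trans ?_
  have h3 : pderiv2 i (F ∘ fun z : EuclideanSpace ℝ (Fin 2) => ‖z‖ ^ 2) x = F' * (2 * x i) := by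
    rw [pderiv2, h2.fderiv]
    simp [EuclideanSpace.inner_single_right]
  rw [h3]
  rfl

theorem hasDerivAt_exp_neg_div (τ r : ℝ) : HasDerivAt (fun r => Real.exp (-(r / τ) / 4))
    (-(1 / τ / 4) * Real.exp (-(r / τ) / 4)) r := by
  have h : HasDerivAt (fun r : ℝ => -(r / τ) / 4) (-(1 / τ) / 4) r :=
    (((hasDerivAt_id r).div_const τ).neg).div_const 4
  convert h.exp using 1
  ring

/-- Apart from derivatives of the cut-off, ∇ψ is the radial vector (2 - σ/2) h/τ · x, where σ =
|x|²/τ + λ and h is `gaussCutoff`. The function `dilationWeight` is minus this radial factor, so the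
Pohozaev field is the negative of ∇ψ up to cut-off terms. -/
theorem pderiv2_similarityWeight (hφ : ContDiff ℝ ∞ φ) (t : ℝ) (i : Fin 2) :
    pderiv2 i (fun z => similarityWeight lam T φ z t) x
      = (2 - (‖x‖ ^ 2 / (T - t) + lam) / 2) * gaussCutoff φ (T - t) x / (T - t) * x i
        + (‖x‖ ^ 2 / (T - t) + lam) * Real.exp (-(‖x‖ ^ 2 / (T - t)) / 4)
          * pderiv2 i (fun z => φ z ^ 2) x := by
  have hχ : DifferentiableAt ℝ (fun z => φ z ^ 2) x :=
    ((hφ.pow 2).differentiable (by simp)).differentiableAt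
  have h1 : HasDerivAt (fun r => (r / (T - t) + lam) * Real.exp (-(r / (T - t)) / 4)) _ (‖x‖ ^ 2) :=
    (((hasDerivAt_id (‖x‖ ^ 2)).div_const (T - t)).add_const lam).mul
      (hasDerivAt_exp_neg_div (T - t) (‖x‖ ^ 2))
  have h2 := pderiv2_comp_norm_sq_mul h1 hχ i
  have h3 : (fun z => similarityWeight lam T φ z t) = fun z => (‖z‖ ^ 2 / (T - t) + lam) *
      Real.exp (-(‖z‖ ^ 2 / (T - t)) / 4) * φ z ^ 2 := by
    ext1 z; simp only [similarityWeight, gaussCutoff]; ring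
  rw [h3, h2]
  simp only [gaussCutoff, id]
  ring

theorem pderiv2_dilationWeight (hφ : ContDiff ℝ ∞ φ) (i : Fin 2) :
    pderiv2 i (dilationWeight lam τ φ) x
      = (1 + (2 - (‖x‖ ^ 2 / τ + lam) / 2) / 2) * gaussCutoff φ τ x / τ ^ 2 * x i
        + -((2 - (‖x‖ ^ 2 / τ + lam) / 2) * Real.exp (-(‖x‖ ^ 2 / τ) / 4) / τ)
          * pderiv2 i (fun z => φ z ^ 2) x := by
  have hχ : DifferentiableAt ℝ (fun z => φ z ^ 2) x :=
    ((hφ.pow 2).differentiable (by simp)).differentiableAt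
  have h0 : HasDerivAt (fun r => (2 - (r / τ + lam) / 2)) (-(1 / τ / 2)) (‖x‖ ^ 2) :=
    ((((hasDerivAt_id (‖x‖ ^ 2)).div_const τ).add_const lam).div_const 2).const_sub 2
  have h1 := ((h0.fun_mul (hasDerivAt_exp_neg_div τ (‖x‖ ^ 2))).div_const τ).fun_neg
  have h2 := pderiv2_comp_norm_sq_mul h1 hχ i
  have h3 : dilationWeight lam τ φ = fun z =>
      -((2 - (‖z‖ ^ 2 / τ + lam) / 2) * Real.exp (-(‖z‖ ^ 2 / τ) / 4) / τ) * φ z ^ 2 := by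
    ext1 z; simp only [dilationWeight, gaussCutoff]; ring
  rw [h3]
  refine h2.trans ?_
  simp only [gaussCutoff]
  ring

theorem deriv_similarityWeight {t : ℝ} (ht : t < T) :
    deriv (fun s => similarityWeight lam T φ x s) t
      = (2 - (‖x‖ ^ 2 / (T - t) + lam) / 2) * (‖x‖ ^ 2 / (2 * (T - t) ^ 2))
        * gaussCutoff φ (T - t) x := by
  have hτ : T - t ≠ 0 := (sub_pos.2 ht).ne'
  have h1 : HasDerivAt (fun s : ℝ => ‖x‖ ^ 2 / (T - s)) (‖x‖ ^ 2 / (T - t) ^ 2) t := by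
    have h := (hasDerivAt_const t (‖x‖ ^ 2)).div ((hasDerivAt_id t).const_sub T) hτ
    exact h.congr_deriv (by simp)
  have h2 : HasDerivAt (fun s => similarityWeight lam T φ x s) _ t :=
    (h1.add_const lam).mul (((h1.fun_neg.div_const 4).exp).mul_const (φ x ^ 2))
  rw [h2.deriv, gaussCutoff]
  field_simp
  ring

theorem contDiffOn_similarityWeight (hφ : ContDiff ℝ ∞ φ) (s : Set (EuclideanSpace ℝ (Fin 2))) :
    ContDiffOn ℝ ∞ (fun z : EuclideanSpace ℝ (Fin 2) × ℝ => similarityWeight lam T φ z.1 z.2)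
      (s ×ˢ Iio T) := by
  have h1 : ContDiffOn ℝ ∞ (fun z : EuclideanSpace ℝ (Fin 2) × ℝ => ‖z.1‖ ^ 2 / (T - z.2))
      (s ×ˢ Iio T) :=
    ((contDiff_norm_sq ℝ).comp contDiff_fst).contDiffOn.div
      (contDiff_const.sub contDiff_snd).contDiffOn (fun z hz => (sub_pos.2 hz.2).ne')
  exact (h1.add contDiffOn_const).mul (((h1.neg.div_const 4).exp).mul
    ((hφ.comp contDiff_fst).pow 2).contDiffOn)

theorem contDiff_dilationWeight (hφ : ContDiff ℝ ∞ φ) : ContDiff ℝ ∞ (dilationWeight lam τ φ) := by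
  have h1 : ContDiff ℝ ∞ (fun z : EuclideanSpace ℝ (Fin 2) => ‖z‖ ^ 2 / τ) :=
    (contDiff_norm_sq ℝ).div_const τ
  exact (((contDiff_const.sub ((h1.add contDiff_const).div_const 2)).mul
    (((h1.neg.div_const 4).exp).mul (hφ.pow 2))).div_const τ).neg

theorem IsCutoff.pderiv2_sq_eq_zero (hφ : IsCutoff δ c φ) (hx : ‖x‖ < δ / 2) (i : Fin 2) :
    pderiv2 i (fun z => φ z ^ 2) x = 0 := by
  have h : (fun z => φ z ^ 2) =ᶠ[𝓝 x] fun _ => 1 := by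
    filter_upwards [Metric.isOpen_ball.mem_nhds (mem_ball_zero_iff.2 hx)] with z hz
    rw [hφ.eq_one z (Metric.ball_subset_closedBall hz), one_pow]
  rw [pderiv2_congr i h, pderiv2_const]

theorem IsCutoff.abs_pderiv2_sq_le (hφ : IsCutoff δ c φ) (i : Fin 2) :
    |pderiv2 i (fun z => φ z ^ 2) x| ≤ 2 * (c * δ⁻¹) := by
  have hd : DifferentiableAt ℝ φ x := (hφ.smooth.differentiable (by simp)).differentiableAt
  have h1 : pderiv2 i (fun z => φ z ^ 2) x = 2 * (φ x * pderiv2 i φ x) := by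
    have : (fun z => φ z ^ 2) = fun z => φ z * φ z := by ext1 z; ring
    rw [this, pderiv2_mul i hd hd]
    ring
  have h2 : |pderiv2 i φ x| ≤ c * δ⁻¹ := by
    have := (fderiv ℝ φ x).le_opNorm (EuclideanSpace.single i 1)
    simp only [PiLp.norm_single, norm_one, mul_one] at this
    exact this.trans (hφ.grad_le x)
  rw [h1, abs_mul, abs_mul, abs_two, abs_of_nonneg (hφ.nonneg x)]
  have := hφ.nonneg x
  have := hφ.le_one x
  have h3 : φ x * |pderiv2 i φ x| ≤ 1 * (c * δ⁻¹) := by gcongr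
  linarith

end SimilarityWeights

/-! ## Pointwise estimate of the rate -/

section NearlyFlat

variable {k : ℕ} {L Q : ℝ} {A : EuclideanSpace ℝ (Fin 2) → Matrix (Fin 2) (Fin 2) ℝ}
  {m : EuclideanSpace ℝ (Fin 2) → ℝ} {x : EuclideanSpace ℝ (Fin 2)}
  {f : EuclideanSpace ℝ (Fin 2) → EuclideanSpace ℝ (Fin k)}

theorem norm_sq_smul_add_smul_le {E : Type*} [NormedAddCommGroup E] [InnerProductSpace ℝ E]
    (a b : ℝ) (p q : E) :
    ‖a • p + b • q‖ ^ 2 ≤ (a ^ 2 + b ^ 2) * (‖p‖ ^ 2 + ‖q‖ ^ 2) := by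
  have h1 : ‖a • p + b • q‖ ≤ |a| * ‖p‖ + |b| * ‖q‖ := by
    refine (norm_add_le _ _).trans (le_of_eq ?_)
    rw [norm_smul, norm_smul, Real.norm_eq_abs, Real.norm_eq_abs]
  calc ‖a • p + b • q‖ ^ 2 ≤ (|a| * ‖p‖ + |b| * ‖q‖) ^ 2 := by gcongr
    _ ≤ (|a| ^ 2 + |b| ^ 2) * (‖p‖ ^ 2 + ‖q‖ ^ 2) := by
        linarith [sq_nonneg (|a| * ‖q‖ - |b| * ‖p‖)]
    _ = _ := by rw [sq_abs, sq_abs]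

theorem norm_sq_eq_add (x : EuclideanSpace ℝ (Fin 2)) : ‖x‖ ^ 2 = x 0 ^ 2 + x 1 ^ 2 := by
  rw [EuclideanSpace.real_norm_sq_eq, Fin.sum_univ_two]

theorem abs_coord_le_norm (x : EuclideanSpace ℝ (Fin 2)) (i : Fin 2) : |x i| ≤ ‖x‖ :=
  PiLp.norm_apply_le x i

theorem norm_radialDeriv_sq_le : ‖radialDeriv f x‖ ^ 2
    ≤ ‖x‖ ^ 2 * (‖pderiv2 0 f x‖ ^ 2 + ‖pderiv2 1 f x‖ ^ 2) := by
  rw [radialDeriv, Fin.sum_univ_two, norm_sq_eq_add x]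
  exact norm_sq_smul_add_smul_le _ _ _ _

theorem IsNearlyFlat.abs_coeff_sub_density_le (h : IsNearlyFlat L A m x) (i j : Fin 2) :
    |A x i j - m x * (1 : Matrix (Fin 2) (Fin 2) ℝ) i j| ≤ 2 * L * ‖x‖ := by
  have h1 := h.coeff_sub_le i j
  have h2 := h.density_sub_le
  have h3 : |(m x - 1) * (1 : Matrix (Fin 2) (Fin 2) ℝ) i j| ≤ |m x - 1| := by
    rw [abs_mul]
    refine mul_le_of_le_one_right (abs_nonneg _) ?_
    fin_cases i <;> fin_cases j <;> simp
  calc _ = |(A x i j - (1 : Matrix (Fin 2) (Fin 2) ℝ) i j)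
        - (m x - 1) * (1 : Matrix (Fin 2) (Fin 2) ℝ) i j| := by congr 1; ring
    _ ≤ _ := abs_sub _ _
    _ ≤ L * ‖x‖ + L * ‖x‖ := add_le_add h1 (h3.trans h2)
    _ = _ := by ring

/-- For the flat metric this defect is zero. In general it is the matrix A - m·1, of size r, applied
to x, so it is quadratic in r. -/
theorem IsNearlyFlat.norm_defect_sq_le (h : IsNearlyFlat L A m x) :
    ‖covectorPairing (A x) (fun i => x i) f x - m x • radialDeriv f x‖ ^ 2
      ≤ 18 * L ^ 2 * ‖x‖ ^ 4 * (‖pderiv2 0 f x‖ ^ 2 + ‖pderiv2 1 f x‖ ^ 2) := by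
  have h00 := h.abs_coeff_sub_density_le 0 0
  have h01 := h.abs_coeff_sub_density_le 0 1
  have h10 := h.abs_coeff_sub_density_le 1 0
  have h11 := h.abs_coeff_sub_density_le 1 1
  simp at h00 h01 h10 h11
  have key : ∀ a b : ℝ, |a| ≤ 2 * L * ‖x‖ → |b| ≤ 2 * L * ‖x‖ →
      (a * x 0 + b * x 1) ^ 2 ≤ 8 * L ^ 2 * ‖x‖ ^ 4 := by
    intro a b ha hb
    have ha2 : a ^ 2 ≤ (2 * L * ‖x‖) ^ 2 := sq_le_sq' (abs_le.1 ha).1 (abs_le.1 ha).2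
    have hb2 : b ^ 2 ≤ (2 * L * ‖x‖) ^ 2 := sq_le_sq' (abs_le.1 hb).1 (abs_le.1 hb).2
    calc (a * x 0 + b * x 1) ^ 2 ≤ (a ^ 2 + b ^ 2) * (x 0 ^ 2 + x 1 ^ 2) := by
          linarith [sq_nonneg (a * x 1 - b * x 0)]
      _ ≤ ((2 * L * ‖x‖) ^ 2 + (2 * L * ‖x‖) ^ 2) * (x 0 ^ 2 + x 1 ^ 2) := by gcongr
      _ = _ := by rw [← norm_sq_eq_add]; ring
  have e : covectorPairing (A x) (fun i => x i) f x - m x • radialDeriv f x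
      = ((A x 0 0 - m x) * x 0 + A x 1 0 * x 1) • pderiv2 0 f x
        + (A x 0 1 * x 0 + (A x 1 1 - m x) * x 1) • pderiv2 1 f x := by
    simp only [covectorPairing, radialDeriv, Fin.sum_univ_two]
    module
  rw [e]
  refine (norm_sq_smul_add_smul_le _ _ _ _).trans ?_
  have h1 := key _ _ h00 h10
  have h2 := key _ _ h01 h11
  have h3 : 0 ≤ L ^ 2 * ‖x‖ ^ 4 := by positivity
  gcongr
  linarith

/-- This exchanges the Euclidean square |∇f|², which bounds |x·∇f|², for the intrinsic energy
density at first-order cost in r. -/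
theorem IsNearlyFlat.density_mul_le (h : IsNearlyFlat L A m x) :
    m x * (‖pderiv2 0 f x‖ ^ 2 + ‖pderiv2 1 f x‖ ^ 2) ≤ dirichletForm (A x) f x
      + 3 * L * ‖x‖ * (‖pderiv2 0 f x‖ ^ 2 + ‖pderiv2 1 f x‖ ^ 2) := by
  have h00 := h.abs_coeff_sub_density_le 0 0
  have h11 := h.abs_coeff_sub_density_le 1 1
  have h01 := h.coeff_sub_le 0 1
  simp at h00 h11 h01
  set a := ‖pderiv2 0 f x‖ with ha
  set b := ‖pderiv2 1 f x‖ with hb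
  have hip : |(inner ℝ (pderiv2 0 f x) (pderiv2 1 f x) : ℝ)| ≤ a * b := abs_real_inner_le_norm _ _
  have e1 : dirichletForm (A x) f x = A x 0 0 * a ^ 2 + A x 1 1 * b ^ 2
      + 2 * (A x 0 1 * inner ℝ (pderiv2 0 f x) (pderiv2 1 f x)) := by
    simp only [dirichletForm, Fin.sum_univ_two, h.symm, real_inner_self_eq_norm_sq,
      real_inner_comm (pderiv2 0 f x) (pderiv2 1 f x), ← ha, ← hb]
    ring
  have e2 : |A x 0 1 * inner ℝ (pderiv2 0 f x) (pderiv2 1 f x)| ≤ L * ‖x‖ * (a * b) := by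
    rw [abs_mul]
    have : 0 ≤ L * ‖x‖ := (abs_nonneg _).trans h01
    gcongr
  have e3 : -(2 * L * ‖x‖) * a ^ 2 ≤ (A x 0 0 - m x) * a ^ 2 :=
    mul_le_mul_of_nonneg_right (abs_le.1 h00).1 (sq_nonneg _)
  have e4 : -(2 * L * ‖x‖) * b ^ 2 ≤ (A x 1 1 - m x) * b ^ 2 :=
    mul_le_mul_of_nonneg_right (abs_le.1 h11).1 (sq_nonneg _)
  have e5 : L * ‖x‖ * (2 * (a * b)) ≤ L * ‖x‖ * (a ^ 2 + b ^ 2) := by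
    have : 0 ≤ L * ‖x‖ := (abs_nonneg _).trans h01
    gcongr
    linarith [sq_nonneg (a - b)]
  have e6 := (abs_le.1 e2).1
  rw [e1]
  linarith

theorem abs_dirichletForm_le {B : Matrix (Fin 2) (Fin 2) ℝ} {R : ℝ} (hB : ∀ i j, |B i j| ≤ R) :
    |dirichletForm B f x| ≤ 2 * R * (‖pderiv2 0 f x‖ ^ 2 + ‖pderiv2 1 f x‖ ^ 2) := by
  have hR : 0 ≤ R := (abs_nonneg _).trans (hB 0 0)
  have key : ∀ i j, |B i j * inner ℝ (pderiv2 i f x) (pderiv2 j f x)|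
      ≤ R * (1 / 2 * ‖pderiv2 i f x‖ ^ 2 + 1 / 2 * ‖pderiv2 j f x‖ ^ 2) := by
    intro i j
    rw [abs_mul]
    refine mul_le_mul (hB i j) ((abs_real_inner_le_norm _ _).trans ?_) (abs_nonneg _) hR
    linarith [sq_nonneg (‖pderiv2 i f x‖ - ‖pderiv2 j f x‖)]
  rw [dirichletForm]
  simp only [Fin.sum_univ_two]
  refine (abs_add_le _ _).trans ?_
  have h1 := (abs_add_le (B 0 0 * inner ℝ (pderiv2 0 f x) (pderiv2 0 f x))
    (B 0 1 * inner ℝ (pderiv2 0 f x) (pderiv2 1 f x))).trans (add_le_add (key 0 0) (key 0 1))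
  have h2 := (abs_add_le (B 1 0 * inner ℝ (pderiv2 1 f x) (pderiv2 0 f x))
    (B 1 1 * inner ℝ (pderiv2 1 f x) (pderiv2 1 f x))).trans (add_le_add (key 1 0) (key 1 1))
  linarith

theorem IsNearlyFlat.abs_inner_covectorPairing_le (h : IsNearlyFlat L A m x) {q : Fin 2 → ℝ}
    (hq : ∀ i, |q i| ≤ Q) (v : EuclideanSpace ℝ (Fin k)) :
    |inner ℝ (covectorPairing (A x) q f x) v|
      ≤ 2 * L * Q * (‖pderiv2 0 f x‖ ^ 2 + ‖pderiv2 1 f x‖ ^ 2 + ‖v‖ ^ 2) := by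
  have hL0 : 0 ≤ L := (abs_nonneg _).trans (h.coeff_le 0 0)
  have hQ0 : 0 ≤ Q := (abs_nonneg _).trans (hq 0)
  have key : ∀ i j, |A x i j * q i * inner ℝ (pderiv2 j f x) v|
      ≤ L * Q * (1 / 2 * ‖pderiv2 j f x‖ ^ 2 + 1 / 2 * ‖v‖ ^ 2) := by
    intro i j
    rw [abs_mul, abs_mul]
    refine mul_le_mul (mul_le_mul (h.coeff_le i j) (hq i) (abs_nonneg _) hL0)
      ((abs_real_inner_le_norm _ _).trans ?_) (abs_nonneg _) (by positivity)
    linarith [sq_nonneg (‖pderiv2 j f x‖ - ‖v‖)]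
  have e : inner ℝ (covectorPairing (A x) q f x) v
      = (A x 0 0 * q 0 * inner ℝ (pderiv2 0 f x) v + A x 0 1 * q 0 * inner ℝ (pderiv2 1 f x) v)
        + (A x 1 0 * q 1 * inner ℝ (pderiv2 0 f x) v
          + A x 1 1 * q 1 * inner ℝ (pderiv2 1 f x) v) := by
    simp only [covectorPairing, Fin.sum_univ_two, inner_add_left, inner_smul_left,
      RCLike.conj_to_real]
  rw [e]
  refine (abs_add_le _ _).trans ?_
  have h1 := (abs_add_le _ _).trans (add_le_add (key 0 0) (key 0 1))
  have h2 := (abs_add_le _ _).trans (add_le_add (key 1 0) (key 1 1))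
  have h3 : 0 ≤ L * Q * (‖pderiv2 0 f x‖ ^ 2 + ‖pderiv2 1 f x‖ ^ 2) := by positivity
  linarith

theorem covectorPairing_add_smul (B : Matrix (Fin 2) (Fin 2) ℝ) (a b : ℝ) (p q : Fin 2 → ℝ) :
    covectorPairing B (fun i => a * p i + b * q i) f x
      = a • covectorPairing B p f x + b • covectorPairing B q f x := by
  simp only [covectorPairing, Fin.sum_univ_two]
  module

end NearlyFlat

/-! ### Completing the square in the rate -/

section RateIdentity

/-- An expansion in inner products. Replacing v by V = τv - ½Z produces the form -σm|V|² - 4m V·Z -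
½r²e; what distinguishes ZA from mZ, the radial derivative of A and the gradient of the cut-off are
kept as separate errors. -/
theorem rate_identity {E : Type*} [NormedAddCommGroup E] [InnerProductSpace ℝ E] (v Z ZA Gq : E)
    {τ r2 h e σ m θ xq DA : ℝ} (hτ : τ ≠ 0) :
    τ * (1 / 2 * ((2 - σ / 2) * (r2 / (2 * τ ^ 2)) * h) * e - σ * h * (m * ‖v‖ ^ 2)
        - inner ℝ (((2 - σ / 2) * h / τ) • ZA + (σ * θ) • Gq) v
        + (-((2 - σ / 2) * h / τ) * (m * inner ℝ v Z)
          + inner ℝ (((1 + (2 - σ / 2) / 2) * h / τ ^ 2) • ZA + (-((2 - σ / 2) * θ / τ)) • Gq) Z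
          - 1 / 2 * ((1 + (2 - σ / 2) / 2) * h / τ ^ 2 * r2 + -((2 - σ / 2) * θ / τ) * xq) * e
          - 1 / 2 * (-((2 - σ / 2) * h / τ)) * DA))
      = h / τ * (-(1 / 2) * r2 * e - σ * m * ‖τ • v - (1 / 2 : ℝ) • Z‖ ^ 2
          - 4 * m * inner ℝ (τ • v - (1 / 2 : ℝ) • Z) Z
          - (2 - σ / 2) * inner ℝ (τ • v - (1 / 2 : ℝ) • Z) (ZA - m • Z)
          + inner ℝ Z (ZA - m • Z) + 1 / 2 * (2 - σ / 2) * τ * DA)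
        + (-(τ * σ * θ) * inner ℝ Gq v - (2 - σ / 2) * θ * inner ℝ Gq Z
          + 1 / 2 * (2 - σ / 2) * θ * xq * e) := by
  simp only [← real_inner_self_eq_norm_sq, inner_add_left, inner_sub_left, inner_sub_right,
    inner_smul_left, inner_smul_right, RCLike.conj_to_real, real_inner_comm Z v,
    real_inner_comm ZA v, real_inner_comm ZA Z]
  field_simp
  ring

end RateIdentity

/-! ### Pointwise bounds for the rate and the dissipation -/

section RateBound

/-- The dissipation density of the weighted energy, `τ ∂ₜU - ½ x·∇U` being the derivative in
self-similar time. -/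
def dissipationDensity {k : ℕ} (A : EuclideanSpace ℝ (Fin 2) → Matrix (Fin 2) (Fin 2) ℝ)
    (m : EuclideanSpace ℝ (Fin 2) → ℝ) (U : EuclideanSpace ℝ (Fin 2) → ℝ → EuclideanSpace ℝ (Fin k))
    (φ : EuclideanSpace ℝ (Fin 2) → ℝ) (T τ : ℝ) (x : EuclideanSpace ℝ (Fin 2)) : ℝ :=
  gaussCutoff φ τ x * ((‖x‖ ^ 2 / τ + 1) * (m x * ‖τ • deriv (fun s => U x s) (T - τ)
      - (1 / 2 : ℝ) • radialDeriv (fun z => U z (T - τ)) x‖ ^ 2) / τ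
    + ‖x‖ ^ 2 / τ * dirichletForm (A x) (fun z => U z (T - τ)) x)

/-- The full space-time energy density. -/
def totalDensity {k : ℕ} (A : EuclideanSpace ℝ (Fin 2) → Matrix (Fin 2) (Fin 2) ℝ)
    (m : EuclideanSpace ℝ (Fin 2) → ℝ) (U : EuclideanSpace ℝ (Fin 2) → ℝ → EuclideanSpace ℝ (Fin k))
    (t : ℝ) (x : EuclideanSpace ℝ (Fin 2)) : ℝ :=
  dirichletForm (A x) (fun z => U z t) x + m x * ‖deriv (fun s => U x s) t‖ ^ 2

variable {k : ℕ} {L δ c lam T τ : ℝ} {A : EuclideanSpace ℝ (Fin 2) → Matrix (Fin 2) (Fin 2) ℝ}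
  {m : EuclideanSpace ℝ (Fin 2) → ℝ} {x : EuclideanSpace ℝ (Fin 2)}
  {U : EuclideanSpace ℝ (Fin 2) → ℝ → EuclideanSpace ℝ (Fin k)}
  {φ : EuclideanSpace ℝ (Fin 2) → ℝ}

theorem IsNearlyFlat.gradient_le (h : IsNearlyFlat L A m x) (hL : 1 ≤ L)
    (f : EuclideanSpace ℝ (Fin 2) → EuclideanSpace ℝ (Fin k)) :
    ‖pderiv2 0 f x‖ ^ 2 + ‖pderiv2 1 f x‖ ^ 2 ≤ L * dirichletForm (A x) f x := by
  have h1 := mul_le_mul_of_nonneg_left (h.coercive k f) (by linarith : 0 ≤ L)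
  rwa [mul_inv_cancel_left₀ (by linarith : L ≠ 0)] at h1

theorem IsNearlyFlat.dirichletForm_nonneg (h : IsNearlyFlat L A m x) (hL : 1 ≤ L)
    (f : EuclideanSpace ℝ (Fin 2) → EuclideanSpace ℝ (Fin k)) : 0 ≤ dirichletForm (A x) f x :=
  le_trans (by positivity) (h.coercive k f)

theorem IsNearlyFlat.density_pos (h : IsNearlyFlat L A m x) (hL : 1 ≤ L) : 0 < m x :=
  lt_of_lt_of_le (by positivity) h.density_lower

theorem IsNearlyFlat.gradient_add_le (h : IsNearlyFlat L A m x) (hL : 1 ≤ L)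
    (t : ℝ) : ‖pderiv2 0 (fun z => U z t) x‖ ^ 2 + ‖pderiv2 1 (fun z => U z t) x‖ ^ 2
      + ‖deriv (fun s => U x s) t‖ ^ 2 ≤ L * totalDensity A m U t x := by
  have h1 := h.gradient_le hL (fun z => U z t)
  have h2 : ‖deriv (fun s => U x s) t‖ ^ 2 ≤ L * m x * ‖deriv (fun s => U x s) t‖ ^ 2 := by
    refine le_mul_of_one_le_left (sq_nonneg _) ?_
    have := mul_le_mul_of_nonneg_left h.density_lower (by linarith : 0 ≤ L)
    rwa [mul_inv_cancel₀ (by linarith : L ≠ 0)] at this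
  rw [totalDensity]
  linarith

theorem IsNearlyFlat.totalDensity_nonneg (h : IsNearlyFlat L A m x) (hL : 1 ≤ L) (t : ℝ) :
    0 ≤ totalDensity A m U t x :=
  add_nonneg (h.dirichletForm_nonneg hL _)
    (mul_nonneg (h.density_pos hL).le (sq_nonneg _))

theorem IsNearlyFlat.dissipationDensity_nonneg (h : IsNearlyFlat L A m x) (hL : 1 ≤ L)
    (hτ : 0 < τ) : 0 ≤ dissipationDensity A m U φ T τ x := by
  have h1 := h.density_pos hL
  have h2 := h.dirichletForm_nonneg hL (fun z => U z (T - τ))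
  have h3 := gaussCutoff_nonneg (φ := φ) (τ := τ) (x := x)
  rw [dissipationDensity]
  positivity

/-- The rate of change, in self-similar time, as a quadratic expression in `V = τ ∂ₜU - ½ Z`,
`Z = x·∇U` and `W = Aⁱʲ xᵢ ∂ⱼU - m Z`, plus terms supported where the cut-off varies. -/
theorem weightedEnergyRate_eq (hφ : ContDiff ℝ ∞ φ) (hτ : 0 < τ)
    {v Z W Gq : EuclideanSpace ℝ (Fin k)} {Y σ θ : ℝ}
    (hv : v = deriv (fun s => U x s) (T - τ)) (hZ : Z = radialDeriv (fun z => U z (T - τ)) x)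
    (hW : W = covectorPairing (A x) (fun i => x i) (fun z => U z (T - τ)) x - m x • Z)
    (hG : Gq = covectorPairing (A x) (fun i => pderiv2 i (fun z => φ z ^ 2) x)
      (fun z => U z (T - τ)) x)
    (hY : Y = ‖x‖ ^ 2 / τ) (hσ : σ = Y + lam) (hθ : θ = Real.exp (-Y / 4)) :
    τ * weightedEnergyRate A m U (similarityWeight lam T φ) (dilationWeight lam τ φ) (T - τ) x
      = gaussCutoff φ τ x / τ * (-(1 / 2) * ‖x‖ ^ 2 * dirichletForm (A x) (fun z => U z (T - τ)) x
          - σ * m x * ‖τ • v - (1 / 2 : ℝ) • Z‖ ^ 2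
          - 4 * m x * inner ℝ (τ • v - (1 / 2 : ℝ) • Z) Z
          - (2 - σ / 2) * inner ℝ (τ • v - (1 / 2 : ℝ) • Z) W
          + inner ℝ Z W + 1 / 2 * (2 - σ / 2) * τ
            * dirichletForm (Matrix.of fun i j => radialDeriv (fun z => A z i j) x)
              (fun z => U z (T - τ)) x)
        + (-(τ * σ * θ) * inner ℝ Gq v - (2 - σ / 2) * θ * inner ℝ Gq Z
          + 1 / 2 * (2 - σ / 2) * θ * (∑ i, x i * pderiv2 i (fun z => φ z ^ 2) x)
            * dirichletForm (A x) (fun z => U z (T - τ)) x) := by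
  have hTτ : T - (T - τ) = τ := by ring
  have h1 : ∀ i, pderiv2 i (fun z => similarityWeight lam T φ z (T - τ)) x
      = (2 - σ / 2) * gaussCutoff φ τ x / τ * x i + σ * θ * pderiv2 i (fun z => φ z ^ 2) x := by
    intro i
    rw [pderiv2_similarityWeight hφ, hTτ, ← hY, ← hσ, ← hθ]
  have h2 : ∀ i, pderiv2 i (dilationWeight lam τ φ) x
      = (1 + (2 - σ / 2) / 2) * gaussCutoff φ τ x / τ ^ 2 * x i
        + -((2 - σ / 2) * θ / τ) * pderiv2 i (fun z => φ z ^ 2) x := by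
    intro i
    rw [pderiv2_dilationWeight hφ, ← hY, ← hσ, ← hθ]
  have h3 : deriv (fun s => similarityWeight lam T φ x s) (T - τ)
      = (2 - σ / 2) * (‖x‖ ^ 2 / (2 * τ ^ 2)) * gaussCutoff φ τ x := by
    rw [deriv_similarityWeight (by linarith), hTτ, ← hY, ← hσ]
  have h4 : radialDeriv (dilationWeight lam τ φ) x
      = (1 + (2 - σ / 2) / 2) * gaussCutoff φ τ x / τ ^ 2 * ‖x‖ ^ 2
        + -((2 - σ / 2) * θ / τ) * ∑ i, x i * pderiv2 i (fun z => φ z ^ 2) x := by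
    simp only [radialDeriv, h2, Fin.sum_univ_two, norm_sq_eq_add x, smul_eq_mul]
    ring
  have h5 : similarityWeight lam T φ x (T - τ) = σ * gaussCutoff φ τ x := by
    rw [similarityWeight, hTτ, ← hY, ← hσ]
  have h6 : dilationWeight lam τ φ x = -((2 - σ / 2) * gaussCutoff φ τ x / τ) := by
    rw [dilationWeight, ← hY, ← hσ]
  rw [weightedEnergyRate, h3, h4, h5, h6]
  simp only [h1, h2]
  rw [covectorPairing_add_smul, covectorPairing_add_smul, ← hG, ← hv, ← hZ, hW]
  exact rate_identity v Z _ Gq hτ.ne'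

/-- With r² = τY every term contains a factor τ, which cancels the 1/τ in front of the quadratic
form and leaves one power of r times at most (1 + Y)². -/
theorem curvature_error_le {L lam B δ r Y τ : ℝ} (hL : 1 ≤ L) (hlam : 8 < lam) (hB : 0 ≤ B)
    (hr : 0 ≤ r) (hrδ : r ≤ δ) (hY : 0 ≤ Y) (hτ : 0 < τ) (hrY : r ^ 2 = τ * Y) :
    7 * L * r ^ 3 + (Y + lam) * B * r ^ 4 + (Y + lam) * τ * L * r
      ≤ τ * ((7 * L + lam * B * δ + lam * L) * (r * (1 + Y) ^ 2)) := by
  have hσ0 : 0 ≤ Y + lam := by linarith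
  have hσY : Y + lam ≤ lam * (1 + Y) := by
    have := mul_nonneg (by linarith : 0 ≤ lam - 1) hY
    linarith
  have hYY : Y ≤ (1 + Y) ^ 2 := by nlinarith
  have a1 : 7 * L * r ^ 3 ≤ τ * (7 * L * (r * (1 + Y) ^ 2)) := by
    calc 7 * L * r ^ 3 = 7 * L * r * r ^ 2 := by ring
      _ = τ * (7 * L * (r * Y)) := by rw [hrY]; ring
      _ ≤ _ := by gcongr
  have a2 : (Y + lam) * B * r ^ 4 ≤ τ * (lam * B * δ * (r * (1 + Y) ^ 2)) := by
    calc (Y + lam) * B * r ^ 4 = (Y + lam) * B * r * r * r ^ 2 := by ring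
      _ = τ * (B * r * (r * ((Y + lam) * Y))) := by rw [hrY]; ring
      _ ≤ τ * (B * δ * (r * (lam * (1 + Y) * (1 + Y)))) := by
          have : Y ≤ 1 + Y := by linarith
          have : 0 ≤ δ := hr.trans hrδ
          gcongr
      _ = _ := by ring
  have a3 : (Y + lam) * τ * L * r ≤ τ * (lam * L * (r * (1 + Y) ^ 2)) := by
    calc (Y + lam) * τ * L * r ≤ lam * (1 + Y) * τ * L * r := by gcongr
      _ = τ * (lam * L * (r * ((1 + Y) * 1))) := by ring
      _ ≤ τ * (lam * L * (r * ((1 + Y) * (1 + Y)))) := by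
          have : 1 ≤ 1 + Y := by linarith
          gcongr
      _ = _ := by ring
  linarith

/-- All three terms carry σθ and a first derivative of φ², bounded by Q; the Gaussian factor θ is
kept for the smallness where the cut-off varies. -/
theorem cutoff_error_le {L δ Q τ σ θ dens e gv gz xq : ℝ} (hτ : 0 < τ) (hτ1 : τ ≤ 1)
    (hσ : 8 < σ) (hθ : 0 < θ) (he : 0 ≤ e) (hed : e ≤ dens)
    (b1 : |gv| ≤ 2 * L * Q * (L * dens))
    (b2 : |gz| ≤ 2 * L * Q * ((1 + δ ^ 2) * (L * dens))) (b3 : |xq| ≤ 2 * (δ * Q)) :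
    -(τ * σ * θ) * gv - (2 - σ / 2) * θ * gz + 1 / 2 * (2 - σ / 2) * θ * xq * e
      ≤ σ * θ * (Q * (2 * L ^ 2 + 2 * L ^ 2 * (1 + δ ^ 2) + δ)) * dens := by
  have hσ0 : 0 < σ := by linarith
  have hζ : |2 - σ / 2| ≤ σ := by rw [abs_le]; constructor <;> linarith
  have d1 : -(τ * σ * θ) * gv ≤ 1 * σ * θ * (2 * L * Q * (L * dens)) := by
    refine (le_abs_self _).trans ?_
    rw [abs_mul, abs_neg, abs_of_pos (by positivity : 0 < τ * σ * θ)]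
    gcongr
  have d2 : -((2 - σ / 2) * θ * gz) ≤ σ * θ * (2 * L * Q * ((1 + δ ^ 2) * (L * dens))) := by
    refine (neg_le_abs _).trans ?_
    rw [abs_mul, abs_mul, abs_of_pos hθ]
    gcongr
  have d3 : 1 / 2 * (2 - σ / 2) * θ * xq * e ≤ 1 / 2 * σ * θ * (2 * (δ * Q)) * dens := by
    refine (le_abs_self _).trans ?_
    rw [abs_mul, abs_mul, abs_mul, abs_mul, abs_of_pos hθ, abs_of_nonneg he,
      abs_of_pos (by norm_num : (0 : ℝ) < 1 / 2)]
    have := (abs_nonneg _).trans b3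
    gcongr
  linarith

/-- The self-similar rate is bounded by minus the dissipation, up to errors which are integrable
in self-similar time. -/
theorem exists_rate_bound (hδ : 0 < δ) (hlam : 8 < lam) (hL : 1 ≤ L) (c : ℝ) (n : ℕ) :
    ∃ c₀ > 0, ∃ C ≥ 0, ∀ (k : ℕ) (A : EuclideanSpace ℝ (Fin 2) → Matrix (Fin 2) (Fin 2) ℝ)
      (m : EuclideanSpace ℝ (Fin 2) → ℝ)
      (U : EuclideanSpace ℝ (Fin 2) → ℝ → EuclideanSpace ℝ (Fin k))
      (φ : EuclideanSpace ℝ (Fin 2) → ℝ) (x : EuclideanSpace ℝ (Fin 2)) (T s : ℝ), 0 ≤ s →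
      IsCutoff δ c φ → ‖x‖ ≤ δ → IsNearlyFlat L A m x →
      Real.exp (-s) * weightedEnergyRate A m U (similarityWeight lam T φ)
          (dilationWeight lam (Real.exp (-s)) φ) (T - Real.exp (-s)) x
        ≤ -c₀ * dissipationDensity A m U φ T (Real.exp (-s)) x
          + C * Real.exp (-s / 4) * (gaussCutoff φ (Real.exp (-s)) x
            * dirichletForm (A x) (fun z => U z (T - Real.exp (-s))) x)
          + C * Real.exp (-(n * s)) * totalDensity A m U (T - Real.exp (-s)) x := by
  obtain ⟨C₁, hC₁, hw₁⟩ := exists_weight_bound n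
  obtain ⟨C₂, hC₂, hw₂⟩ := exists_weight_bound_away hδ n
  set Q := 2 * (|c| * δ⁻¹) with hQ
  have hQ0 : 0 ≤ Q := by positivity
  set B := 18 * L ^ 3 * lam / (lam - 8) with hB
  have hl8 : 0 < lam - 8 := by linarith
  have hB0 : 0 ≤ B := by rw [hB]; positivity
  set R := 7 * L + lam * B * δ + lam * L with hR
  have hR0 : 0 ≤ R := by rw [hR]; positivity
  set D := Q * (2 * L ^ 2 + 2 * L ^ 2 * (1 + δ ^ 2) + δ) with hD
  have hD0 : 0 ≤ D := by rw [hD]; positivity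
  -- The constant adds the near-origin curvature error R L, its Gaussian tail R L C₁ and the cut-off
  -- error λ C₂ D.
  refine ⟨min (3 / 4) ((lam - 8) / (2 * (lam + 24))), lt_min (by norm_num) (by positivity),
    R * L + R * L * C₁ + lam * C₂ * D, by positivity, ?_⟩
  intro k A m U φ x T s hs hφ hx hA
  set τ := Real.exp (-s) with hτd
  have hτ : 0 < τ := Real.exp_pos _
  have hτ1 : τ ≤ 1 := Real.exp_le_one_iff.2 (by linarith)
  have hτs : τ * Real.exp s = 1 := by
    rw [hτd, ← Real.exp_add, neg_add_cancel, Real.exp_zero]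
  set f : EuclideanSpace ℝ (Fin 2) → EuclideanSpace ℝ (Fin k) := fun z => U z (T - τ) with hf
  set v := deriv (fun s => U x s) (T - τ) with hv
  set Z := radialDeriv f x with hZ
  set W := covectorPairing (A x) (fun i => x i) f x - m x • Z with hW
  set Gq := covectorPairing (A x) (fun i => pderiv2 i (fun z => φ z ^ 2) x) f x with hG
  set Y := ‖x‖ ^ 2 / τ with hY
  set σ := Y + lam with hσ
  set θ := Real.exp (-Y / 4) with hθ
  set h := gaussCutoff φ τ x with hh
  set e := dirichletForm (A x) f x with he
  set V := τ • v - (1 / 2 : ℝ) • Z with hV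
  set r := ‖x‖ with hr
  have hr0 : 0 ≤ r := norm_nonneg x
  have hY0 : 0 ≤ Y := by positivity
  have hYs : Y = r ^ 2 * Real.exp s := by
    rw [hY, div_eq_iff hτ.ne', mul_assoc, mul_comm _ τ, hτs, mul_one]
  have hrY : r ^ 2 = τ * Y := by rw [hY]; field_simp
  have he0 : 0 ≤ e := hA.dirichletForm_nonneg hL f
  have hm0 := hA.density_pos hL
  have hθ0 : 0 < θ := Real.exp_pos _
  have hh0 : 0 ≤ h := gaussCutoff_nonneg
  have hφ0 := hφ.nonneg x
  have hφ1 := hφ.le_one x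
  have hhθ : h = θ * φ x ^ 2 := by rw [hh, gaussCutoff, ← hY, ← neg_div, hθ, neg_div]
  set P := ‖pderiv2 0 f x‖ ^ 2 + ‖pderiv2 1 f x‖ ^ 2 with hP
  have hP0 : 0 ≤ P := by positivity
  have hPe : P ≤ L * e := hA.gradient_le hL f
  set dens := totalDensity A m U (T - τ) x with hdens
  have hdens0 : 0 ≤ dens := hA.totalDensity_nonneg hL _
  have hPd : P + ‖v‖ ^ 2 ≤ L * dens := hA.gradient_add_le hL (T - τ)
  have hed : e ≤ dens := le_add_of_nonneg_right (by positivity)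
  have hZP : ‖Z‖ ^ 2 ≤ r ^ 2 * P := norm_radialDeriv_sq_le
  have hquad := quadratic_rate_le (vz := inner ℝ V Z) (vw := inner ℝ V W) (zw := inner ℝ Z W)
    (B := dirichletForm (Matrix.of fun i j => radialDeriv (fun z => A z i j) x) f x) hlam hL hr0 hτ
    hY0 hA.density_lower hP0 he0 (abs_real_inner_le_norm _ _)
    (abs_real_inner_le_norm _ _) (abs_real_inner_le_norm _ _) hZP hA.norm_defect_sq_le
    hA.density_mul_le ((abs_dirichletForm_le fun i j => hA.radial_le i j).trans (le_of_eq (by ring)))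
  have hid := weightedEnergyRate_eq (A := A) (m := m) (U := U) (x := x) (T := T) (lam := lam)
    hφ.smooth hτ hv hZ hW hG hY hσ hθ
  rw [hid]
  rw [← hσ, ← hB] at hquad
  set cc := min (3 / 4) ((lam - 8) / (2 * (lam + 24))) with hcc
  -- the error coming from the curvature of the metric
  have hσ8 : 8 < σ := lt_of_lt_of_le hlam (le_add_of_nonneg_left hY0)
  -- The Gaussian is separated from φ², so that the e^{-s/4} part keeps the full weight h and the
  -- tail part needs only φ² ≤ 1.
  have herr : h / τ * ((7 * L * r ^ 3 + σ * B * r ^ 4 + σ * τ * L * r) * P)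
      ≤ R * L * (Real.exp (-s / 4) * (h * e) + C₁ * Real.exp (-(n * s)) * e) := by
    have h1 := curvature_error_le hL hlam hB0 hr0 hx hY0 hτ hrY
    rw [← hσ, ← hR] at h1
    have h2 := hw₁ s r Y hs hr0 hYs
    calc h / τ * ((7 * L * r ^ 3 + σ * B * r ^ 4 + σ * τ * L * r) * P)
        ≤ h / τ * (τ * (R * (r * (1 + Y) ^ 2)) * (L * e)) := by gcongr
      _ = R * L * (r * (1 + Y) ^ 2 * θ * (φ x ^ 2 * e)) := by rw [hhθ]; field_simp
      _ ≤ R * L * ((Real.exp (-s / 4) * θ + C₁ * Real.exp (-(n * s))) * (φ x ^ 2 * e)) := by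
          gcongr
      _ = R * L * (Real.exp (-s / 4) * (h * e) + C₁ * Real.exp (-(n * s)) * (φ x ^ 2 * e)) := by
          rw [hhθ]; ring
      _ ≤ R * L * (Real.exp (-s / 4) * (h * e) + C₁ * Real.exp (-(n * s)) * (1 * e)) := by
          gcongr
          exact pow_le_one₀ hφ0 hφ1
      _ = _ := by ring
  -- the error coming from the cut-off
  have hcut : -(τ * σ * θ) * inner ℝ Gq v - (2 - σ / 2) * θ * inner ℝ Gq Z
      + 1 / 2 * (2 - σ / 2) * θ * (∑ i, x i * pderiv2 i (fun z => φ z ^ 2) x) * e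
      ≤ lam * C₂ * D * Real.exp (-(n * s)) * dens := by
    have hR0 : 0 ≤ lam * C₂ * D * Real.exp (-(n * s)) * dens := by positivity
    -- Inside B_{δ/2} the cut-off is constant and the error vanishes; outside, the Gaussian is
    -- smaller than any power of e^{-s}.
    rcases lt_or_ge r (δ / 2) with hrδ | hrδ
    · have hq : ∀ i, pderiv2 i (fun z => φ z ^ 2) x = 0 := hφ.pderiv2_sq_eq_zero hrδ
      have hG0 : Gq = 0 := by simp [hG, covectorPairing, hq]
      simpa [hG0, hq] using hR0
    · have hq : ∀ i, |pderiv2 i (fun z => φ z ^ 2) x| ≤ Q := fun i =>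
        (hφ.abs_pderiv2_sq_le i).trans (by
          rw [hQ]
          have := le_abs_self c
          gcongr)
      have b1 : |inner ℝ Gq v| ≤ 2 * L * Q * (L * dens) :=
        (hA.abs_inner_covectorPairing_le hq v).trans (by gcongr)
      have b2 : |inner ℝ Gq Z| ≤ 2 * L * Q * ((1 + δ ^ 2) * (L * dens)) := by
        refine (hA.abs_inner_covectorPairing_le hq Z).trans ?_
        have hPd' : P ≤ L * dens := le_trans (le_add_of_nonneg_right (sq_nonneg _)) hPd
        have : P + ‖Z‖ ^ 2 ≤ (1 + δ ^ 2) * (L * dens) := by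
          calc P + ‖Z‖ ^ 2 ≤ P + r ^ 2 * P := by gcongr
            _ ≤ P + δ ^ 2 * P := by gcongr
            _ = (1 + δ ^ 2) * P := by ring
            _ ≤ _ := by gcongr
        gcongr
      have b3 : |∑ i, x i * pderiv2 i (fun z => φ z ^ 2) x| ≤ 2 * (δ * Q) := by
        rw [Fin.sum_univ_two]
        refine (abs_add_le _ _).trans ?_
        rw [abs_mul, abs_mul]
        have c0 : |x 0| * |pderiv2 0 (fun z => φ z ^ 2) x| ≤ δ * Q :=
          mul_le_mul ((abs_coord_le_norm x 0).trans hx) (hq 0) (abs_nonneg _) hδ.le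
        have c1 : |x 1| * |pderiv2 1 (fun z => φ z ^ 2) x| ≤ δ * Q :=
          mul_le_mul ((abs_coord_le_norm x 1).trans hx) (hq 1) (abs_nonneg _) hδ.le
        linarith only [c0, c1]
      have h3 : σ ≤ lam * (1 + Y) := by
        have := mul_nonneg (sub_nonneg.2 (by linarith only [hlam] : 1 ≤ lam)) hY0
        linarith only [this, hσ]
      have h2 := hw₂ s r Y hrδ hYs
      calc _ ≤ σ * θ * D * dens := cutoff_error_le hτ hτ1 hσ8 hθ0 he0 hed b1 b2 b3
        _ ≤ lam * (1 + Y) * θ * D * dens := by gcongr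
        _ = lam * ((1 + Y) * θ) * D * dens := by ring
        _ ≤ lam * (C₂ * Real.exp (-(n * s))) * D * dens := by gcongr
        _ = _ := by ring
  have hdiss : dissipationDensity A m U φ T τ x = h / τ * (m x * (Y + 1) * ‖V‖ ^ 2 + r ^ 2 * e) := by
    rw [dissipationDensity, ← hh, ← hr, ← hY, ← hv, ← hf, ← hZ, ← hV, ← he, hrY]
    field_simp
  have hmain := mul_le_mul_of_nonneg_left hquad (div_nonneg hh0 hτ.le)
  have f1 : R * L * (Real.exp (-s / 4) * (h * e)) ≤ (R * L + R * L * C₁ + lam * C₂ * D)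
      * Real.exp (-s / 4) * (h * e) := by
    rw [← mul_assoc]
    gcongr
    have : 0 ≤ R * L * C₁ + lam * C₂ * D := by positivity
    linarith only [this]
  have f2 : R * L * (C₁ * Real.exp (-(n * s)) * e) + lam * C₂ * D * Real.exp (-(n * s)) * dens
      ≤ (R * L + R * L * C₁ + lam * C₂ * D) * Real.exp (-(n * s)) * dens := by
    have g1 : R * L * (C₁ * Real.exp (-(n * s)) * e) ≤ R * L * (C₁ * Real.exp (-(n * s)) * dens) := by
      gcongr
    have g2 : 0 ≤ R * L * Real.exp (-(n * s)) * dens := by positivity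
    linarith only [g1, g2]
  rw [hdiss]
  linarith only [hmain, herr, hcut, f1, f2]

/-- A crude bound of the dissipation, valid for all times. -/
theorem exists_dissipation_bound (hδ : 0 < δ) (hL : 1 ≤ L) (c : ℝ) :
    ∃ C ≥ 0, ∀ (k : ℕ) (A : EuclideanSpace ℝ (Fin 2) → Matrix (Fin 2) (Fin 2) ℝ)
      (m : EuclideanSpace ℝ (Fin 2) → ℝ)
      (U : EuclideanSpace ℝ (Fin 2) → ℝ → EuclideanSpace ℝ (Fin k))
      (φ : EuclideanSpace ℝ (Fin 2) → ℝ) (x : EuclideanSpace ℝ (Fin 2)) (T s : ℝ),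
      IsCutoff δ c φ → ‖x‖ ≤ δ → IsNearlyFlat L A m x →
      dissipationDensity A m U φ T (Real.exp (-s)) x
        ≤ C * (Real.exp (-s) * (m x * ‖deriv (fun s => U x s) (T - Real.exp (-s))‖ ^ 2)
          + Real.exp s * dirichletForm (A x) (fun z => U z (T - Real.exp (-s))) x) := by
  set E := 4 ^ 1 * (1 : ℕ).factorial * Real.exp (1 / 4) with hE
  have hE0 : 0 ≤ E := by rw [hE]; positivity
  refine ⟨2 * E + E * L ^ 2 * δ ^ 2 + δ ^ 2, by positivity, ?_⟩
  intro k A m U φ x T s hφ hx hA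
  set τ := Real.exp (-s) with hτd
  have hτ : 0 < τ := Real.exp_pos _
  have hτs : τ * Real.exp s = 1 := by
    rw [hτd, ← Real.exp_add, neg_add_cancel, Real.exp_zero]
  set f : EuclideanSpace ℝ (Fin 2) → EuclideanSpace ℝ (Fin k) := fun z => U z (T - τ) with hf
  set v := deriv (fun s => U x s) (T - τ) with hv
  set Z := radialDeriv f x with hZ
  set Y := ‖x‖ ^ 2 / τ with hY
  set e := dirichletForm (A x) f x with he
  set r := ‖x‖ with hr
  have hr0 : 0 ≤ r := norm_nonneg x
  have hY0 : 0 ≤ Y := by positivity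
  have hYs : Y = r ^ 2 * Real.exp s := by
    rw [hY, div_eq_iff hτ.ne', mul_assoc, mul_comm _ τ, hτs, mul_one]
  have hYδ : Y ≤ δ ^ 2 * Real.exp s := by rw [hYs]; gcongr
  have hrY : r ^ 2 = τ * Y := by rw [hY]; field_simp
  have he0 : 0 ≤ e := hA.dirichletForm_nonneg hL f
  have hm0 := hA.density_pos hL
  set P := ‖pderiv2 0 f x‖ ^ 2 + ‖pderiv2 1 f x‖ ^ 2 with hP
  have hPe : P ≤ L * e := hA.gradient_le hL f
  have hZP : ‖Z‖ ^ 2 ≤ r ^ 2 * P := norm_radialDeriv_sq_le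
  -- Here |Z|² is bounded by r²|∇U|² = τY|∇U|², so its contribution divided by τ is a power of Y
  -- only, and Y ≤ δ²e^s.
  have hVn : ‖τ • v - (1 / 2 : ℝ) • Z‖ ^ 2 ≤ 2 * τ ^ 2 * ‖v‖ ^ 2 + 1 / 2 * (τ * Y * (L * e)) := by
    have h1 : ‖τ • v - (1 / 2 : ℝ) • Z‖ ≤ τ * ‖v‖ + 1 / 2 * ‖Z‖ := by
      refine (norm_sub_le _ _).trans (le_of_eq ?_)
      rw [norm_smul, norm_smul, Real.norm_eq_abs, Real.norm_eq_abs, abs_of_pos hτ]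
      norm_num
    calc ‖τ • v - (1 / 2 : ℝ) • Z‖ ^ 2 ≤ (τ * ‖v‖ + 1 / 2 * ‖Z‖) ^ 2 := by gcongr
      _ ≤ 2 * τ ^ 2 * ‖v‖ ^ 2 + 1 / 2 * ‖Z‖ ^ 2 := by
          nlinarith [sq_nonneg (τ * ‖v‖ - 1 / 2 * ‖Z‖)]
      _ ≤ 2 * τ ^ 2 * ‖v‖ ^ 2 + 1 / 2 * (r ^ 2 * P) := by gcongr
      _ ≤ 2 * τ ^ 2 * ‖v‖ ^ 2 + 1 / 2 * (r ^ 2 * (L * e)) := by gcongr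
      _ = _ := by rw [hrY]
  have hφ1 : φ x ^ 2 ≤ 1 := pow_le_one₀ (hφ.nonneg x) (hφ.le_one x)
  have hh0 : 0 ≤ gaussCutoff φ τ x := gaussCutoff_nonneg
  have hhE : gaussCutoff φ τ x * (1 + Y) ≤ E := by
    have h1 := one_add_pow_mul_exp_le 1 hY0
    calc gaussCutoff φ τ x * (1 + Y) = ((1 + Y) ^ 1 * Real.exp (-Y / 4)) * φ x ^ 2 := by
          rw [gaussCutoff, ← hY, neg_div]; ring
      _ ≤ E * 1 := by gcongr
      _ = E := mul_one E
  have hh1 : gaussCutoff φ τ x ≤ 1 := by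
    rw [gaussCutoff]
    exact mul_le_one₀ (Real.exp_le_one_iff.2 (by rw [← hY]; linarith)) (sq_nonneg _) hφ1
  have hmL := hA.density_upper
  have key : gaussCutoff φ τ x * ((Y + 1) * (m x * ‖τ • v - (1 / 2 : ℝ) • Z‖ ^ 2) / τ)
      ≤ E * (2 * (τ * (m x * ‖v‖ ^ 2)) + L ^ 2 * δ ^ 2 * (Real.exp s * e)) := by
    calc gaussCutoff φ τ x * ((Y + 1) * (m x * ‖τ • v - (1 / 2 : ℝ) • Z‖ ^ 2) / τ)
        ≤ gaussCutoff φ τ x * ((Y + 1) * (m x *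
          (2 * τ ^ 2 * ‖v‖ ^ 2 + 1 / 2 * (τ * Y * (L * e)))) / τ) := by gcongr
      _ = (gaussCutoff φ τ x * (1 + Y)) * (2 * (τ * (m x * ‖v‖ ^ 2))
          + 1 / 2 * (m x * (Y * (L * e)))) := by field_simp; ring
      _ ≤ E * (2 * (τ * (m x * ‖v‖ ^ 2)) + 1 * (L * (δ ^ 2 * Real.exp s * (L * e)))) := by
          gcongr; norm_num
      _ = _ := by ring
  have key2 : gaussCutoff φ τ x * (Y * e) ≤ 1 * (δ ^ 2 * Real.exp s * e) := by gcongr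
  have p1 : 0 ≤ τ * (m x * ‖v‖ ^ 2) := by positivity
  have p2 : 0 ≤ Real.exp s * e := by positivity
  have p3 : 0 ≤ E * (Real.exp s * e) := by positivity
  have p4 : 0 ≤ (E * L ^ 2 * δ ^ 2 + δ ^ 2) * (τ * (m x * ‖v‖ ^ 2)) := by positivity
  rw [dissipationDensity, ← hr, ← hY, ← hf, ← hv, ← hZ, ← he, mul_add]
  nlinarith

end RateBound

/-! ## Differential inequalities -/

section DifferentialInequality

/-- The derivative of a monotone continuous function is integrable automatically, so the fundamental
theorem of calculus applies to -H'. R is compared with it inside the lower integral and need not be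
measurable; later R is merely chosen for each s. -/
theorem lintegral_Ioc_le_of_hasDerivAt {H H' R : ℝ → ℝ} {a b : ℝ} (hab : a ≤ b)
    (hc : ContinuousOn H (Icc a b)) (hd : ∀ s ∈ Ioc a b, HasDerivAt H (H' s) s)
    (hle : ∀ s ∈ Ioc a b, H' s ≤ -R s) (hR : ∀ s ∈ Ioc a b, 0 ≤ R s) :
    ∫⁻ s in Ioc a b, ENNReal.ofReal (R s) ≤ ENNReal.ofReal (H a - H b) := by
  have hpos : ∀ s ∈ Ioc a b, 0 ≤ -H' s := fun s hs => by linarith [hle s hs, hR s hs]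
  have hd' : ∀ s ∈ Ioo a b, HasDerivAt (fun s => -H s) (-H' s) s := fun s hs =>
    (hd s (Ioo_subset_Ioc_self hs)).fun_neg
  have hi : IntegrableOn (fun s => -H' s) (Ioc a b) :=
    intervalIntegral.integrableOn_deriv_of_nonneg hc.neg hd'
      fun s hs => hpos s (Ioo_subset_Ioc_self hs)
  have h1 : ∫ s in a..b, -H' s = -H b - -H a :=
    intervalIntegral.integral_eq_sub_of_hasDerivAt_of_le hab hc.neg hd'
      ((intervalIntegrable_iff_integrableOn_Ioc_of_le hab).2 hi)
  rw [intervalIntegral.integral_of_le hab] at h1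
  calc ∫⁻ s in Ioc a b, ENNReal.ofReal (R s) ≤ ∫⁻ s in Ioc a b, ENNReal.ofReal (-H' s) :=
        setLIntegral_mono' measurableSet_Ioc fun s hs =>
          ENNReal.ofReal_le_ofReal (by linarith [hle s hs])
    _ = ENNReal.ofReal (∫ s in Ioc a b, -H' s) :=
        (ofReal_integral_eq_lintegral_ofReal hi
          ((ae_restrict_iff' measurableSet_Ioc).2 (Filter.Eventually.of_forall hpos))).symm
    _ = _ := by rw [h1]; congr 1; ring

theorem lintegral_Ioi_le_of_hasDerivAt {H H' R : ℝ → ℝ} {a : ℝ}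
    (hc : ContinuousOn H (Ici a)) (hd : ∀ s ∈ Ioi a, HasDerivAt H (H' s) s)
    (hle : ∀ s ∈ Ioi a, H' s ≤ -R s) (hR : ∀ s ∈ Ioi a, 0 ≤ R s) (hH : ∀ s ∈ Ici a, 0 ≤ H s) :
    ∫⁻ s in Ioi a, ENNReal.ofReal (R s) ≤ ENNReal.ofReal (H a) := by
  have hU : Ioi a = ⋃ n : ℕ, Ioc a (a + n) := by
    ext s
    simp only [mem_Ioi, mem_iUnion, mem_Ioc]
    refine ⟨fun hs => ?_, fun ⟨n, hn⟩ => hn.1⟩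
    obtain ⟨n, hn⟩ := exists_nat_ge (s - a)
    exact ⟨n, hs, by linarith⟩
  have hmono : Monotone fun n : ℕ => Ioc a (a + n) := fun i j hij =>
    Ioc_subset_Ioc_right (by gcongr)
  rw [hU, setLIntegral_iUnion_of_directed _ hmono.directed_le]
  refine iSup_le fun n => ?_
  refine (lintegral_Ioc_le_of_hasDerivAt (b := a + n) (by simp) (hc.mono Icc_subset_Ici_self)
    (fun s hs => hd s hs.1) (fun s hs => hle s hs.1) fun s hs => hR s hs.1).trans ?_
  exact ENNReal.ofReal_le_ofReal (by linarith [hH (a + n) (by simp)])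

/-- The correcting factor absorbing an integrable exponential growth rate. -/
def growthFactor (C s : ℝ) : ℝ := Real.exp (4 * C * Real.exp (-s / 4))

theorem hasDerivAt_growthFactor (C s : ℝ) :
    HasDerivAt (growthFactor C) (-(C * Real.exp (-s / 4)) * growthFactor C s) s := by
  have h1 : HasDerivAt (fun s : ℝ => -s / 4) (-1 / 4) s := ((hasDerivAt_id s).neg).div_const 4
  have h2 : HasDerivAt (growthFactor C) _ s := ((h1.exp).const_mul (4 * C)).exp
  refine h2.congr_deriv ?_
  rw [growthFactor]
  ring

theorem one_le_growthFactor {C : ℝ} (hC : 0 ≤ C) (s : ℝ) : 1 ≤ growthFactor C s :=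
  Real.one_le_exp (by positivity)

theorem antitone_growthFactor {C : ℝ} (hC : 0 ≤ C) : Antitone (growthFactor C) := fun s t hst => by
  rw [growthFactor, growthFactor]
  gcongr

variable {F F' E D R : ℝ → ℝ} {C E₀ a s' : ℝ} {n : ℕ}

/-- The Lyapunov functional of the differential inequality
`F' ≤ -R + C e^{-s/4} F + C e^{-(n+1)s} (2E + D)`, where `E' = -e^{-s} D`. -/
def lyapunov (F E : ℝ → ℝ) (C E₀ : ℝ) (n : ℕ) (s' s : ℝ) : ℝ :=
  F s * growthFactor C s + growthFactor C 0 * C * Real.exp (-(n * s')) * E s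
    + 2 * growthFactor C 0 * C * E₀ * Real.exp (-((n + 1) * s))

/-- The growth factor cancels C e^{-s/4}F. The dissipation D is absorbed by E' = -e^{-s}D, because
e^{-(n+1)s} ≤ e^{-ns'}e^{-s}: one of the n + 1 exponentials is spent here. The term with E ≤ E₀ is
absorbed by the explicit exponential. At s = s' the corrections sum to at most 3 times the same
constant. -/
theorem lyapunov_spec (hC : 0 ≤ C) (hs' : 0 ≤ s')
    (hFc : ContinuousOn F (Ici s')) (hEc : ContinuousOn E (Ici s'))
    (hF0 : ∀ s ∈ Ici s', 0 ≤ F s) (hE0 : ∀ s ∈ Ici s', 0 ≤ E s) (hE1 : ∀ s ∈ Ici s', E s ≤ E₀)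
    (hE : ∀ s ∈ Ioi s', HasDerivAt E (-(Real.exp (-s) * D s)) s) (hD : ∀ s ∈ Ioi s', 0 ≤ D s)
    (hF : ∀ s ∈ Ioi s', HasDerivAt F (F' s) s)
    (hle : ∀ s ∈ Ioi s', F' s ≤ -R s + C * Real.exp (-s / 4) * F s
      + C * Real.exp (-((n + 1 : ℕ) * s)) * (2 * E s + D s)) (hR : ∀ s ∈ Ioi s', 0 ≤ R s) :
    ContinuousOn (lyapunov F E C E₀ n s') (Ici s') ∧
    (∀ s ∈ Ici s', F s ≤ lyapunov F E C E₀ n s' s) ∧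
    lyapunov F E C E₀ n s' s' ≤ growthFactor C s' * F s'
      + 3 * growthFactor C 0 * C * Real.exp (-(n * s')) * E₀ ∧
    ∃ H' : ℝ → ℝ, ∀ s ∈ Ioi s', HasDerivAt (lyapunov F E C E₀ n s') (H' s) s ∧ H' s ≤ -R s := by
  have hg0 := one_le_growthFactor hC 0
  have hE₀ : 0 ≤ E₀ := (hE0 s' self_mem_Ici).trans (hE1 s' self_mem_Ici)
  have hexp : ∀ s, HasDerivAt (fun s : ℝ => Real.exp (-((n + 1) * s)))
      (-((n + 1) * Real.exp (-((n + 1) * s)))) s := by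
    intro s
    have h1 : HasDerivAt (fun s : ℝ => -((n + 1) * s)) (-((n + 1) * 1)) s :=
      ((hasDerivAt_id s).const_mul ((n : ℝ) + 1)).fun_neg
    exact h1.exp.congr_deriv (by ring)
  refine ⟨?_, ?_, ?_, fun s => F' s * growthFactor C s
      + F s * (-(C * Real.exp (-s / 4)) * growthFactor C s)
      + growthFactor C 0 * C * Real.exp (-(n * s')) * (-(Real.exp (-s) * D s))
      + 2 * growthFactor C 0 * C * E₀ * (-((n + 1) * Real.exp (-((n + 1) * s)))), ?_⟩
  · refine ((hFc.mul fun s _ => (hasDerivAt_growthFactor C s).continuousAt.continuousWithinAt).add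
      (continuousOn_const.mul hEc)).add (continuousOn_const.mul fun s _ =>
        (hexp s).continuousAt.continuousWithinAt)
  · intro s hs
    have h1 : F s * 1 ≤ F s * growthFactor C s :=
      mul_le_mul_of_nonneg_left (one_le_growthFactor hC s) (hF0 s hs)
    have h2 : 0 ≤ growthFactor C 0 * C * Real.exp (-(n * s')) * E s := by
      have := hE0 s hs
      positivity
    have h3 : 0 ≤ 2 * growthFactor C 0 * C * E₀ * Real.exp (-((n + 1) * s)) := by positivity
    rw [lyapunov]
    linarith
  · have h1 : growthFactor C 0 * C * Real.exp (-(n * s')) * E s'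
        ≤ growthFactor C 0 * C * Real.exp (-(n * s')) * E₀ := by
      have := hE1 s' self_mem_Ici
      gcongr
    have h2 : 2 * growthFactor C 0 * C * E₀ * Real.exp (-((n + 1) * s'))
        ≤ 2 * growthFactor C 0 * C * E₀ * Real.exp (-(n * s')) := by
      gcongr
      linarith
    rw [lyapunov]
    linarith
  · intro s hs
    have hs0 : s' ≤ s := (mem_Ioi.1 hs).le
    refine ⟨(((hF s hs).mul (hasDerivAt_growthFactor C s)).add ((hE s hs).const_mul _)).add
      ((hexp s).const_mul _), ?_⟩
    have hg1 := one_le_growthFactor hC s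
    have hg : growthFactor C s ≤ growthFactor C 0 := antitone_growthFactor hC (hs'.trans hs0)
    have hDs := hD s hs
    have hEs := hE0 s hs0
    have hEs1 := hE1 s hs0
    have h1 := mul_le_mul_of_nonneg_right (hle s hs) (by linarith : 0 ≤ growthFactor C s)
    have h2 : R s * 1 ≤ R s * growthFactor C s := mul_le_mul_of_nonneg_left hg1 (hR s hs)
    have hcast : Real.exp (-((n + 1 : ℕ) * s)) = Real.exp (-((n + 1) * s)) := by push_cast; rfl
    rw [hcast] at h1
    have h3 : C * Real.exp (-((n + 1) * s)) * (2 * E s + D s) * growthFactor C s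
        ≤ C * Real.exp (-((n + 1) * s)) * (2 * E₀ + D s) * growthFactor C 0 := by gcongr
    have h4 : C * Real.exp (-((n + 1) * s)) * D s * growthFactor C 0
        ≤ C * (Real.exp (-(n * s')) * Real.exp (-s)) * D s * growthFactor C 0 := by
      gcongr
      rw [← Real.exp_add]
      gcongr
      have : (n : ℝ) * s' ≤ n * s := by gcongr
      linarith
    -- Differentiating e^{-(n+1)s} gives the factor n + 1, of which 1 is needed; the rest has a
    -- favourable sign.
    have h5 : 0 ≤ 2 * growthFactor C 0 * C * E₀ * (n * Real.exp (-((n + 1) * s))) := by positivity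
    nlinarith

theorem le_of_lyapunov {s : ℝ} (hC : 0 ≤ C) (hs' : 0 ≤ s') (hs : s' < s)
    (hFc : ContinuousOn F (Ici s')) (hEc : ContinuousOn E (Ici s'))
    (hF0 : ∀ s ∈ Ici s', 0 ≤ F s) (hE0 : ∀ s ∈ Ici s', 0 ≤ E s) (hE1 : ∀ s ∈ Ici s', E s ≤ E₀)
    (hE : ∀ s ∈ Ioi s', HasDerivAt E (-(Real.exp (-s) * D s)) s) (hD : ∀ s ∈ Ioi s', 0 ≤ D s)
    (hF : ∀ s ∈ Ioi s', HasDerivAt F (F' s) s)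
    (hle : ∀ s ∈ Ioi s', F' s ≤ -R s + C * Real.exp (-s / 4) * F s
      + C * Real.exp (-((n + 1 : ℕ) * s)) * (2 * E s + D s)) (hR : ∀ s ∈ Ioi s', 0 ≤ R s) :
    F s ≤ growthFactor C s' * F s' + 3 * growthFactor C 0 * C * Real.exp (-(n * s')) * E₀ := by
  obtain ⟨h1, h2, h3, H', h4⟩ := lyapunov_spec hC hs' hFc hEc hF0 hE0 hE1 hE hD hF hle hR
  have hanti : AntitoneOn (lyapunov F E C E₀ n s') (Ici s') := by
    refine antitoneOn_of_deriv_nonpos (convex_Ici s') h1 (fun t ht => ?_) fun t ht => ?_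
    · rw [interior_Ici] at ht
      exact (h4 t ht).1.differentiableAt.differentiableWithinAt
    · rw [interior_Ici] at ht
      rw [(h4 t ht).1.deriv]
      linarith [(h4 t ht).2, hR t ht]
  exact (h2 s hs.le).trans ((hanti self_mem_Ici hs.le hs.le).trans h3)

theorem lintegral_le_of_lyapunov (hC : 0 ≤ C) (hs' : 0 ≤ s')
    (hFc : ContinuousOn F (Ici s')) (hEc : ContinuousOn E (Ici s'))
    (hF0 : ∀ s ∈ Ici s', 0 ≤ F s) (hE0 : ∀ s ∈ Ici s', 0 ≤ E s) (hE1 : ∀ s ∈ Ici s', E s ≤ E₀)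
    (hE : ∀ s ∈ Ioi s', HasDerivAt E (-(Real.exp (-s) * D s)) s) (hD : ∀ s ∈ Ioi s', 0 ≤ D s)
    (hF : ∀ s ∈ Ioi s', HasDerivAt F (F' s) s)
    (hle : ∀ s ∈ Ioi s', F' s ≤ -R s + C * Real.exp (-s / 4) * F s
      + C * Real.exp (-((n + 1 : ℕ) * s)) * (2 * E s + D s)) (hR : ∀ s ∈ Ioi s', 0 ≤ R s) :
    ∫⁻ s in Ioi s', ENNReal.ofReal (R s) ≤ ENNReal.ofReal
      (growthFactor C 0 * F s' + 3 * growthFactor C 0 * C * E₀) := by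
  obtain ⟨h1, h2, h3, H', h4⟩ := lyapunov_spec hC hs' hFc hEc hF0 hE0 hE1 hE hD hF hle hR
  refine (lintegral_Ioi_le_of_hasDerivAt h1 (fun s hs => (h4 s hs).1) (fun s hs => (h4 s hs).2) hR
    fun s hs => (hF0 s hs).trans (h2 s hs)).trans (ENNReal.ofReal_le_ofReal (h3.trans ?_))
  have hg0 := one_le_growthFactor hC 0
  have hE₀ : 0 ≤ E₀ := (hE0 s' self_mem_Ici).trans (hE1 s' self_mem_Ici)
  have hF' := hF0 s' self_mem_Ici
  have h5 : Real.exp (-(n * s')) ≤ 1 := Real.exp_le_one_iff.2 (by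
    have : (0 : ℝ) ≤ n * s' := by positivity
    linarith)
  have h6 : growthFactor C s' ≤ growthFactor C 0 := antitone_growthFactor hC hs'
  calc growthFactor C s' * F s' + 3 * growthFactor C 0 * C * Real.exp (-(n * s')) * E₀
      ≤ growthFactor C 0 * F s' + 3 * growthFactor C 0 * C * 1 * E₀ := by gcongr
    _ = _ := by ring

end DifferentialInequality

/-! ## The weighted energy in self-similar time -/

section SelfSimilar

set_option linter.unusedSectionVars false

theorem weightedEnergyRate_eq_zero {k : ℕ} {K : Set (EuclideanSpace ℝ (Fin 2))} {T : ℝ}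
    {A : EuclideanSpace ℝ (Fin 2) → Matrix (Fin 2) (Fin 2) ℝ} {m : EuclideanSpace ℝ (Fin 2) → ℝ}
    {U : EuclideanSpace ℝ (Fin 2) → ℝ → EuclideanSpace ℝ (Fin k)}
    {ψ : EuclideanSpace ℝ (Fin 2) → ℝ → ℝ} {η : EuclideanSpace ℝ (Fin 2) → ℝ} (hK : IsClosed K)
    (hψ0 : ∀ x ∉ K, ∀ t ∈ Ioo 0 T, ψ x t = 0) (hη0 : ∀ x ∉ K, η x = 0) {t : ℝ} (ht : t ∈ Ioo 0 T)
    {x : EuclideanSpace ℝ (Fin 2)} (hx : x ∉ K) : weightedEnergyRate A m U ψ η t x = 0 := by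
  have e3 : ∀ i, pderiv2 i (fun z => ψ z t) x = 0 := fun i =>
    pderiv2_eq_zero_of_support hK (fun z hz => hψ0 z hz t ht) hx i
  have e4 : ∀ i, pderiv2 i η x = 0 := fun i => pderiv2_eq_zero_of_support hK hη0 hx i
  have e5 : deriv (fun s => ψ x s) t = 0 := by
    have : (fun s => ψ x s) =ᶠ[𝓝 t] fun _ => 0 := by
      filter_upwards [isOpen_Ioo.mem_nhds ht] with s hs using hψ0 x hx s hs
    rw [this.deriv_eq]; simp
  simp [weightedEnergyRate, e3, e4, e5, covectorPairing, hψ0 x hx t ht, hη0 x hx, radialDeriv]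

variable {M : Type*} [TopologicalSpace M] [ChartedSpace (EuclideanSpace ℝ (Fin 2)) M]
  [IsManifold (𝓡 2) ∞ M]

/-- The weighted energy `½ ∫ (|x|²/τ + λ) e^{-|x|²/(4τ)} φ² |∇u|² dV_g` at time `T - τ`, where
`τ = e^{-s}`. -/
def selfSimilarEnergy {k : ℕ} (lam T : ℝ) (g : SurfaceMetric M)
    (e : OpenPartialHomeomorph M (EuclideanSpace ℝ (Fin 2))) (φ : EuclideanSpace ℝ (Fin 2) → ℝ)
    (u : M → ℝ → EuclideanSpace ℝ (Fin k)) (s : ℝ) : ℝ :=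
  1 / 2 * ∫ x, similarityWeight lam T φ x (T - Real.exp (-s))
    * dirichletForm (conformalCoeff g e x) (fun z => u (e.symm z) (T - Real.exp (-s))) x

variable {g : SurfaceMetric M} {e : OpenPartialHomeomorph M (EuclideanSpace ℝ (Fin 2))}
  {k : ℕ} {N : Set (EuclideanSpace ℝ (Fin k))} {T : ℝ} {u : M → ℝ → EuclideanSpace ℝ (Fin k)}
  {δ K c lam : ℝ} {p₀ : M} {φ : EuclideanSpace ℝ (Fin 2) → ℝ}

theorem IsCutoff.gaussCutoff_eq_zero (hφ : IsCutoff δ c φ) {x : EuclideanSpace ℝ (Fin 2)}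
    (hx : x ∉ Metric.closedBall (0 : EuclideanSpace ℝ (Fin 2)) δ) (τ : ℝ) :
    gaussCutoff φ τ x = 0 := by
  simp [gaussCutoff, hφ.eq_zero x hx]

theorem IsCutoff.similarityWeight_eq_zero (hφ : IsCutoff δ c φ) {x : EuclideanSpace ℝ (Fin 2)}
    (hx : x ∉ Metric.closedBall (0 : EuclideanSpace ℝ (Fin 2)) δ) (t : ℝ) :
    similarityWeight lam T φ x t = 0 := by
  simp [similarityWeight, hφ.gaussCutoff_eq_zero hx]

theorem IsCutoff.dilationWeight_eq_zero (hφ : IsCutoff δ c φ) {x : EuclideanSpace ℝ (Fin 2)}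
    (hx : x ∉ Metric.closedBall (0 : EuclideanSpace ℝ (Fin 2)) δ) (τ : ℝ) :
    dilationWeight lam τ φ x = 0 := by
  simp [dilationWeight, hφ.gaussCutoff_eq_zero hx]

theorem time_mem_Ioo {s : ℝ} (hT : 0 < T) (hs : -Real.log T < s) : T - Real.exp (-s) ∈ Ioo 0 T := by
  have h1 : Real.exp (-s) < T := (Real.lt_log_iff_exp_lt hT).1 (by linarith)
  have h2 := Real.exp_pos (-s)
  constructor <;> linarith

theorem time_mem_Ico {s : ℝ} (hT : 0 < T) (hs : -Real.log T ≤ s) : T - Real.exp (-s) ∈ Ico 0 T := by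
  have h1 : Real.exp (-s) ≤ T := (Real.le_log_iff_exp_le hT).1 (by linarith)
  have h2 := Real.exp_pos (-s)
  constructor <;> linarith

theorem hasDerivAt_time (T s : ℝ) :
    HasDerivAt (fun s => T - Real.exp (-s)) (Real.exp (-s)) s := by
  have h1 : HasDerivAt (fun s : ℝ => -s) (-1) s := (hasDerivAt_id s).fun_neg
  exact (h1.exp.const_sub T).congr_deriv (by ring)

theorem IsHarmonicHeatFlow.continuousOn_chart_form (hu : IsHarmonicHeatFlow g N T u)
    (he : e ∈ IsManifold.maximalAtlas (𝓡 2) ∞ M) {t : ℝ} (ht : t ∈ Ico 0 T) :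
    ContinuousOn (fun x => dirichletForm (conformalCoeff g e x) (fun z => u (e.symm z) t) x)
      e.target :=
  (hu.isPatchFlow he).continuousOn_dirichletForm.comp (f := fun x => (x, t)) (by fun_prop)
    fun x hx => ⟨hx, ht⟩

theorem IsHarmonicHeatFlow.continuousOn_chart_deriv (hu : IsHarmonicHeatFlow g N T u)
    (he : e ∈ IsManifold.maximalAtlas (𝓡 2) ∞ M) {t : ℝ} (ht : t ∈ Ioo 0 T) :
    ContinuousOn (fun x => volumeDensity g e x * ‖deriv (fun s => u (e.symm x) s) t‖ ^ 2)
      e.target := by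
  have hvs : ContDiffOn ℝ ∞ (fun z => deriv (fun s => u (e.symm z) s) t) e.target :=
    contDiffOn_slice (J := Ioo 0 T) (U := fun z t => deriv (fun s => u (e.symm z) s) t)
      (contDiffOn_deriv_slice (U := fun x t => u (e.symm x) t) e.open_target isOpen_Ioo
        (hu.isPatchFlow he).smooth_Ioo) ht
  exact (contDiffOn_volumeDensity he).continuousOn.mul (hvs.continuousOn.norm.pow 2)

theorem continuous_gaussCutoff (hφ : IsCutoff δ c φ) (τ : ℝ) : Continuous (gaussCutoff φ τ) := by
  have := hφ.smooth.continuous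
  unfold gaussCutoff
  fun_prop

theorem IsHarmonicHeatFlow.integrable_weight_mul (hu : IsHarmonicHeatFlow g N T u)
    (hch : IsNormalizedChart g δ K p₀ e) (hφ : IsCutoff δ c φ) {t : ℝ} (ht : t ∈ Ico 0 T)
    {χ : EuclideanSpace ℝ (Fin 2) → ℝ} (hχ : Continuous χ) (τ : ℝ) :
    Integrable (fun x => χ x * (gaussCutoff φ τ x
      * dirichletForm (conformalCoeff g e x) (fun z => u (e.symm z) t) x)) :=
  integrable_of_support (isCompact_closedBall _ _) hch.ball_subset
    (hχ.continuousOn.mul ((continuous_gaussCutoff hφ τ).continuousOn.mul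
      (hu.continuousOn_chart_form hch.mem_atlas ht)))
    fun x hx => by simp [hφ.gaussCutoff_eq_zero hx]

theorem IsHarmonicHeatFlow.continuousOn_selfSimilarEnergy (hu : IsHarmonicHeatFlow g N T u)
    (hT : 0 < T) (hch : IsNormalizedChart g δ K p₀ e) (hφ : IsCutoff δ c φ) :
    ContinuousOn (selfSimilarEnergy lam T g e φ u) (Ici (-Real.log T)) := by
  have h := (hu.isPatchFlow hch.mem_atlas).continuousOn_weightedEnergy (isCompact_closedBall 0 δ)
    hch.ball_subset (ψ := similarityWeight lam T φ)
    ((contDiffOn_similarityWeight hφ.smooth e.target).continuousOn.mono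
      (prod_mono le_rfl fun t ht => ht.2)) (fun x hx t _ => hφ.similarityWeight_eq_zero hx t)
  exact h.comp (f := fun s => T - Real.exp (-s)) (by fun_prop) fun s hs => time_mem_Ico hT hs

variable [T2Space M] [CompactSpace M] [MeasurableSpace M] [BorelSpace M]

/-- The total dissipation at self-similar time `s`. -/
def flowDissipation (g : SurfaceMetric M) (T : ℝ) (u : M → ℝ → EuclideanSpace ℝ (Fin k)) (s : ℝ) :
    ℝ :=
  ∫ p, ‖deriv (fun s => u p s) (T - Real.exp (-s))‖ ^ 2 ∂(surfaceVolume g)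

theorem flowDissipation_nonneg (s : ℝ) : 0 ≤ flowDissipation g T u s :=
  integral_nonneg fun p => by positivity

theorem IsHarmonicHeatFlow.hasDerivAt_energy_time (hu : IsHarmonicHeatFlow g N T u) (hT : 0 < T)
    {s : ℝ} (hs : -Real.log T < s) :
    HasDerivAt (fun s => dirichletEnergy g (fun p => u p (T - Real.exp (-s))))
      (-(Real.exp (-s) * flowDissipation g T u s)) s := by
  have h := (hu.energy_identity.2.2 _ (time_mem_Ioo hT hs)).2
  have h2 := HasDerivAt.comp (h₂ := fun t => dirichletEnergy g (fun p => u p t)) s h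
    (hasDerivAt_time T s)
  refine h2.congr_deriv ?_
  rw [neg_mul, mul_comm]
  rfl

theorem IsHarmonicHeatFlow.continuousOn_energy_time (hu : IsHarmonicHeatFlow g N T u) (hT : 0 < T) :
    ContinuousOn (fun s => dirichletEnergy g (fun p => u p (T - Real.exp (-s))))
      (Ici (-Real.log T)) :=
  hu.energy_identity.2.1.comp (f := fun s => T - Real.exp (-s)) (by fun_prop)
    fun s hs => time_mem_Ico hT hs

theorem IsHarmonicHeatFlow.energy_time_le (hu : IsHarmonicHeatFlow g N T u) (hT : 0 < T)
    {s : ℝ} (hs : -Real.log T ≤ s) : dirichletEnergy g (fun p => u p (T - Real.exp (-s)))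
      ≤ dirichletEnergy g (fun p => u p 0) :=
  hu.antitoneOn_energy ⟨le_rfl, hT⟩ (time_mem_Ico hT hs) (time_mem_Ico hT hs).1

theorem IsNormalizedChart.dirichletForm_nonneg (hch : IsNormalizedChart g δ K p₀ e) (hδ : 0 < δ)
    {x : EuclideanSpace ℝ (Fin 2)} (hx : x ∈ Metric.closedBall (0 : EuclideanSpace ℝ (Fin 2)) δ)
    (f : EuclideanSpace ℝ (Fin 2) → EuclideanSpace ℝ (Fin k)) :
    0 ≤ dirichletForm (conformalCoeff g e x) f x := by
  have hK := hch.one_le hδ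
  exact (hch.isNearlyFlat hδ hx).dirichletForm_nonneg (by nlinarith [one_le_pow₀ hK (n := 6)]) f

theorem selfSimilarEnergy_nonneg (hδ : 0 < δ) (hlam : 0 ≤ lam)
    (hch : IsNormalizedChart g δ K p₀ e) (hφ : IsCutoff δ c φ) (s : ℝ) :
    0 ≤ selfSimilarEnergy lam T g e φ u s := by
  refine mul_nonneg (by norm_num) (integral_nonneg fun x => ?_)
  by_cases hx : x ∈ Metric.closedBall (0 : EuclideanSpace ℝ (Fin 2)) δ
  · refine mul_nonneg (mul_nonneg ?_ gaussCutoff_nonneg) (hch.dirichletForm_nonneg hδ hx _)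
    rw [sub_sub_cancel]
    positivity
  · simp [hφ.similarityWeight_eq_zero hx]

theorem selfSimilarEnergy_eq (s : ℝ) : selfSimilarEnergy lam T g e φ u s
    = 1 / 2 * ∫ x, (‖x‖ ^ 2 / Real.exp (-s) + lam) * (gaussCutoff φ (Real.exp (-s)) x
      * dirichletForm (conformalCoeff g e x) (fun z => u (e.symm z) (T - Real.exp (-s))) x) := by
  simp only [selfSimilarEnergy, similarityWeight, sub_sub_cancel, mul_assoc]

/-- For λ ≥ 2 the weight ½(Y + λ) is at least 1; this turns the e^{-s/4} error into a multiple of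
the functional itself. -/
theorem IsHarmonicHeatFlow.integral_gaussCutoff_le (hu : IsHarmonicHeatFlow g N T u) (hT : 0 < T)
    (hδ : 0 < δ) (hlam : 2 ≤ lam) (hch : IsNormalizedChart g δ K p₀ e) (hφ : IsCutoff δ c φ) {s : ℝ}
    (hs : -Real.log T ≤ s) :
    ∫ x, gaussCutoff φ (Real.exp (-s)) x
      * dirichletForm (conformalCoeff g e x) (fun z => u (e.symm z) (T - Real.exp (-s))) x
      ≤ selfSimilarEnergy lam T g e φ u s := by
  have ht := time_mem_Ico hT hs
  rw [selfSimilarEnergy_eq, ← integral_const_mul]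
  have h1 := hu.integrable_weight_mul hch hφ ht (χ := fun _ => 1) continuous_const (Real.exp (-s))
  have h2 := hu.integrable_weight_mul hch hφ ht (χ := fun x => ‖x‖ ^ 2 / Real.exp (-s) + lam)
    (by fun_prop) (Real.exp (-s))
  simp only [one_mul] at h1
  refine integral_mono h1 (h2.const_mul _) fun x => ?_
  by_cases hx : x ∈ Metric.closedBall (0 : EuclideanSpace ℝ (Fin 2)) δ
  · have h3 := mul_nonneg (gaussCutoff_nonneg (φ := φ) (τ := Real.exp (-s)) (x := x))
      (hch.dirichletForm_nonneg hδ hx (fun z => u (e.symm z) (T - Real.exp (-s))))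
    have h4 : (0 : ℝ) ≤ ‖x‖ ^ 2 / Real.exp (-s) := by positivity
    have h5 := mul_nonneg h4 h3
    have h6 := mul_nonneg (by linarith : 0 ≤ lam - 2) h3
    simp only
    linarith
  · simp [hφ.gaussCutoff_eq_zero hx]

/-- The weight (Y + λ)e^{-Y/4} is bounded, so the functional is controlled by the global energy at
every time. This supplies the starting value for the space-time bound. -/
theorem IsHarmonicHeatFlow.selfSimilarEnergy_le (hu : IsHarmonicHeatFlow g N T u) (hT : 0 < T)
    (hδ : 0 < δ) (hlam : 1 ≤ lam) (hch : IsNormalizedChart g δ K p₀ e) (hφ : IsCutoff δ c φ) {s : ℝ}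
    (hs : -Real.log T ≤ s) :
    selfSimilarEnergy lam T g e φ u s
      ≤ lam * (4 ^ 1 * (1 : ℕ).factorial * Real.exp (1 / 4))
        * dirichletEnergy g (fun p => u p 0) := by
  have ht := time_mem_Ico hT hs
  have hi := hu.setIntegral_dirichletForm_le hch.mem_atlas (isCompact_closedBall 0 δ)
    hch.ball_subset ht
  have hE := hu.energy_time_le hT hs
  set B := 4 ^ 1 * (1 : ℕ).factorial * Real.exp (1 / 4) with hB
  have hB0 : 0 ≤ B := by rw [hB]; positivity
  set ef := fun x => dirichletForm (conformalCoeff g e x)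
    (fun z => u (e.symm z) (T - Real.exp (-s))) x with hef
  have hint : IntegrableOn ef (Metric.closedBall 0 δ) :=
    ((hu.continuousOn_chart_form hch.mem_atlas ht).mono hch.ball_subset).integrableOn_compact
      (isCompact_closedBall _ _)
  have h2 := hu.integrable_weight_mul hch hφ ht (χ := fun x => ‖x‖ ^ 2 / Real.exp (-s) + lam)
    (by fun_prop) (Real.exp (-s))
  have h3 : ∫ x, (‖x‖ ^ 2 / Real.exp (-s) + lam) * (gaussCutoff φ (Real.exp (-s)) x * ef x)
      ≤ ∫ x, (Metric.closedBall 0 δ).indicator (fun x => lam * B * ef x) x := by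
    refine integral_mono h2
      ((integrable_indicator_iff measurableSet_closedBall).2 (hint.const_mul _)) fun x => ?_
    by_cases hx : x ∈ Metric.closedBall (0 : EuclideanSpace ℝ (Fin 2)) δ
    · rw [indicator_of_mem hx]
      have h4 : (0 : ℝ) ≤ ‖x‖ ^ 2 / Real.exp (-s) := by positivity
      have h5 := one_add_pow_mul_exp_le 1 h4
      rw [← hB, pow_one] at h5
      have h6 := hch.dirichletForm_nonneg hδ hx (fun z => u (e.symm z) (T - Real.exp (-s)))
      have h7 : φ x ^ 2 ≤ 1 := pow_le_one₀ (hφ.nonneg x) (hφ.le_one x)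
      have h8 : ‖x‖ ^ 2 / Real.exp (-s) + lam ≤ lam * (1 + ‖x‖ ^ 2 / Real.exp (-s)) := by
        have := mul_nonneg (sub_nonneg.2 hlam) h4
        linarith
      calc (‖x‖ ^ 2 / Real.exp (-s) + lam) * (gaussCutoff φ (Real.exp (-s)) x * ef x)
          ≤ lam * (1 + ‖x‖ ^ 2 / Real.exp (-s)) * (gaussCutoff φ (Real.exp (-s)) x * ef x) :=
            mul_le_mul_of_nonneg_right h8 (mul_nonneg gaussCutoff_nonneg h6)
        _ = lam * ((1 + ‖x‖ ^ 2 / Real.exp (-s))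
            * Real.exp (-(‖x‖ ^ 2 / Real.exp (-s)) / 4)) * φ x ^ 2 * ef x := by
            rw [gaussCutoff]; ring
        _ ≤ lam * B * 1 * ef x := by gcongr
        _ = lam * B * ef x := by ring
    · simp [hφ.gaussCutoff_eq_zero hx, indicator_of_notMem hx]
  rw [integral_indicator measurableSet_closedBall, integral_const_mul] at h3
  rw [selfSimilarEnergy_eq]
  have h9 : lam * B * ∫ x in Metric.closedBall 0 δ, ef x
      ≤ lam * B * (2 * dirichletEnergy g (fun p => u p 0)) := by
    have : 0 ≤ lam := by linarith
    gcongr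
    linarith
  linarith

theorem IsHarmonicHeatFlow.setIntegral_totalDensity_le (hu : IsHarmonicHeatFlow g N T u)
    (hT : 0 < T) (hch : IsNormalizedChart g δ K p₀ e) {s : ℝ} (hs : -Real.log T < s) :
    IntegrableOn (totalDensity (conformalCoeff g e) (volumeDensity g e)
      (fun x t => u (e.symm x) t) (T - Real.exp (-s))) (Metric.closedBall 0 δ) ∧
    ∫ x in Metric.closedBall 0 δ, totalDensity (conformalCoeff g e) (volumeDensity g e)
      (fun x t => u (e.symm x) t) (T - Real.exp (-s)) x
      ≤ 2 * dirichletEnergy g (fun p => u p (T - Real.exp (-s))) + flowDissipation g T u s := by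
  have ht := time_mem_Ioo hT hs
  have hB : IsCompact (Metric.closedBall (0 : EuclideanSpace ℝ (Fin 2)) δ) :=
    isCompact_closedBall _ _
  have i1 := ((hu.continuousOn_chart_form hch.mem_atlas (Ioo_subset_Ico_self ht)).mono
    hch.ball_subset).integrableOn_compact (μ := volume) hB
  have i2 := ((hu.continuousOn_chart_deriv hch.mem_atlas ht).mono
    hch.ball_subset).integrableOn_compact (μ := volume) hB
  refine ⟨i1.add i2, ?_⟩
  simp only [totalDensity]
  rw [integral_add i1 i2]
  exact add_le_add (hu.setIntegral_dirichletForm_le hch.mem_atlas hB hch.ball_subset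
    (Ioo_subset_Ico_self ht)) (hu.setIntegral_deriv_le hch.mem_atlas hB hch.ball_subset ht)

/-- Integrated form of the pointwise rate estimate. -/
theorem IsHarmonicHeatFlow.selfSimilarEnergy_rate (hu : IsHarmonicHeatFlow g N T u) (hT : 0 < T)
    (hδ : 0 < δ) (hlam : 2 ≤ lam) (hch : IsNormalizedChart g δ K p₀ e) (hφ : IsCutoff δ c φ)
    {s c₀ C κ : ℝ} (hc₀ : 0 < c₀) (hC : 0 ≤ C) (hs : -Real.log T < s)
    (hrate : ∀ x : EuclideanSpace ℝ (Fin 2), ‖x‖ ≤ δ →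
      Real.exp (-s) * weightedEnergyRate (conformalCoeff g e) (volumeDensity g e)
          (fun x t => u (e.symm x) t) (similarityWeight lam T φ)
          (dilationWeight lam (Real.exp (-s)) φ) (T - Real.exp (-s)) x
        ≤ -c₀ * dissipationDensity (conformalCoeff g e) (volumeDensity g e)
            (fun x t => u (e.symm x) t) φ T (Real.exp (-s)) x
          + C * Real.exp (-s / 4) * (gaussCutoff φ (Real.exp (-s)) x
            * dirichletForm (conformalCoeff g e x) (fun z => u (e.symm z) (T - Real.exp (-s))) x)
          + C * κ * totalDensity (conformalCoeff g e) (volumeDensity g e)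
            (fun x t => u (e.symm x) t) (T - Real.exp (-s)) x) (hκ : 0 ≤ κ) :
    ∃ F' R : ℝ, HasDerivAt (selfSimilarEnergy lam T g e φ u) F' s ∧ 0 ≤ R ∧
      ∫⁻ x, ENNReal.ofReal (c₀ * dissipationDensity (conformalCoeff g e) (volumeDensity g e)
        (fun x t => u (e.symm x) t) φ T (Real.exp (-s)) x) ≤ ENNReal.ofReal R ∧
      F' ≤ -R + C * Real.exp (-s / 4) * selfSimilarEnergy lam T g e φ u s
        + C * κ * (2 * dirichletEnergy g (fun p => u p (T - Real.exp (-s)))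
          + flowDissipation g T u s) := by
  have ht := time_mem_Ioo hT hs
  set τ := Real.exp (-s) with hτd
  have hτ : 0 < τ := Real.exp_pos _
  set A := conformalCoeff g e with hA
  set m := volumeDensity g e with hm
  set U : EuclideanSpace ℝ (Fin 2) → ℝ → EuclideanSpace ℝ (Fin k) := fun x t => u (e.symm x) t
    with hU
  set B := Metric.closedBall (0 : EuclideanSpace ℝ (Fin 2)) δ with hB
  have hBc : IsCompact B := isCompact_closedBall _ _
  have hK := hch.one_le hδ
  have hψ0 : ∀ x ∉ B, ∀ t ∈ Ioo 0 T, similarityWeight lam T φ x t = 0 :=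
    fun x hx t _ => hφ.similarityWeight_eq_zero hx t
  have hη0 : ∀ x ∉ B, dilationWeight lam τ φ x = 0 := fun x hx => hφ.dilationWeight_eq_zero hx τ
  obtain ⟨i1, hd⟩ := (hu.isPatchFlow hch.mem_atlas).hasDerivAt_weightedEnergy hBc hch.ball_subset
    ((contDiffOn_similarityWeight (lam := lam) hφ.smooth e.target).mono
      (prod_mono le_rfl fun t ht => ht.2)) hψ0
    (contDiff_dilationWeight (lam := lam) (τ := τ) hφ.smooth).contDiffOn hη0 ht
  have i2 := hu.integrable_weight_mul hch hφ (Ioo_subset_Ico_self ht) (χ := fun _ => 1)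
    continuous_const τ
  simp only [one_mul] at i2
  obtain ⟨j3, h3⟩ := hu.setIntegral_totalDensity_le hT hch hs
  have i3 := (integrable_indicator_iff (measurableSet_closedBall (x := (0 :
    EuclideanSpace ℝ (Fin 2))) (ε := δ))).2 j3
  set S := weightedEnergyRate A m U (similarityWeight lam T φ) (dilationWeight lam τ φ) (T - τ)
    with hS
  set h := fun x => gaussCutoff φ τ x * dirichletForm (A x) (fun z => U z (T - τ)) x with hh
  set d := fun x => B.indicator (totalDensity A m U (T - τ)) x with hd'
  set ρ := fun x => -(τ * S x) + C * Real.exp (-s / 4) * h x + C * κ * d x with hρ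
  have k1 := (i1.const_mul τ).neg
  have k2 := i2.const_mul (C * Real.exp (-s / 4))
  have k3 := i3.const_mul (C * κ)
  have hρi : Integrable ρ := (k1.add k2).add k3
  have hρint : ∫ x, ρ x = -(τ * ∫ x, S x) + C * Real.exp (-s / 4) * (∫ x, h x)
      + C * κ * ∫ x, d x := by
    have e1 := integral_add (k1.add k2) k3
    have e2 := integral_add k1 k2
    simp only [Pi.add_apply, Pi.neg_apply] at e1 e2
    rw [hρ, e1, e2, integral_neg, integral_const_mul, integral_const_mul, integral_const_mul]
  have hle : ∀ x, c₀ * dissipationDensity A m U φ T τ x ≤ ρ x ∧ 0 ≤ ρ x := by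
    intro x
    by_cases hx : x ∈ B
    · have h1 := hrate x (mem_closedBall_zero_iff.1 hx)
      have h2 : d x = totalDensity A m U (T - τ) x := indicator_of_mem hx _
      have h4 : 0 ≤ dissipationDensity A m U φ T τ x :=
        (hch.isNearlyFlat hδ hx).dissipationDensity_nonneg
          (by nlinarith [one_le_pow₀ hK (n := 6)]) hτ
      have h5 : c₀ * dissipationDensity A m U φ T τ x ≤ ρ x := by
        simp only [hρ, h2, hh]
        linarith
      exact ⟨h5, (mul_nonneg hc₀.le h4).trans h5⟩
    · have h1 : S x = 0 := weightedEnergyRate_eq_zero hBc.isClosed hψ0 hη0 ht hx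
      have h2 : d x = 0 := indicator_of_notMem hx _
      have h4 : h x = 0 := by simp [hh, hφ.gaussCutoff_eq_zero hx]
      have h5 : dissipationDensity A m U φ T τ x = 0 := by
        simp [dissipationDensity, hφ.gaussCutoff_eq_zero hx]
      simp [hρ, h1, h2, h4, h5]
  have hF : HasDerivAt (selfSimilarEnergy lam T g e φ u) ((∫ x, S x) * τ) s :=
    HasDerivAt.comp (h₂ := fun t => 1 / 2 * ∫ x, similarityWeight lam T φ x t
      * dirichletForm (A x) (fun z => U z t) x) s hd (hasDerivAt_time T s)
  refine ⟨(∫ x, S x) * τ, ∫ x, ρ x, hF,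
    integral_nonneg fun x => (hle x).2, ?_, ?_⟩
  · rw [ofReal_integral_eq_lintegral_ofReal hρi (Filter.Eventually.of_forall fun x => (hle x).2)]
    exact lintegral_mono fun x => ENNReal.ofReal_le_ofReal (hle x).1
  · have h1 := hu.integral_gaussCutoff_le hT hδ hlam hch hφ hs.le
    have h2 : ∫ x, d x ≤ _ := (integral_indicator measurableSet_closedBall).trans_le h3
    have h4 : C * Real.exp (-s / 4) * (∫ x, h x)
        ≤ C * Real.exp (-s / 4) * selfSimilarEnergy lam T g e φ u s := by gcongr
    have h5 := mul_le_mul_of_nonneg_left h2 (mul_nonneg hC hκ)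
    rw [hρint]
    linarith

/-- Integrated form of the crude bound of the dissipation. -/
theorem IsHarmonicHeatFlow.lintegral_dissipation_le (hu : IsHarmonicHeatFlow g N T u) (hT : 0 < T)
    (hch : IsNormalizedChart g δ K p₀ e) (hφ : IsCutoff δ c φ)
    {s C : ℝ} (hC : 0 ≤ C) (hs : -Real.log T < s)
    (hbd : ∀ x : EuclideanSpace ℝ (Fin 2), ‖x‖ ≤ δ →
      dissipationDensity (conformalCoeff g e) (volumeDensity g e)
          (fun x t => u (e.symm x) t) φ T (Real.exp (-s)) x
        ≤ C * (Real.exp (-s) * (volumeDensity g e x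
            * ‖deriv (fun s => u (e.symm x) s) (T - Real.exp (-s))‖ ^ 2)
          + Real.exp s * dirichletForm (conformalCoeff g e x)
            (fun z => u (e.symm z) (T - Real.exp (-s))) x)) :
    ∫⁻ x, ENNReal.ofReal (dissipationDensity (conformalCoeff g e) (volumeDensity g e)
        (fun x t => u (e.symm x) t) φ T (Real.exp (-s)) x)
      ≤ ENNReal.ofReal (C * (Real.exp (-s) * flowDissipation g T u s
        + Real.exp s * (2 * dirichletEnergy g (fun p => u p 0)))) := by
  have ht := time_mem_Ioo hT hs
  have hB : IsCompact (Metric.closedBall (0 : EuclideanSpace ℝ (Fin 2)) δ) :=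
    isCompact_closedBall _ _
  have i1 := ((hu.continuousOn_chart_form hch.mem_atlas (Ioo_subset_Ico_self ht)).mono
    hch.ball_subset).integrableOn_compact (μ := volume) hB
  have i2 := ((hu.continuousOn_chart_deriv hch.mem_atlas ht).mono
    hch.ball_subset).integrableOn_compact (μ := volume) hB
  have h1 := hu.setIntegral_dirichletForm_le hch.mem_atlas hB hch.ball_subset
    (Ioo_subset_Ico_self ht)
  have h2 := hu.setIntegral_deriv_le hch.mem_atlas hB hch.ball_subset ht
  have h3 := hu.energy_time_le hT hs.le
  set d1 := fun x => dirichletForm (conformalCoeff g e x)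
    (fun z => u (e.symm z) (T - Real.exp (-s))) x with hd1
  set d2 := fun x => volumeDensity g e x
    * ‖deriv (fun s => u (e.symm x) s) (T - Real.exp (-s))‖ ^ 2 with hd2
  have hnn : ∀ x ∈ Metric.closedBall (0 : EuclideanSpace ℝ (Fin 2)) δ,
      0 ≤ C * (Real.exp (-s) * d2 x + Real.exp s * d1 x) := by
    intro x hx
    have := (volumeDensity_pos (g := g) hch.mem_atlas (hch.ball_subset hx)).le
    have : 0 ≤ d1 x :=
      (hu.isPatchFlow hch.mem_atlas).coeff_nonneg x (hch.ball_subset hx) _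
    positivity
  have hint : IntegrableOn (fun x => C * (Real.exp (-s) * d2 x + Real.exp s * d1 x))
      (Metric.closedBall 0 δ) :=
    ((i2.const_mul (Real.exp (-s))).add (i1.const_mul (Real.exp s))).const_mul C
  calc _ ≤ ∫⁻ x in Metric.closedBall 0 δ,
        ENNReal.ofReal (C * (Real.exp (-s) * d2 x + Real.exp s * d1 x)) := by
        rw [← lintegral_indicator measurableSet_closedBall]
        refine lintegral_mono fun x => ?_
        by_cases hx : x ∈ Metric.closedBall (0 : EuclideanSpace ℝ (Fin 2)) δ
        · rw [indicator_of_mem hx]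
          exact ENNReal.ofReal_le_ofReal (hbd x (mem_closedBall_zero_iff.1 hx))
        · simp [dissipationDensity, hφ.gaussCutoff_eq_zero hx]
    _ = ENNReal.ofReal (∫ x in Metric.closedBall 0 δ,
        C * (Real.exp (-s) * d2 x + Real.exp s * d1 x)) :=
        (ofReal_integral_eq_lintegral_ofReal hint
          ((ae_restrict_iff' measurableSet_closedBall).2 (Filter.Eventually.of_forall hnn))).symm
    _ ≤ _ := by
        refine ENNReal.ofReal_le_ofReal ?_
        rw [integral_const_mul, integral_add (i2.const_mul _) (i1.const_mul _), integral_const_mul,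
          integral_const_mul]
        have h4 : ∫ x in Metric.closedBall 0 δ, d1 x
          ≤ 2 * dirichletEnergy g (fun p => u p 0) := by linarith
        have h5 : ∫ x in Metric.closedBall 0 δ, d2 x ≤ flowDissipation g T u s := h2
        gcongr

end SelfSimilar

/-! ## Self-similar variables -/

section Rescaling

set_option linter.unusedSectionVars false

/-- Scaling is a measurable equivalence, so the formula holds for arbitrary, possibly
non-measurable, G. -/
theorem lintegral_comp_smul_plane (G : EuclideanSpace ℝ (Fin 2) → ENNReal) {a : ℝ} (ha : 0 < a) :
    ENNReal.ofReal (a ^ 2) * ∫⁻ y, G (a • y) = ∫⁻ x, G x := by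
  have h1 : ∫⁻ y, G (a • y) = ∫⁻ x, G x ∂(Measure.map (fun y => a • y) volume) :=
    (lintegral_map_equiv G
      (Homeomorph.smul (isUnit_iff_ne_zero.2 ha.ne').unit).toMeasurableEquiv).symm
  rw [h1, Measure.map_addHaar_smul volume ha.ne', lintegral_smul_measure, smul_eq_mul, ← mul_assoc,
    ← ENNReal.ofReal_mul (by positivity), finrank_euclideanSpace_fin, abs_of_pos (by positivity),
    mul_inv_cancel₀ (by positivity), ENNReal.ofReal_one, one_mul]

theorem integral_comp_smul_plane (G : EuclideanSpace ℝ (Fin 2) → ℝ) {a : ℝ} (ha : 0 < a) :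
    ∫ y, a ^ 2 * G (a • y) = ∫ x, G x := by
  rw [integral_const_mul, Measure.integral_comp_smul_of_nonneg volume G a (hR := ha.le),
    finrank_euclideanSpace_fin, smul_eq_mul, ← mul_assoc, mul_inv_cancel₀ (by positivity), one_mul]

theorem gradSq_comp_smul {k : ℕ} (G : Matrix (Fin 2) (Fin 2) ℝ)
    (f : EuclideanSpace ℝ (Fin 2) → EuclideanSpace ℝ (Fin k)) (a : ℝ)
    (y : EuclideanSpace ℝ (Fin 2)) :
    gradSq G (fun z => f (a • z)) y = a ^ 2 * gradSq G f (a • y) := by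
  have h : ∀ i, pderiv2 i (fun z => f (a • z)) y = a • pderiv2 i f (a • y) := by
    intro i
    rw [pderiv2, fderiv_comp_smul]
    rfl
  simp only [gradSq, h, inner_smul_left, inner_smul_right, RCLike.conj_to_real, Fin.sum_univ_two]
  ring

theorem exp_neg_half_sq (s : ℝ) : Real.exp (-s / 2) ^ 2 = Real.exp (-s) := by
  rw [← Real.exp_nat_mul]; congr 1; push_cast; ring

theorem norm_sq_div_exp (y : EuclideanSpace ℝ (Fin 2)) (s : ℝ) :
    ‖Real.exp (-s / 2) • y‖ ^ 2 / Real.exp (-s) = ‖y‖ ^ 2 := by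
  rw [norm_smul, Real.norm_eq_abs, abs_of_pos (Real.exp_pos _), mul_pow, exp_neg_half_sq,
    mul_div_cancel_left₀ _ (Real.exp_pos _).ne']

variable {M : Type*} [TopologicalSpace M] [ChartedSpace (EuclideanSpace ℝ (Fin 2)) M]
  [IsManifold (𝓡 2) ∞ M] {g : SurfaceMetric M}
  {e : OpenPartialHomeomorph M (EuclideanSpace ℝ (Fin 2))}
  {k : ℕ} {N : Set (EuclideanSpace ℝ (Fin k))} {T : ℝ} {u : M → ℝ → EuclideanSpace ℝ (Fin k)}
  {δ K c lam : ℝ} {p₀ : M} {φ : EuclideanSpace ℝ (Fin 2) → ℝ}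

theorem gaussCutoff_smul (y : EuclideanSpace ℝ (Fin 2)) (s : ℝ) :
    gaussCutoff φ (Real.exp (-s)) (Real.exp (-s / 2) • y)
      = gaussWeight y * rescaledCutoff φ y s ^ 2 := by
  rw [gaussCutoff, norm_sq_div_exp, gaussWeight, rescaledCutoff]

/-- The factor a² = e^{-s} is exactly the Jacobian of y ↦ a y in the plane: the Dirichlet integrand
is scale invariant in dimension two. -/
theorem rescaledGradSq_mul_density (y : EuclideanSpace ℝ (Fin 2)) (s : ℝ) :
    rescaledGradSq g e T u y s * rescaledVolumeDensity g e y s = Real.exp (-s / 2) ^ 2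
      * dirichletForm (conformalCoeff g e (Real.exp (-s / 2) • y))
        (fun z => u (e.symm z) (T - Real.exp (-s))) (Real.exp (-s / 2) • y) := by
  have h1 : rescaledGradSq g e T u y s = Real.exp (-s / 2) ^ 2 *
      gradSq (metricMatrix g e (Real.exp (-s / 2) • y))
        (fun z => u (e.symm z) (T - Real.exp (-s))) (Real.exp (-s / 2) • y) :=
    gradSq_comp_smul _ (fun z => u (e.symm z) (T - Real.exp (-s))) _ y
  have h2 : rescaledVolumeDensity g e y s = volumeDensity g e (Real.exp (-s / 2) • y) := rfl
  rw [h1, h2, dirichletForm_conformalCoeff]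
  ring

theorem localEnergy_eq (s : ℝ) : localEnergy g e φ T u s
    = 1 / 2 * ∫ x, gaussCutoff φ (Real.exp (-s)) x
      * dirichletForm (conformalCoeff g e x) (fun z => u (e.symm z) (T - Real.exp (-s))) x := by
  refine congrArg (1 / 2 * ·) (Eq.trans ?_
    (integral_comp_smul_plane _ (Real.exp_pos (-s / 2))))
  congr 1
  ext1 y
  beta_reduce
  rw [gaussCutoff_smul]
  linear_combination gaussWeight y * rescaledCutoff φ y s ^ 2
    * rescaledGradSq_mul_density (g := g) (e := e) (T := T) (u := u) y s

theorem localEnergyTwo_eq (s : ℝ) : localEnergyTwo g e φ T u s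
    = 1 / 2 * ∫ x, ‖x‖ ^ 2 / Real.exp (-s) * (gaussCutoff φ (Real.exp (-s)) x
      * dirichletForm (conformalCoeff g e x) (fun z => u (e.symm z) (T - Real.exp (-s))) x) := by
  refine congrArg (1 / 2 * ·) (Eq.trans ?_
    (integral_comp_smul_plane _ (Real.exp_pos (-s / 2))))
  congr 1
  ext1 y
  beta_reduce
  rw [gaussCutoff_smul, norm_sq_div_exp]
  linear_combination gaussWeight y * ‖y‖ ^ 2 * rescaledCutoff φ y s ^ 2
    * rescaledGradSq_mul_density (g := g) (e := e) (T := T) (u := u) y s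

/-- The derivative of the rescaled solution in self-similar time. -/
theorem IsHarmonicHeatFlow.deriv_rescaledSolution (hu : IsHarmonicHeatFlow g N T u) (hT : 0 < T)
    (he : e ∈ IsManifold.maximalAtlas (𝓡 2) ∞ M) {y : EuclideanSpace ℝ (Fin 2)} {s : ℝ}
    (hs : -Real.log T < s) (hy : Real.exp (-s / 2) • y ∈ e.target) :
    deriv (fun σ => rescaledSolution e T u y σ) s
      = Real.exp (-s) • deriv (fun t => u (e.symm (Real.exp (-s / 2) • y)) t) (T - Real.exp (-s))
        - (1 / 2 : ℝ) • radialDeriv (fun z => u (e.symm z) (T - Real.exp (-s)))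
          (Real.exp (-s / 2) • y) := by
  have ht := time_mem_Ioo hT hs
  set x := Real.exp (-s / 2) • y with hx
  set W : EuclideanSpace ℝ (Fin 2) × ℝ → EuclideanSpace ℝ (Fin k) := fun z => u (e.symm z.1) z.2
    with hW
  have hsm : ContDiffOn ℝ ∞ W (e.target ×ˢ Ioo 0 T) := (hu.isPatchFlow he).smooth_Ioo
  have hd : DifferentiableAt ℝ W (x, T - Real.exp (-s)) :=
    (hsm.differentiableOn (by simp)).differentiableAt
      ((e.open_target.prod isOpen_Ioo).mem_nhds ⟨hy, ht⟩)
  have h1 : HasDerivAt (fun σ : ℝ => -σ / 2) (-1 / 2) s := ((hasDerivAt_id s).fun_neg).div_const 2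
  -- The curve σ ↦ (e^{-σ/2}y, T - e^{-σ}) has velocity (-½x, τ), so w_s = τ∂ₜu - ½ x·∇u, the vector
  -- V of the quadratic estimate.
  have hc : HasDerivAt (fun σ : ℝ => (Real.exp (-σ / 2) • y, T - Real.exp (-σ)))
      ((-(1 / 2 : ℝ)) • x, Real.exp (-s)) s := by
    refine HasDerivAt.prodMk ?_ (hasDerivAt_time T s)
    refine (h1.exp.smul_const y).congr_deriv ?_
    rw [hx, smul_smul]
    congr 1
    ring
  have h2 : HasDerivAt (fun σ => rescaledSolution e T u y σ)
      (fderiv ℝ W (x, T - Real.exp (-s)) ((-(1 / 2 : ℝ)) • x, Real.exp (-s))) s :=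
    HasFDerivAt.comp_hasDerivAt (l := W)
      (f := fun σ : ℝ => (Real.exp (-σ / 2) • y, T - Real.exp (-σ))) s hd.hasFDerivAt hc
  have h3 : HasDerivAt (fun t => u (e.symm x) t)
      (fderiv ℝ W (x, T - Real.exp (-s)) (0, 1)) (T - Real.exp (-s)) :=
    HasFDerivAt.comp_hasDerivAt (l := W) (f := fun t : ℝ => (x, t)) (T - Real.exp (-s))
      hd.hasFDerivAt ((hasDerivAt_const _ x).prodMk (hasDerivAt_id _))
  have h4 : HasFDerivAt (fun z => u (e.symm z) (T - Real.exp (-s)))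
      ((fderiv ℝ W (x, T - Real.exp (-s))).comp
        (ContinuousLinearMap.inl ℝ (EuclideanSpace ℝ (Fin 2)) ℝ)) x :=
    HasFDerivAt.comp (g := W) (f := fun z => (z, T - Real.exp (-s))) x hd.hasFDerivAt
      (hasFDerivAt_prodMk_left x (T - Real.exp (-s)))
  rw [h2.deriv, h3.deriv, radialDeriv_eq_fderiv, h4.fderiv]
  simp only [ContinuousLinearMap.comp_apply, ContinuousLinearMap.inl_apply]
  rw [← map_smul, ← map_smul, ← map_sub]
  congr 1
  ext1
  · simp
  · simp

/-- Under x = e^{-s/2}y one has dy = dx/τ. This explains the 1/τ at the |w_s|² term of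
`dissipationDensity` and its absence at the scale-invariant gradient term. -/
theorem IsHarmonicHeatFlow.lintegral_rescaled (hu : IsHarmonicHeatFlow g N T u) (hT : 0 < T)
    (hch : IsNormalizedChart g δ K p₀ e) (hφ : IsCutoff δ c φ) {s : ℝ} (hs : -Real.log T < s) :
    ∫⁻ y : EuclideanSpace ℝ (Fin 2), ENNReal.ofReal
        ((gaussWeight y * (‖y‖ ^ 2 + 1) * ‖deriv (fun σ => rescaledSolution e T u y σ) s‖ ^ 2
            * rescaledCutoff φ y s ^ 2
          + gaussWeight y * ‖y‖ ^ 2 * rescaledGradSq g e T u y s * rescaledCutoff φ y s ^ 2)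
          * rescaledVolumeDensity g e y s)
      = ∫⁻ x, ENNReal.ofReal (dissipationDensity (conformalCoeff g e) (volumeDensity g e)
        (fun x t => u (e.symm x) t) φ T (Real.exp (-s)) x) := by
  refine Eq.trans ?_ (lintegral_comp_smul_plane _ (Real.exp_pos (-s / 2)))
  rw [← lintegral_const_mul' _ _ ENNReal.ofReal_ne_top]
  congr 1
  ext1 y
  beta_reduce
  rw [← ENNReal.ofReal_mul (by positivity)]
  congr 1
  by_cases hy : Real.exp (-s / 2) • y ∈ Metric.closedBall (0 : EuclideanSpace ℝ (Fin 2)) δ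
  · have h1 := rescaledGradSq_mul_density (g := g) (e := e) (T := T) (u := u) y s
    have h2 : rescaledVolumeDensity g e y s = volumeDensity g e (Real.exp (-s / 2) • y) := rfl
    rw [dissipationDensity, gaussCutoff_smul, norm_sq_div_exp,
      hu.deriv_rescaledSolution hT hch.mem_atlas hs (hch.ball_subset hy), ← h2]
    have h3 := exp_neg_half_sq s
    have h4 := Real.exp_pos (-s)
    rw [h3] at h1 ⊢
    rw [neg_div] at h1
    field_simp
    linear_combination gaussWeight y * ‖y‖ ^ 2 * rescaledCutoff φ y s ^ 2 * h1
  · have h1 : rescaledCutoff φ y s = 0 := hφ.eq_zero _ hy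
    simp [dissipationDensity, hφ.gaussCutoff_eq_zero hy, h1]

theorem IsHarmonicHeatFlow.localEnergy_add_eq [T2Space M] [CompactSpace M]
    [MeasurableSpace M] [BorelSpace M] (hu : IsHarmonicHeatFlow g N T u) (hT : 0 < T)
    (hch : IsNormalizedChart g δ K p₀ e) (hφ : IsCutoff δ c φ) {s : ℝ} (hs : -Real.log T ≤ s) :
    localEnergyTwo g e φ T u s + lam * localEnergy g e φ T u s
      = selfSimilarEnergy lam T g e φ u s := by
  have ht := time_mem_Ico hT hs
  have h1 := hu.integrable_weight_mul hch hφ ht (χ := fun x => ‖x‖ ^ 2 / Real.exp (-s))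
    (by fun_prop) (Real.exp (-s))
  have h2 := hu.integrable_weight_mul hch hφ ht (χ := fun _ => lam) continuous_const (Real.exp (-s))
  rw [localEnergyTwo_eq, localEnergy_eq, selfSimilarEnergy_eq]
  simp only [add_mul]
  rw [integral_add h1 h2, integral_const_mul]
  ring

end Rescaling

/-! ## The main theorem -/

theorem exists_growthFactor_le (C : ℝ) {kap : ℝ} (hkap : 0 < kap) :
    ∃ s₀ : ℝ, 0 ≤ s₀ ∧ growthFactor C s₀ ≤ 1 + kap⁻¹ := by
  have h1 : Filter.Tendsto (fun s : ℝ => -s / 4) Filter.atTop Filter.atBot :=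
    Filter.tendsto_neg_atTop_atBot.atBot_div_const (by norm_num)
  have h2 : Filter.Tendsto (growthFactor C) Filter.atTop (𝓝 1) := by
    have h3 := ((Real.tendsto_exp_atBot.comp h1).const_mul (4 * C)).rexp
    have h4 : growthFactor C = fun s => Real.exp (4 * C * Real.exp (-s / 4)) := rfl
    rw [h4]
    simpa [Function.comp_def] using h3
  have h4 : ∀ᶠ s in Filter.atTop, growthFactor C s ≤ 1 + kap⁻¹ :=
    (h2.eventually_lt_const (by simpa using hkap)).mono fun _ h => h.le
  obtain ⟨s, hs1, hs2⟩ := (h4.and (Filter.eventually_ge_atTop 0)).exists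
  exact ⟨s, hs2, hs1⟩

/-! ### Dissipation at early times -/

section Flow

variable {M : Type*} [TopologicalSpace M] [T2Space M] [CompactSpace M]
  [ChartedSpace (EuclideanSpace ℝ (Fin 2)) M] [IsManifold (𝓡 2) ∞ M]
  [MeasurableSpace M] [BorelSpace M] {g : SurfaceMetric M}
  {k : ℕ} {N : Set (EuclideanSpace ℝ (Fin k))} {T : ℝ} {u : M → ℝ → EuclideanSpace ℝ (Fin k)}

/-- Before self-similar time `b`, an integrand bounded by the global dissipation has integral
controlled by the initial energy. -/
theorem IsHarmonicHeatFlow.lintegral_Ioc_le (hu : IsHarmonicHeatFlow g N T u) (hT : 0 < T)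
    {J : ℝ → ENNReal} {C b : ℝ} (hC : 0 ≤ C) (hb : -Real.log T ≤ b)
    (hJ : ∀ s, -Real.log T < s → J s ≤ ENNReal.ofReal (C * (Real.exp (-s) * flowDissipation g T u s
      + Real.exp s * (2 * dirichletEnergy g (fun p => u p 0))))) :
    ∫⁻ s in Ioc (-Real.log T) b, J s ≤ ENNReal.ofReal
      (C * (1 + 2 * Real.exp b) * dirichletEnergy g (fun p => u p 0)) := by
  set a := -Real.log T with ha
  set E₀ := dirichletEnergy g (fun p => u p 0) with hE₀
  have hE₀0 : 0 ≤ E₀ := dirichletEnergy_nonneg _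
  -- A function whose derivative is minus the assumed bound: E accounts for e^{-s}∫|∂ₜu|², and e^s
  -- is its own primitive, which stays bounded by e^b however large T is.
  set H : ℝ → ℝ := fun s => C * (dirichletEnergy g (fun p => u p (T - Real.exp (-s)))
    - Real.exp s * (2 * E₀)) with hH
  have hd : ∀ s ∈ Ioc a b, HasDerivAt H (C * (-(Real.exp (-s) * flowDissipation g T u s)
      - Real.exp s * (2 * E₀))) s := fun s hs =>
    (((hu.hasDerivAt_energy_time hT hs.1).sub
      ((Real.hasDerivAt_exp s).mul_const (2 * E₀))).const_mul C)
  have hc : ContinuousOn H (Icc a b) :=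
    continuousOn_const.mul (((hu.continuousOn_energy_time hT).mono Icc_subset_Ici_self).sub
      (by fun_prop))
  have h1 := lintegral_Ioc_le_of_hasDerivAt (R := fun s => C * (Real.exp (-s)
    * flowDissipation g T u s + Real.exp s * (2 * E₀))) hb hc hd
    (fun s _ => le_of_eq (by ring)) (fun s _ => by
      have := flowDissipation_nonneg (g := g) (T := T) (u := u) s
      positivity)
  refine (setLIntegral_mono' measurableSet_Ioc fun s hs => hJ s hs.1).trans (h1.trans ?_)
  refine ENNReal.ofReal_le_ofReal ?_
  have h2 := hu.energy_time_le hT (s := a) le_rfl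
  have h3 : 0 ≤ dirichletEnergy g (fun p => u p (T - Real.exp (-b))) := dirichletEnergy_nonneg _
  have h4 : 0 ≤ Real.exp a * (2 * E₀) := by positivity
  have h5 : H a - H b ≤ C * (E₀ + Real.exp b * (2 * E₀)) := by
    simp only [hH]
    rw [← mul_sub]
    refine mul_le_mul_of_nonneg_left ?_ hC
    linarith
  exact h5.trans (le_of_eq (by ring))

end Flow

theorem proposition2p2 (δ K c lam kap : ℝ) (hδ : 0 < δ) (hlam : 8 < lam) (hkap : 1 < kap) :
    ∃ C s₀ : ℝ,
      ∀ (M : Type*) [TopologicalSpace M] [T2Space M] [CompactSpace M]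
        [ChartedSpace (EuclideanSpace ℝ (Fin 2)) M] [IsManifold (𝓡 2) ∞ M]
        [MeasurableSpace M] [BorelSpace M] (g : SurfaceMetric M) (p₀ : M)
        (e : OpenPartialHomeomorph M (EuclideanSpace ℝ (Fin 2)))
        (φ : EuclideanSpace ℝ (Fin 2) → ℝ)
        (n k : ℕ) (N : Set (EuclideanSpace ℝ (Fin k)))
        (T : ℝ) (u : M → ℝ → EuclideanSpace ℝ (Fin k)),
        IsNormalizedChart g δ K p₀ e → IsCutoff δ c φ → IsEmbeddedSubmanifold n N → 0 < T →
        IsHarmonicHeatFlow g N T u →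
        (∀ s' s : ℝ, s₀ ≤ s' → -Real.log T ≤ s' → s' < s →
          localEnergyTwo g e φ T u s + lam * localEnergy g e φ T u s ≤
            (1 + kap⁻¹) * (localEnergyTwo g e φ T u s' + lam * localEnergy g e φ T u s')
              + C * Real.exp (-kap * s') * dirichletEnergy g (fun p => u p 0)) ∧
        ∫⁻ s in Ioi (-Real.log T), ∫⁻ y : EuclideanSpace ℝ (Fin 2),
          ENNReal.ofReal
            ((gaussWeight y * (‖y‖ ^ 2 + 1) * ‖deriv (fun σ => rescaledSolution e T u y σ) s‖ ^ 2
                * rescaledCutoff φ y s ^ 2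
              + gaussWeight y * ‖y‖ ^ 2 * rescaledGradSq g e T u y s * rescaledCutoff φ y s ^ 2)
              * rescaledVolumeDensity g e y s)
          ≤ ENNReal.ofReal (C * dirichletEnergy g (fun p => u p 0)) := by
  -- For K < 1 no normalized chart exists, because the metric at the origin is the identity.
  rcases lt_or_ge K 1 with hK1 | hK1
  · exact ⟨0, 0, fun M _ _ _ _ _ _ _ g p₀ e φ n k N T u hch => absurd (hch.one_le hδ) hK1.not_ge⟩
  have hL : 1 ≤ 4 * K ^ 6 := by nlinarith [one_le_pow₀ hK1 (n := 6)]
  set q := ⌈kap⌉₊ with hq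
  have hqk : kap ≤ q := Nat.le_ceil kap
  -- The order q + 1 exceeds the required decay q ≥ κ by one, the exponential lost in absorbing the
  -- dissipation.
  obtain ⟨c₀, hc₀, C₁, hC₁, hrate⟩ := exists_rate_bound hδ hlam hL c (q + 1)
  obtain ⟨C₂, hC₂, hcrude⟩ := exists_dissipation_bound hδ hL c
  obtain ⟨s₀, hs₀, hgrow⟩ := exists_growthFactor_le C₁ (by linarith : 0 < kap)
  set μ := growthFactor C₁ 0 with hμ
  have hμ1 : 1 ≤ μ := one_le_growthFactor hC₁ 0
  set B := lam * (4 ^ 1 * (1 : ℕ).factorial * Real.exp (1 / 4)) with hB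
  have hB0 : 0 ≤ B := by rw [hB]; positivity
  -- One constant serves both claims: 3μC₁ for the monotonicity, the C₂ term for the times s ≤ 0,
  -- and the c₀⁻¹ term for the later times.
  refine ⟨3 * μ * C₁ + C₂ * (1 + 2 * Real.exp 0) + c₀⁻¹ * (μ * B + 3 * μ * C₁), s₀, ?_⟩
  intro M _ _ _ _ _ _ _ g p₀ e φ n k N T u hch hφ _ hT hu
  set a := -Real.log T with ha
  set E₀ := dirichletEnergy g (fun p => u p 0) with hE₀
  have hE₀0 : 0 ≤ E₀ := dirichletEnergy_nonneg _
  set F := selfSimilarEnergy lam T g e φ u with hF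
  set E : ℝ → ℝ := fun s => dirichletEnergy g (fun p => u p (T - Real.exp (-s))) with hE
  have hF0 : ∀ s, 0 ≤ F s := fun s => selfSimilarEnergy_nonneg hδ (by linarith) hch hφ s
  have hE0 : ∀ s, 0 ≤ E s := fun s => dirichletEnergy_nonneg _
  have hFc : ContinuousOn F (Ici a) := hu.continuousOn_selfSimilarEnergy hT hch hφ
  have hEc : ContinuousOn E (Ici a) := hu.continuousOn_energy_time hT
  have hE1 : ∀ s, a ≤ s → E s ≤ E₀ := fun s hs => hu.energy_time_le hT hs
  have hEd : ∀ s, a < s → HasDerivAt E (-(Real.exp (-s) * flowDissipation g T u s)) s :=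
    fun s hs => hu.hasDerivAt_energy_time hT hs
  have hex : ∀ s, a < s ∧ 0 ≤ s → ∃ F' R : ℝ, HasDerivAt F F' s ∧ 0 ≤ R ∧
      ∫⁻ x, ENNReal.ofReal (c₀ * dissipationDensity (conformalCoeff g e) (volumeDensity g e)
        (fun x t => u (e.symm x) t) φ T (Real.exp (-s)) x) ≤ ENNReal.ofReal R ∧
      F' ≤ -R + C₁ * Real.exp (-s / 4) * F s + C₁ * Real.exp (-((q + 1 : ℕ) * s))
        * (2 * E s + flowDissipation g T u s) := fun s hs =>
    hu.selfSimilarEnergy_rate hT hδ (by linarith) hch hφ hc₀ hC₁ hs.1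
      (fun x hx => hrate k _ _ _ φ x T s hs.2 hφ hx
        (hch.isNearlyFlat hδ (mem_closedBall_zero_iff.2 hx))) (Real.exp_pos _).le
  -- F' and R become total functions of s, with arbitrary values where s ≤ -log T or s < 0; only s
  -- beyond both thresholds is used.
  choose! F' R hF' hR0 hR hle using hex
  constructor
  · intro s' s hs₀' has' hss
    rw [hu.localEnergy_add_eq hT hch hφ (has'.trans hss.le), hu.localEnergy_add_eq hT hch hφ has']
    have hs'0 : 0 ≤ s' := hs₀.trans hs₀'
    have h1 := le_of_lyapunov (n := q) (E₀ := E₀) hC₁ hs'0 hss (hFc.mono (Ici_subset_Ici.2 has'))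
      (hEc.mono (Ici_subset_Ici.2 has')) (fun s _ => hF0 s) (fun s _ => hE0 s)
      (fun s hs => hE1 s (has'.trans hs)) (fun s hs => hEd s (has'.trans_lt hs))
      (fun s _ => flowDissipation_nonneg s)
      (fun s hs => hF' s ⟨has'.trans_lt hs, hs'0.trans (mem_Ioi.1 hs).le⟩)
      (fun s hs => hle s ⟨has'.trans_lt hs, hs'0.trans (mem_Ioi.1 hs).le⟩)
      (fun s hs => hR0 s ⟨has'.trans_lt hs, hs'0.trans (mem_Ioi.1 hs).le⟩)
    have h2 : growthFactor C₁ s' * F s' ≤ (1 + kap⁻¹) * F s' :=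
      mul_le_mul_of_nonneg_right ((antitone_growthFactor hC₁ hs₀').trans hgrow) (hF0 s')
    have h3 : Real.exp (-(q * s')) ≤ Real.exp (-kap * s') := by
      gcongr
      have := mul_le_mul_of_nonneg_right hqk hs'0
      linarith
    refine h1.trans (add_le_add h2 ?_)
    gcongr
    have : 0 ≤ C₂ * (1 + 2 * Real.exp 0) + c₀⁻¹ * (μ * B + 3 * μ * C₁) := by positivity
    linarith
  · set J : ℝ → ENNReal := fun s => ∫⁻ x, ENNReal.ofReal (dissipationDensity (conformalCoeff g e)
      (volumeDensity g e) (fun x t => u (e.symm x) t) φ T (Real.exp (-s)) x) with hJ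
    rw [setLIntegral_congr_fun measurableSet_Ioi
      (fun s hs => hu.lintegral_rescaled hT hch hφ (s := s) hs)]
    -- The rate estimate requires s ≥ 0. If T ≤ 1 then b = a and the early interval is empty.
    set b := max a 0 with hb
    have hab : a ≤ b := le_max_left _ _
    have hb0 : 0 ≤ b := le_max_right _ _
    have hlate : ∫⁻ s in Ioi b, J s ≤ ENNReal.ofReal (c₀⁻¹ * (μ * B + 3 * μ * C₁) * E₀) := by
      have h1 := lintegral_le_of_lyapunov (n := q) (E₀ := E₀) hC₁ hb0
        (hFc.mono (Ici_subset_Ici.2 hab)) (hEc.mono (Ici_subset_Ici.2 hab)) (fun s _ => hF0 s)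
        (fun s _ => hE0 s) (fun s hs => hE1 s (hab.trans hs)) (fun s hs => hEd s (hab.trans_lt hs))
        (fun s _ => flowDissipation_nonneg s)
        (fun s hs => hF' s ⟨hab.trans_lt hs, hb0.trans (mem_Ioi.1 hs).le⟩)
        (fun s hs => hle s ⟨hab.trans_lt hs, hb0.trans (mem_Ioi.1 hs).le⟩)
        (fun s hs => hR0 s ⟨hab.trans_lt hs, hb0.trans (mem_Ioi.1 hs).le⟩)
      have h2 : ∀ s ∈ Ioi b, J s ≤ ENNReal.ofReal c₀⁻¹ * ENNReal.ofReal (R s) := by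
        intro s hs
        have h3 := hR s ⟨hab.trans_lt hs, hb0.trans (mem_Ioi.1 hs).le⟩
        simp only [ENNReal.ofReal_mul hc₀.le] at h3
        rw [lintegral_const_mul' _ _ ENNReal.ofReal_ne_top] at h3
        calc J s = ENNReal.ofReal c₀⁻¹ * (ENNReal.ofReal c₀ * J s) := by
              rw [← mul_assoc, ← ENNReal.ofReal_mul (by positivity), inv_mul_cancel₀ hc₀.ne',
                ENNReal.ofReal_one, one_mul]
          _ ≤ _ := by gcongr
      have h4 : F b ≤ B * E₀ := hu.selfSimilarEnergy_le hT hδ (by linarith) hch hφ hab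
      calc ∫⁻ s in Ioi b, J s ≤ ∫⁻ s in Ioi b, ENNReal.ofReal c₀⁻¹ * ENNReal.ofReal (R s) :=
            setLIntegral_mono' measurableSet_Ioi h2
        _ = ENNReal.ofReal c₀⁻¹ * ∫⁻ s in Ioi b, ENNReal.ofReal (R s) :=
            lintegral_const_mul' _ _ ENNReal.ofReal_ne_top
        _ ≤ ENNReal.ofReal c₀⁻¹ * ENNReal.ofReal (μ * F b + 3 * μ * C₁ * E₀) := by gcongr
        _ = ENNReal.ofReal (c₀⁻¹ * (μ * F b + 3 * μ * C₁ * E₀)) :=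
            (ENNReal.ofReal_mul (by positivity)).symm
        _ ≤ _ := by
            refine ENNReal.ofReal_le_ofReal ?_
            calc c₀⁻¹ * (μ * F b + 3 * μ * C₁ * E₀) ≤ c₀⁻¹ * (μ * (B * E₀) + 3 * μ * C₁ * E₀) := by
                  gcongr
              _ = _ := by ring
    have hearly : ∫⁻ s in Ioc a b, J s ≤ ENNReal.ofReal (C₂ * (1 + 2 * Real.exp 0) * E₀) := by
      rcases le_total a 0 with h0 | h0
      · rw [hb, max_eq_right h0]
        exact hu.lintegral_Ioc_le hT hC₂ h0 fun s hs => hu.lintegral_dissipation_le hT hch hφ hC₂ hs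
          fun x hx => hcrude k _ _ _ φ x T s hφ hx
            (hch.isNearlyFlat hδ (mem_closedBall_zero_iff.2 hx))
      · rw [hb, max_eq_left h0, Ioc_self]
        simp
    rw [← Ioc_union_Ioi_eq_Ioi hab]
    refine (lintegral_union_le _ _ _).trans ((add_le_add hearly hlate).trans ?_)
    rw [← ENNReal.ofReal_add (by positivity) (by positivity)]
    refine ENNReal.ofReal_le_ofReal ?_
    have : 0 ≤ 3 * μ * C₁ * E₀ := by positivity
    linarith

end
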